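/- Let $f\in C^5(\mathbb R)$ with $f''(u)>0$ for all $u\in\mathbb R$, let $u_-<u_+$, let $\alpha,\beta,\gamma>0$ and $\delta\in\mathbb R$, and let $\epsilon>0$, $q>\tfrac12$. Put $\lambda=f'$ and $\lambda_\pm=f'(u_\pm)$, and let $$w_0(x)=\frac{\lambda_-+\lambda_+}{2}+\frac{\lambda_+-\lambda_-}{2}\,K_q\int_0^{\epsilon x}\frac{dy}{(1+y^2)^q},\qquad K_q\int_0^\infty\frac{dy}{(1+y^2)^q}=1 .$$ Let $w$ be the classical solution of $\partial_t w+\partial_x(\tfrac12 w^2)=0$, $w(0,\cdot)=w_0$, that is, $w(t,x)=w_0(x_0(t,x))$ where $x_0=x_0(t,x)$ is the unique solution of $x=x_0+w_0(x_0)\,t$. Let $U^r(t,x)=\lambda^{-1}(w(t,x))$ be the smooth approximate rarefaction wave, and let $$F(U^r)=\alpha\,\partial_t\partial_x^2U^r+\beta\,\partial_x^2U^r-\delta\,\partial_x^3U^r-\gamma\,\partial_x^4U^r .$$ Write $H^k=H^k(\mathbb R)$, with $\|v\|_{H^k}^2=\sum_{j=0}^k\|\partial_x^jv\|_{L^2}^2$.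 **Theorem 3.3 (a priori estimates).** For every $\phi_0\in H^3$ there is a constant $C_{\phi_0}>0$ (it may also depend on the fixed data $f,u_\pm,\alpha,\beta,\gamma,\delta,\epsilon,q$, but not on $T$, $t$ or the solution) such that the following holds. If $T>0$ and $\phi$ is a solution on $[0,T]$ of the Cauchy problem $$\partial_t\phi+\partial_x\big(f(\phi+U^r)-f(U^r)\big)-\alpha\,\partial_t\partial_x^2\phi-\beta\,\partial_x^2\phi+\gamma\,\partial_x^4\phi=F(U^r),\qquad \phi(0,\cdot)=\phi_0,$$ in the class $$\phi\in C^0([0,T];H^3),\qquad \partial_x\phi\in L^2(0,T;H^3),\qquad \partial_t\phi\in L^2(0,T;H^2)$$ (derivatives of $\phi$ in the weak sense, the equation holding in $L^2(\mathbb R)$ for almost every $t\in(0,T)$), then for every $t\in[0,T]$ $$\|\phi(t)\|_{H^3}^2+\int_0^t\big\|\big(\sqrt{\partial_xU^r}\,\phi\big)(\tau)\big\|_{L^2}^2\,d\tau+\int_0^t\|\partial_x\phi(\tau)\|_{H^3}^2\,d\tau+\int_0^t\|\partial_t\phi(\tau)\|_{H^2}^2\,d\tau\le C_{\phi_0}.$$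 -/

import Mathlib

open MeasureTheory Set Filter Topology
open scoped ENNReal NNReal ContDiff

noncomputable section

namespace BBMB

/-! ## Sobolev spaces on the real line -/

/-- `h` is the weak (distributional) derivative of `g` on `ℝ`. -/
def IsWeakDeriv (g h : ℝ → ℝ) : Prop :=
  LocallyIntegrable g volume ∧ LocallyIntegrable h volume ∧
    ∀ θ : ℝ → ℝ, ContDiff ℝ ∞ θ → HasCompactSupport θ →
      ∫ x, g x * deriv θ x = -∫ x, h x * θ x

theorem IsWeakDeriv.congr_ae {g g' h h' : ℝ → ℝ} (H : IsWeakDeriv g h)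
    (hg : g =ᵐ[volume] g') (hh : h =ᵐ[volume] h') : IsWeakDeriv g' h' := by
  obtain ⟨h1, h2, h3⟩ := H
  refine ⟨h1.congr hg, h2.congr hh, fun θ hθ hc => ?_⟩
  have e1 : ∫ x, g' x * deriv θ x = ∫ x, g x * deriv θ x :=
    integral_congr_ae (by filter_upwards [hg] with x hx; rw [hx])
  have e2 : ∫ x, h' x * θ x = ∫ x, h x * θ x :=
    integral_congr_ae (by filter_upwards [hh] with x hx; rw [hx])
  rw [e1, e2, h3 θ hθ hc]

theorem integrable_mul_test {g θ : ℝ → ℝ} (hg : LocallyIntegrable g volume)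
    (hθ : Continuous θ) (hc : HasCompactSupport θ) : Integrable (fun x => g x * θ x) := by
  have := hg.integrable_smul_left_of_hasCompactSupport hθ hc
  simpa [mul_comm] using this

theorem IsWeakDeriv.zero : IsWeakDeriv (fun _ => 0) (fun _ => 0) :=
  ⟨locallyIntegrable_const _, locallyIntegrable_const _, fun θ _ _ => by simp⟩

theorem IsWeakDeriv.add {g g' h h' : ℝ → ℝ} (H : IsWeakDeriv g h) (H' : IsWeakDeriv g' h') :
    IsWeakDeriv (fun x => g x + g' x) (fun x => h x + h' x) := by
  obtain ⟨h1, h2, h3⟩ := H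
  obtain ⟨h1', h2', h3'⟩ := H'
  refine ⟨h1.add h1', h2.add h2', fun θ hθ hc => ?_⟩
  have cd : Continuous (deriv θ) := hθ.continuous_deriv (by simp)
  simp only [add_mul]
  rw [integral_add (integrable_mul_test h1 cd hc.deriv) (integrable_mul_test h1' cd hc.deriv),
    integral_add (integrable_mul_test h2 hθ.continuous hc)
      (integrable_mul_test h2' hθ.continuous hc), h3 θ hθ hc, h3' θ hθ hc]
  ring

theorem IsWeakDeriv.const_mul {g h : ℝ → ℝ} (c : ℝ) (H : IsWeakDeriv g h) :
    IsWeakDeriv (fun x => c * g x) (fun x => c * h x) := by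
  obtain ⟨h1, h2, h3⟩ := H
  refine ⟨h1.smul c, h2.smul c, fun θ hθ hc => ?_⟩
  simp only [mul_assoc]
  rw [integral_const_mul, integral_const_mul, h3 θ hθ hc]
  ring

/-- The real Sobolev space `H^k(ℝ)`: an element is the tuple `(v, ∂ₓv, …, ∂ₓ^k v)` of square
integrable functions, each one the weak derivative of the preceding one. As a subspace of the
Hilbert sum of `k + 1` copies of `L²(ℝ)` it carries the norm `(∑_{j ≤ k} ‖∂ₓ^j v‖²_{L²})^{1/2}`. -/
def Sob (k : ℕ) : Submodule ℝ (PiLp 2 (fun _ : Fin (k + 1) => Lp ℝ 2 (volume : Measure ℝ))) where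
  carrier := {v | ∀ j : Fin k, IsWeakDeriv (v j.castSucc) (v j.succ)}
  zero_mem' := fun _ => IsWeakDeriv.zero.congr_ae
    (Lp.coeFn_zero ℝ 2 (volume : Measure ℝ)).symm (Lp.coeFn_zero ℝ 2 (volume : Measure ℝ)).symm
  add_mem' := fun {a b} ha hb j => ((ha j).add (hb j)).congr_ae
    (Lp.coeFn_add (a j.castSucc) (b j.castSucc)).symm (Lp.coeFn_add (a j.succ) (b j.succ)).symm
  smul_mem' := fun c a ha j => ((ha j).const_mul c).congr_ae
    (Lp.coeFn_smul c (a j.castSucc)).symm (Lp.coeFn_smul c (a j.succ)).symm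

/-- The `j`-th weak derivative `∂ₓ^j v ∈ L²(ℝ)` of `v ∈ H^k(ℝ)`; `v` itself for `j = 0`. -/
def wd {k : ℕ} (v : Sob k) (j : Fin (k + 1)) : Lp ℝ 2 (volume : Measure ℝ) :=
  (v : PiLp 2 (fun _ : Fin (k + 1) => Lp ℝ 2 (volume : Measure ℝ))) j

/-! ## The smooth approximation of the rarefaction wave -/

/-- The initial datum
`w₀(x) = (w₋ + w₊)/2 + (w₊ - w₋)/2 · K_q ∫₀^{εx} dy/(1 + y²)^q`,
with `K_q` normalised by `K_q ∫₀^∞ dy/(1 + y²)^q = 1`. -/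
def burgersData (wm wp ε q x : ℝ) : ℝ :=
  (wm + wp) / 2 + (wp - wm) / 2 *
    (∫ y in Ioi (0 : ℝ), 1 / (1 + y ^ 2) ^ q)⁻¹ * ∫ y in (0 : ℝ)..(ε * x), 1 / (1 + y ^ 2) ^ q

/-- The characteristic map of the Burgers equation at time `t`: `x₀ ↦ x₀ + w₀(x₀) t`. -/
def charMap (wm wp ε q t y : ℝ) : ℝ := y + burgersData wm wp ε q y * t

theorem continuous_kernel (q : ℝ) : Continuous (fun y : ℝ => 1 / (1 + y ^ 2) ^ q) := by
  have h : ∀ y : ℝ, 0 < 1 + y ^ 2 := fun y => by positivity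
  refine continuous_const.div ?_ (fun y => (Real.rpow_pos_of_pos (h y) q).ne')
  exact (by fun_prop : Continuous fun y : ℝ => 1 + y ^ 2).rpow_const
    (fun y => Or.inl (h y).ne')

theorem continuous_burgersData (wm wp ε q : ℝ) : Continuous (burgersData wm wp ε q) := by
  have h : Continuous fun z : ℝ => ∫ y in (0 : ℝ)..z, 1 / (1 + y ^ 2) ^ q :=
    intervalIntegral.continuous_primitive
      (fun a b => (continuous_kernel q).intervalIntegrable a b) 0
  exact continuous_const.add (continuous_const.mul (h.comp (continuous_const.mul continuous_id)))

theorem monotone_burgersData {wm wp ε : ℝ} (hw : wm ≤ wp) (hε : 0 ≤ ε) (q : ℝ) :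
    Monotone (burgersData wm wp ε q) := by
  intro a b hab
  have pos : ∀ y : ℝ, 0 ≤ 1 / (1 + y ^ 2) ^ q := fun y => by positivity
  have hK : 0 ≤ ∫ y in Ioi (0 : ℝ), 1 / (1 + y ^ 2) ^ q := integral_nonneg pos
  have hI : (∫ y in (0 : ℝ)..(ε * a), 1 / (1 + y ^ 2) ^ q)
      ≤ ∫ y in (0 : ℝ)..(ε * b), 1 / (1 + y ^ 2) ^ q := by
    have ii := fun c d : ℝ => (continuous_kernel q).intervalIntegrable c d (μ := volume)
    rw [← sub_nonneg, intervalIntegral.integral_interval_sub_left (ii _ _) (ii _ _)]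
    exact intervalIntegral.integral_nonneg (mul_le_mul_of_nonneg_left hab hε) (fun y _ => pos y)
  have hc : 0 ≤ (wp - wm) / 2 * (∫ y in Ioi (0 : ℝ), 1 / (1 + y ^ 2) ^ q)⁻¹ :=
    mul_nonneg (by linarith) (inv_nonneg.2 hK)
  unfold burgersData
  linarith [mul_le_mul_of_nonneg_left hI hc]

/-- Characteristics neither cross nor leave gaps: each `(t, x)` with `t ≥ 0` lies on exactly one. -/
theorem charMap_bijective {wm wp ε t : ℝ} (hw : wm ≤ wp) (hε : 0 ≤ ε) (ht : 0 ≤ t) (q : ℝ) :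
    Function.Bijective (charMap wm wp ε q t) := by
  have hm := monotone_burgersData hw hε q
  refine ⟨StrictMono.injective fun a b hab => ?_, Continuous.surjective ?_ ?_ ?_⟩
  · have := mul_le_mul_of_nonneg_right (hm hab.le) ht
    unfold charMap
    linarith
  · exact continuous_id.add ((continuous_burgersData wm wp ε q).mul continuous_const)
  · refine tendsto_atTop_mono' _ ?_
      (tendsto_atTop_add_const_right _ (burgersData wm wp ε q 0 * t) tendsto_id)
    filter_upwards [eventually_ge_atTop 0] with y hy
    have := mul_le_mul_of_nonneg_right (hm hy) ht
    simp only [charMap, id]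
    linarith
  · refine tendsto_atBot_mono' _ ?_
      (tendsto_atBot_add_const_right _ (burgersData wm wp ε q 0 * t) tendsto_id)
    filter_upwards [eventually_le_atBot 0] with y hy
    have := mul_le_mul_of_nonneg_right (hm hy) ht
    simp only [charMap, id]
    linarith

/-- The foot `x₀(t, x)` of the characteristic through `(t, x)`: the unique solution (for `t ≥ 0`)
of `x = x₀ + w₀(x₀) t`. -/
def charFoot (wm wp ε q t x : ℝ) : ℝ := Function.invFun (charMap wm wp ε q t) x

theorem charFoot_spec {wm wp ε t : ℝ} (hw : wm ≤ wp) (hε : 0 ≤ ε) (ht : 0 ≤ t) (q x : ℝ) :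
    charFoot wm wp ε q t x + burgersData wm wp ε q (charFoot wm wp ε q t x) * t = x :=
  Function.invFun_eq ((charMap_bijective hw hε ht q).2 x)

/-- The classical solution `w(t, x) = w₀(x₀(t, x))` of the Burgers equation
`∂ₜw + ∂ₓ(w²/2) = 0`, `w(0, ·) = w₀`, given by the method of characteristics. -/
def burgersSol (wm wp ε q t x : ℝ) : ℝ := burgersData wm wp ε q (charFoot wm wp ε q t x)

/-- The smooth approximate rarefaction wave
`U(t, x) = (f')⁻¹ (w(t, x ; f'(u₋), f'(u₊)))`. -/
def rarefaction (f : ℝ → ℝ) (um up ε q t x : ℝ) : ℝ :=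
  Function.invFun (deriv f) (burgersSol (deriv f um) (deriv f up) ε q t x)

/-! ## The reformulated Cauchy problem -/

/-- `F(U) = α ∂ₜ∂ₓ²U + β ∂ₓ²U - δ ∂ₓ³U - γ ∂ₓ⁴U`. -/
def source (α β γ δ : ℝ) (U : ℝ → ℝ → ℝ) (t x : ℝ) : ℝ :=
  α * deriv (fun s => iteratedDeriv 2 (U s) x) t + β * iteratedDeriv 2 (U t) x
    - δ * iteratedDeriv 3 (U t) x - γ * iteratedDeriv 4 (U t) x

/-- `v` is the weak time derivative on `(0, T)` of the `L²(ℝ)`-valued function `u`. -/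
def IsWeakTimeDeriv (T : ℝ) (u v : ℝ → Lp ℝ 2 (volume : Measure ℝ)) : Prop :=
  ∀ θ : ℝ → ℝ, ContDiff ℝ ∞ θ → HasCompactSupport θ → tsupport θ ⊆ Ioo 0 T →
    ∫ t in Ioo 0 T, deriv θ t • u t = -∫ t in Ioo 0 T, θ t • v t

/-- `φ`, with `φx = ∂ₓφ` and `φt = ∂ₜφ`, solves on `[0, T]`
`∂ₜφ + ∂ₓ(f(φ + U) - f(U)) - α ∂ₜ∂ₓ²φ - β ∂ₓ²φ + γ ∂ₓ⁴φ = F(U)`, `φ(0) = φ₀`, in the class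
`φ ∈ C⁰([0, T]; H³)`, `∂ₓφ ∈ L²(0, T; H³)`, `∂ₜφ ∈ L²(0, T; H²)`. The equation is an identity
in `L²(ℝ)` for almost every time; all the space derivatives are weak ones. -/
structure IsSolution (f : ℝ → ℝ) (α β γ δ : ℝ) (U : ℝ → ℝ → ℝ) (T : ℝ) (φ₀ : Sob 3)
    (φ φx : ℝ → Sob 3) (φt : ℝ → Sob 2) : Prop where
  continuousOn : ContinuousOn φ (Icc 0 T)
  memLp_dx : MemLp φx 2 (volume.restrict (Ioo 0 T))
  memLp_dt : MemLp φt 2 (volume.restrict (Ioo 0 T))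
  dx_eq : ∀ᵐ t ∂(volume.restrict (Ioo 0 T)), wd (φx t) 0 = wd (φ t) 1
  dt_eq : IsWeakTimeDeriv T (fun t => wd (φ t) 0) (fun t => wd (φt t) 0)
  initial : φ 0 = φ₀
  equation : ∀ᵐ t ∂(volume.restrict (Ioo 0 T)), ∃ N : ℝ → ℝ,
    IsWeakDeriv (fun x => f (wd (φ t) 0 x + U t x) - f (U t x)) N ∧
      ∀ᵐ x, wd (φt t) 0 x + N x - α * wd (φt t) 2 x - β * wd (φ t) 2 x + γ * wd (φx t) 3 x
        = source α β γ δ U t x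

end BBMB

end

/-! Write `v₀, …, v₄` for the space derivatives of `φ`, `s₀, s₁, s₂` for those of `∂ₜφ`, `N` for the
weak derivative of the flux difference, and `R = s₀ - α s₂ - β v₂ + γ v₄`, so that the equation
reads `R + N = F(U)`.

Pairing with `φ` makes the linear part produce half the time derivative of `‖v₀‖² + α‖v₁‖²` plus the
dissipation `β‖v₁‖² + γ‖v₂‖²`. Up to an exact derivative, `N φ` equals `Uₓ` times the Taylor
remainder of `f` at `U`. Since `Uₓ ≥ 0` and `f'' > 0`, this contributes a good term, at least a
positive constant times `Q = ∫ Uₓ φ²` (`flux_estimate`). The source is integrable over all positive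
times with values in `L²` (`source_decay`), so the energy is bounded independently of `T`
(`first_energy`).

The energy bounds `sup |φ|`, so `f'` and `f''` are evaluated on a fixed compact interval and `‖N‖²`
is at most a fixed multiple of `‖v₁‖² + Q`, which is already integrable in time. From then on `R` is
a controlled element of `L²` in time and space. The higher estimates are therefore linear: pair `R`
with `v₂`, then with `v₄`, and finally read off `s₀ - α s₂`, whose norm controls all of `s₀, s₁, s₂`
(`exists_energy_bound`). No derivative of `N` is ever taken.

Decay of the source comes from characteristics. With foot `y`, slope `p = w₀'(y)` and `E = 1/(1 + t
p)`, each space derivative acts as `E ∂_y`. A small symbol calculus, uniform in time, bounds the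
second to fourth space derivatives of `U`, and the time derivative of the second, by the weight `p
(p + μ) E²`, where `μ = (1 + (εy)²)^{-1/2}`. After the change of variables `x ↦ y`, the squared `L²`
norm is `O((1 + t)^{-(2 + 2η)})` with `η = 1/(8q)`.

The solution is only weak, so the identities rest on the translation group of `L²`: a weak
derivative is a derivative along translations. Integration by parts and the energy identity for
`‖v₃‖²`, where no `L²`-valued time derivative of `v₃` is available, follow from this by difference
quotients. -/

noncomputable section

namespace BBMB

open scoped RealInnerProductSpace

/-! ### The translation group of `L²(ℝ)` and weak derivatives. -/

/-- The Hilbert space `L²(ℝ)`. -/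
abbrev L2 := Lp ℝ 2 (volume : Measure ℝ)

/-- Translation `g ↦ g(· + s)` on `L²(ℝ)`. -/
def shift (s : ℝ) : L2 →ₗᵢ[ℝ] L2 :=
  Lp.compMeasurePreservingₗᵢ ℝ (fun x : ℝ => x + s) (measurePreserving_add_right volume s)

theorem shift_coeFn (s : ℝ) (g : L2) : shift s g =ᵐ[volume] fun x => g (x + s) :=
  Lp.coeFn_compMeasurePreserving g (measurePreserving_add_right volume s)

theorem shift_add (s r : ℝ) (g : L2) : shift (s + r) g = shift s (shift r g) := by
  refine Lp.ext ?_
  have h1 := (measurePreserving_add_right (volume : Measure ℝ) s).quasiMeasurePreserving.ae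
    (shift_coeFn r g)
  filter_upwards [shift_coeFn (s + r) g, shift_coeFn s (shift r g), h1] with x h2 h3 h4
  rw [h2, h3, h4, add_assoc]

theorem shift_zero (g : L2) : shift 0 g = g := by
  refine Lp.ext ?_
  filter_upwards [shift_coeFn 0 g] with x h
  simpa using h

theorem continuous_shift (g : L2) : Continuous fun s => shift s g := by
  have hc : Continuous fun s : ℝ => (⟨fun x : ℝ => x + s, by fun_prop⟩ : C(ℝ, ℝ)) :=
    ContinuousMap.continuous_of_continuous_uncurry _ (by simpa [Function.uncurry_def] using! (by fun_prop : Continuous fun p : ℝ × ℝ => p.2 + p.1))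
  exact (continuous_const (y := g)).compMeasurePreservingLp hc
    (fun s => measurePreserving_add_right volume s) (by simp)

theorem inner_shift_left (s : ℝ) (g u : L2) : ⟪shift s g, u⟫ = ⟪g, shift (-s) u⟫ := by
  have h : u = shift s (shift (-s) u) := by rw [← shift_add, add_neg_cancel, shift_zero]
  conv_lhs => rw [h]
  exact (shift s).inner_map_map _ _

theorem L2.locallyIntegrable (g : L2) : LocallyIntegrable g volume :=
  (Lp.memLp g).locallyIntegrable (by norm_num)

theorem L2.inner_eq_integral (g h : L2) : ⟪g, h⟫ = ∫ x, g x * h x := by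
  rw [MeasureTheory.L2.inner_def]
  refine integral_congr_ae (Eventually.of_forall fun x => ?_)
  simp [mul_comm]

theorem L2.norm_sq_eq_integral (g : L2) : ‖g‖ ^ 2 = ∫ x, g x ^ 2 := by
  rw [← real_inner_self_eq_norm_sq, L2.inner_eq_integral]
  simp [sq]

theorem memLp_test {θ : ℝ → ℝ} (hθ : ContDiff ℝ ∞ θ) (hc : HasCompactSupport θ) :
    MemLp θ 2 (volume : Measure ℝ) :=
  hθ.continuous.memLp_of_hasCompactSupport hc

theorem inner_toLp {θ : ℝ → ℝ} (hθ : MemLp θ 2 (volume : Measure ℝ)) (g : L2) :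
    ⟪g, hθ.toLp θ⟫ = ∫ x, g x * θ x := by
  rw [L2.inner_eq_integral]
  refine integral_congr_ae ?_
  filter_upwards [hθ.coeFn_toLp] with x hx
  rw [hx]

theorem L2.ext_test {g h : L2} (H : ∀ θ : ℝ → ℝ, ContDiff ℝ ∞ θ → HasCompactSupport θ →
    ∫ x, g x * θ x = ∫ x, h x * θ x) : g = h := by
  refine Lp.ext ?_
  refine ae_eq_of_integral_contDiff_smul_eq (L2.locallyIntegrable g) (L2.locallyIntegrable h)
    fun θ hθ hc => ?_
  simpa [mul_comm] using H θ hθ hc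

theorem contDiff_deriv_test {θ : ℝ → ℝ} (hθ : ContDiff ℝ ∞ θ) : ContDiff ℝ ∞ (deriv θ) :=
  ((contDiff_infty_iff_deriv (𝕜 := ℝ)).1 hθ).2

theorem isWeakDeriv_iff_inner {g h : L2} : IsWeakDeriv g h ↔
    ∀ (θ : ℝ → ℝ) (hθ : ContDiff ℝ ∞ θ) (hc : HasCompactSupport θ),
      ⟪g, (memLp_test (contDiff_deriv_test hθ) hc.deriv).toLp (deriv θ)⟫
        = -⟪h, (memLp_test hθ hc).toLp θ⟫ := by
  simp only [inner_toLp]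
  exact ⟨fun H => H.2.2, fun H => ⟨L2.locallyIntegrable g, L2.locallyIntegrable h, H⟩⟩

/-- The integral is the convolution of `g` with the reflected test function `z ↦ θ (-z)`, so the
derivative falls on the smooth factor. -/
theorem hasDerivAt_integral_shift_test {g θ : ℝ → ℝ} (hg : LocallyIntegrable g volume)
    (hθ : ContDiff ℝ ∞ θ) (hc : HasCompactSupport θ) (s : ℝ) :
    HasDerivAt (fun s => ∫ x, g x * θ (x - s)) (-∫ x, g x * deriv θ (x - s)) s := by
  set η : ℝ → ℝ := fun z => θ (-z) with hη
  have hη1 : ContDiff ℝ 1 η := (hθ.comp contDiff_neg).of_le (by exact_mod_cast le_top)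
  have hηc : HasCompactSupport η := hc.comp_homeomorph (Homeomorph.neg ℝ)
  have := hηc.hasDerivAt_convolution_right (ContinuousLinearMap.mul ℝ ℝ) hg hη1 s
  have hd : ∀ z, deriv η z = -deriv θ (-z) := fun z => deriv_comp_neg θ z
  simp only [convolution, hd] at this
  convert! this using 1
  · funext r; simp [hη, convolution]
  · rw [← integral_neg]; simp

theorem inner_shift_toLp {θ : ℝ → ℝ} (hθ : MemLp θ 2 (volume : Measure ℝ)) (g : L2) (s : ℝ) :
    ⟪shift s g, hθ.toLp θ⟫ = ∫ x, g x * θ (x - s) := by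
  rw [inner_toLp]
  have : ∫ x, g x * θ (x - s) = ∫ x, g (x + s) * θ x := by
    rw [← integral_add_right_eq_self (fun x => g x * θ (x - s)) s]
    simp
  rw [this]
  refine integral_congr_ae ?_
  filter_upwards [shift_coeFn s g] with x hx
  rw [hx]

/-- `h` is the derivative of `g` with respect to the translation group of `L²(ℝ)`. -/
def IsShiftDeriv (g h : L2) : Prop := HasDerivAt (fun s => shift s g) h 0

/-- Paired with a test function, the left side is differentiable in `s`. Its derivative, by the weak
derivative relation for the translated test function, is the pairing of `shift s h`. This turns a
distributional relation into an identity in the norm topology. -/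
theorem IsWeakDeriv.shift_sub {g h : L2} (H : IsWeakDeriv g h) (s : ℝ) :
    shift s g - g = ∫ r in (0 : ℝ)..s, shift r h := by
  refine L2.ext_test fun θ hθ hc => ?_
  have hm := memLp_test hθ hc
  rw [← inner_toLp hm, ← inner_toLp hm, inner_sub_left]
  have hd : ∀ r, HasDerivAt (fun r => ⟪shift r g, hm.toLp θ⟫) ⟪shift r h, hm.toLp θ⟫ r := by
    intro r
    simp only [inner_shift_toLp]
    have := hasDerivAt_integral_shift_test H.1 hθ hc r
    have hθr : ContDiff ℝ ∞ fun x => θ (x - r) := hθ.comp (contDiff_id.sub contDiff_const)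
    have hcr : HasCompactSupport fun x => θ (x - r) := by
      simpa [sub_eq_add_neg] using! hc.comp_homeomorph (Homeomorph.addRight (-r))
    have h2 := H.2.2 _ hθr hcr
    have h3 : ∀ x, deriv (fun x => θ (x - r)) x = deriv θ (x - r) := fun x =>
      deriv_comp_sub_const θ r x
    simp only [h3] at h2
    rwa [h2, neg_neg] at this
  have hcont : Continuous fun r => ⟪shift r h, hm.toLp θ⟫ :=
    (continuous_shift h).inner continuous_const
  have h1 := intervalIntegral.integral_eq_sub_of_hasDerivAt (a := 0) (b := s) (fun r _ => hd r)
    (hcont.intervalIntegrable _ _)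
  have h2 := (innerSL ℝ (hm.toLp θ)).intervalIntegral_comp_comm
    ((continuous_shift h).intervalIntegrable (μ := volume) 0 s)
  simp only [innerSL_apply_apply] at h2
  rw [real_inner_comm (hm.toLp θ) (∫ r in (0 : ℝ)..s, shift r h), ← h2]
  simp only [real_inner_comm _ (hm.toLp θ)] at h1 ⊢
  rw [h1, shift_zero]

theorem IsWeakDeriv.isShiftDeriv {g h : L2} (H : IsWeakDeriv g h) : IsShiftDeriv g h := by
  have h1 := intervalIntegral.integral_hasDerivAt_right
    ((continuous_shift h).intervalIntegrable (μ := volume) 0 0)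
    (continuous_shift h).aestronglyMeasurable.stronglyMeasurableAtFilter
    (continuous_shift h).continuousAt
  rw [shift_zero] at h1
  have h2 := h1.add_const g
  refine h2.congr_of_eventuallyEq (Eventually.of_forall fun s => ?_)
  simp only [← H.shift_sub s, sub_add_cancel]

namespace IsShiftDeriv

variable {g h g' h' u u' : L2}

theorem sub (H : IsShiftDeriv g h) (H' : IsShiftDeriv g' h') :
    IsShiftDeriv (g - g') (h - h') := by
  simpa [IsShiftDeriv, Pi.sub_def] using! HasDerivAt.sub H H'

theorem smul (c : ℝ) (H : IsShiftDeriv g h) : IsShiftDeriv (c • g) (c • h) := by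
  simpa [IsShiftDeriv] using! HasDerivAt.const_smul c H

theorem shift (H : IsShiftDeriv g h) (r : ℝ) : IsShiftDeriv (shift r g) (shift r h) := by
  have := (BBMB.shift r).toContinuousLinearMap.hasFDerivAt.comp_hasDerivAt (0 : ℝ) H
  refine this.congr_of_eventuallyEq (Eventually.of_forall fun s => ?_)
  simp [← shift_add, add_comm]

theorem hasDerivAt (H : IsShiftDeriv g h) (r : ℝ) :
    HasDerivAt (fun s => BBMB.shift s g) (BBMB.shift r h) r := by
  have h1 : HasDerivAt (fun s => BBMB.shift s (BBMB.shift r g)) (BBMB.shift r h) (r - r) := by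
    rw [sub_self]; exact H.shift r
  have h2 := h1.comp_sub_const r r
  simpa [← shift_add] using h2

theorem norm_shift_sub_le (H : IsShiftDeriv g h) (s : ℝ) :
    ‖BBMB.shift s g - g‖ ≤ |s| * ‖h‖ := by
  have := Convex.norm_image_sub_le_of_norm_hasDerivWithin_le (s := univ) (x := 0) (y := s) (C := ‖h‖)
    (f := fun s => BBMB.shift s g)
    (fun r _ => (H.hasDerivAt r).hasDerivWithinAt) (fun r _ => by simp) convex_univ
    (mem_univ _) (mem_univ _)
  simpa [shift_zero, mul_comm] using this

/-- Integration by parts on the line: differentiate `⟪shift s g, u⟫ = ⟪g, shift (-s) u⟫` at `s = 0`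
in both forms. No boundary terms or pointwise representatives occur. -/
theorem inner_eq_neg (H : IsShiftDeriv g h) (H' : IsShiftDeriv u u') : ⟪h, u⟫ = -⟪g, u'⟫ := by
  have h1 : HasDerivAt (fun s => ⟪BBMB.shift s g, u⟫) ⟪h, u⟫ 0 := by
    simpa using HasDerivAt.inner ℝ H (hasDerivAt_const (0 : ℝ) u)
  have h2 : HasDerivAt (fun s => BBMB.shift (-s) u) (-u') 0 := by
    have := HasDerivAt.scomp (h := fun s : ℝ => -s) (0 : ℝ) (g₁ := fun s => BBMB.shift s u) (g₁' := u') (by simpa [IsShiftDeriv] using H')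
      (hasDerivAt_neg (0 : ℝ))
    simpa [Function.comp_def] using this
  have h3 : HasDerivAt (fun s => ⟪g, BBMB.shift (-s) u⟫) (-⟪g, u'⟫) 0 := by
    simpa using HasDerivAt.inner ℝ (hasDerivAt_const (0 : ℝ) g) h2
  simp only [← inner_shift_left] at h3
  exact h1.unique h3

end IsShiftDeriv

/-- The difference quotient `(g(· + s) - g) / s`. -/
def diffQuot (s : ℝ) : L2 →L[ℝ] L2 :=
  s⁻¹ • ((shift s).toContinuousLinearMap - ContinuousLinearMap.id ℝ L2)

theorem diffQuot_apply (s : ℝ) (g : L2) : diffQuot s g = s⁻¹ • (shift s g - g) := by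
  simp [diffQuot]

theorem inner_diffQuot_left (s : ℝ) (g u : L2) :
    ⟪diffQuot s g, u⟫ = -⟪g, diffQuot (-s) u⟫ := by
  simp only [diffQuot_apply, inner_smul_left, inner_smul_right, inner_sub_left, inner_sub_right,
    inner_shift_left, inv_neg]
  simp

namespace IsShiftDeriv

variable {g h k : L2}

theorem tendsto_diffQuot (H : IsShiftDeriv g h) :
    Tendsto (fun s => diffQuot s g) (𝓝[≠] 0) (𝓝 h) := by
  have := hasDerivAt_iff_tendsto_slope_zero.1 H
  simpa [diffQuot_apply, shift_zero] using this

theorem norm_diffQuot_le (H : IsShiftDeriv g h) (s : ℝ) : ‖diffQuot s g‖ ≤ ‖h‖ := by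
  rcases eq_or_ne s 0 with rfl | hs
  · simp [diffQuot_apply]
  have h0 : 0 < |s| := abs_pos.2 hs
  rw [diffQuot_apply, norm_smul, norm_inv, Real.norm_eq_abs, inv_mul_le_iff₀ h0]
  exact H.norm_shift_sub_le s

theorem diffQuot (H : IsShiftDeriv g h) (s : ℝ) :
    IsShiftDeriv (diffQuot s g) (BBMB.diffQuot s h) := by
  simp only [diffQuot_apply]
  exact ((H.shift s).sub H).smul _

/-- The sign `-s` is the one produced by the adjoint of `diffQuot s`. The uniform bound of a
difference quotient by the derivative lets the inner quotient be replaced by its limit. -/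
theorem tendsto_diffQuot_diffQuot (H : IsShiftDeriv g h) (H' : IsShiftDeriv h k) :
    Tendsto (fun s => BBMB.diffQuot (-s) (BBMB.diffQuot s g)) (𝓝[≠] 0) (𝓝 k) := by
  have hneg : Tendsto (fun s : ℝ => -s) (𝓝[≠] 0) (𝓝[≠] 0) := by
    refine tendsto_nhdsWithin_iff.2 ⟨?_, ?_⟩
    · simpa using (continuous_neg.tendsto (0 : ℝ)).mono_left nhdsWithin_le_nhds
    · filter_upwards [self_mem_nhdsWithin] with s hs
      simpa using hs
  have h1 := H'.tendsto_diffQuot.comp hneg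
  have h2 : Tendsto (fun s => BBMB.diffQuot (-s) (BBMB.diffQuot s g - h)) (𝓝[≠] 0) (𝓝 0) := by
    refine squeeze_zero_norm (fun s => ((H.diffQuot s).sub H').norm_diffQuot_le (-s)) ?_
    simpa using (H'.tendsto_diffQuot.sub_const k).norm
  simpa using h1.add h2

end IsShiftDeriv

/-! ### Test functions, du Bois-Reymond's lemma and primitives. -/

/-- Integrate from the left end of the support. Mean zero makes the primitive vanish again beyond
the right end, and order connectedness keeps the hull of the support inside `s`. -/
theorem exists_test_primitive {s : Set ℝ} (hs : s.OrdConnected) {η : ℝ → ℝ} (hη : ContDiff ℝ ∞ η)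
    (hc : HasCompactSupport η) (hsub : tsupport η ⊆ s) (h0 : ∫ x, η x = 0) :
    ∃ θ : ℝ → ℝ, ContDiff ℝ ∞ θ ∧ HasCompactSupport θ ∧ tsupport θ ⊆ s ∧ deriv θ = η := by
  rcases (tsupport η).eq_empty_or_nonempty with he | hne
  · rw [tsupport_eq_empty_iff] at he
    subst he
    exact ⟨0, contDiff_const, HasCompactSupport.zero, by simp [tsupport_eq_empty_iff.2 rfl],
      by ext; simp⟩
  have hK : IsCompact (tsupport η) := hc
  set a := sInf (tsupport η)
  set b := sSup (tsupport η)
  have ha : a ∈ tsupport η := hK.sInf_mem hne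
  have hb : b ∈ tsupport η := hK.sSup_mem hne
  have hab : Icc a b ⊆ s := hs.out (hsub ha) (hsub hb)
  have hout : ∀ x, x ∉ Icc a b → η x = 0 := fun x hx => by
    by_contra h
    have := subset_tsupport η h
    exact hx ⟨csInf_le hK.bddBelow this, le_csSup hK.bddAbove this⟩
  have hII : ∀ c d, IntervalIntegrable η volume c d := fun c d => hη.continuous.intervalIntegrable c d
  have hd : ∀ x, HasDerivAt (fun x => ∫ y in a..x, η y) (η x) x := fun x =>
    intervalIntegral.integral_hasDerivAt_right (hII _ _)
      hη.continuous.aestronglyMeasurable.stronglyMeasurableAtFilter hη.continuous.continuousAt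
  have hderiv : deriv (fun x => ∫ y in a..x, η y) = η := funext fun x => (hd x).deriv
  have hsupp : ∀ x, x ∉ Icc a b → ∫ y in a..x, η y = 0 := by
    intro x hx
    rcases lt_or_ge x a with h | h
    · rw [intervalIntegral.integral_symm, intervalIntegral.integral_of_le h.le,
        integral_Ioc_eq_integral_Ioo, setIntegral_eq_zero_of_forall_eq_zero, neg_zero]
      intro y hy
      exact hout y fun h' => absurd hy.2 (not_lt.2 h'.1)
    · have hbx : b < x := by
        by_contra h'
        exact hx ⟨h, not_lt.1 h'⟩
      rw [intervalIntegral.integral_of_le h, ← integral_Icc_eq_integral_Ioc,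
        setIntegral_eq_integral_of_forall_compl_eq_zero, h0]
      intro y hy
      exact hout y fun h' => hy ⟨h'.1, h'.2.trans hbx.le⟩
  have hts : tsupport (fun x => ∫ y in a..x, η y) ⊆ Icc a b := by
    refine closure_minimal (fun x hx => ?_) isClosed_Icc
    by_contra h
    exact hx (hsupp x h)
  refine ⟨fun x => ∫ y in a..x, η y, ?_, HasCompactSupport.of_support_subset_isCompact isCompact_Icc
    (subset_closure.trans hts), hts.trans hab, hderiv⟩
  rw [contDiff_infty_iff_deriv, hderiv]
  exact ⟨fun x => (hd x).differentiableAt, hη⟩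

/-- The lemma of du Bois-Reymond. -/
theorem exists_ae_eq_const_of_integral_deriv_mul {s : Set ℝ} (hso : IsOpen s) (hs : s.OrdConnected)
    (hne : s.Nonempty) {f : ℝ → ℝ} (hf : LocallyIntegrableOn f s)
    (H : ∀ θ : ℝ → ℝ, ContDiff ℝ ∞ θ → HasCompactSupport θ → tsupport θ ⊆ s →
      ∫ x, deriv θ x * f x = 0) :
    ∃ c, ∀ᵐ x, x ∈ s → f x = c := by
  obtain ⟨x₀, hx₀⟩ := hne
  obtain ⟨r, hr, hrs⟩ := Metric.isOpen_iff.1 hso x₀ hx₀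
  let φ : ContDiffBump x₀ := ⟨r / 4, r / 2, by positivity, by linarith⟩
  set θ₀ := φ.normed volume
  have hθ₀ : ContDiff ℝ ∞ θ₀ := φ.contDiff_normed
  have hc₀ : HasCompactSupport θ₀ := φ.hasCompactSupport_normed
  have hs₀ : tsupport θ₀ ⊆ s := by
    rw [φ.tsupport_normed_eq]
    exact (Metric.closedBall_subset_ball (by change r / 2 < r; linarith)).trans hrs
  have hi : ∀ ψ : ℝ → ℝ, ContDiff ℝ ∞ ψ → HasCompactSupport ψ → tsupport ψ ⊆ s →
      Integrable fun x => ψ x * f x := by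
    intro ψ hψ hc hsub
    have h1 : IntegrableOn f (tsupport ψ) := hf.integrableOn_compact_subset hsub hc
    have h2 : IntegrableOn (fun x => ψ x * f x) (tsupport ψ) :=
      h1.continuousOn_mul hψ.continuous.continuousOn hc
    refine (integrableOn_iff_integrable_of_support_subset ?_).1 h2
    intro x hx
    exact subset_tsupport ψ (left_ne_zero_of_mul hx)
  refine ⟨∫ x, θ₀ x * f x, ?_⟩
  have hloc : LocallyIntegrableOn (fun x => f x - ∫ x, θ₀ x * f x) s :=
    hf.sub ((locallyIntegrable_const _).locallyIntegrableOn s)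
  have := hso.ae_eq_zero_of_integral_contDiff_smul_eq_zero hloc ?_
  · filter_upwards [this] with x hx hxs
    exact sub_eq_zero.1 (hx hxs)
  intro ψ hψ hc hsub
  -- Subtracting the right multiple of a fixed bump of mass one gives mean zero, hence the
  -- derivative of an admissible test function. The constant sought is the integral of `f` against
  -- that bump.
  have hηs : tsupport (fun x => ψ x - (∫ y, ψ y) * θ₀ x) ⊆ s := by
    refine (tsupport_sub ψ fun x => (∫ y, ψ y) * θ₀ x).trans (union_subset hsub ?_)
    exact (tsupport_mul_subset_right (f := fun _ => ∫ y, ψ y) (g := θ₀)).trans hs₀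
  obtain ⟨θ, h1, h2, h3, h4⟩ := exists_test_primitive hs
    (η := fun x => ψ x - (∫ y, ψ y) * θ₀ x) (hψ.sub (contDiff_const.mul hθ₀))
    (hc.sub (hc₀.mul_left)) hηs (by
      rw [integral_sub (hψ.continuous.integrable_of_hasCompactSupport hc)
        ((hθ₀.continuous.integrable_of_hasCompactSupport hc₀).const_mul _), integral_const_mul,
        φ.integral_normed]
      ring)
  have h5 := H θ h1 h2 h3
  simp only [h4, sub_mul, mul_assoc] at h5
  rw [integral_sub (hi ψ hψ hc hsub) ((hi θ₀ hθ₀ hc₀ hs₀).const_mul _), integral_const_mul] at h5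
  simp only [smul_eq_mul, mul_sub]
  rw [integral_sub (hi ψ hψ hc hsub)
    ((hψ.continuous.integrable_of_hasCompactSupport hc).mul_const _), integral_mul_const]
  exact h5

/-- On an interval containing the support of `θ`, both the primitive and `θ` are absolutely
continuous, so integration by parts applies; Lebesgue differentiation identifies the derivative of
the primitive. -/
theorem isWeakDeriv_primitive {n : ℝ → ℝ} (hn : LocallyIntegrable n volume) :
    IsWeakDeriv (fun x => ∫ y in (0 : ℝ)..x, n y) n := by
  have hII : ∀ a b, IntervalIntegrable n volume a b := fun a b =>
    hn.integrableOn_isCompact isCompact_uIcc |>.intervalIntegrable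
  have hcont : Continuous fun x => ∫ y in (0 : ℝ)..x, n y :=
    intervalIntegral.continuous_primitive hII 0
  refine ⟨hcont.locallyIntegrable, hn, fun θ hθ hc => ?_⟩
  obtain ⟨R, hR⟩ := (show IsCompact (tsupport θ) from hc).isBounded.subset_closedBall 0
  rw [Real.closedBall_eq_Icc, zero_sub, zero_add] at hR
  set S := |R| + 1
  have hS : 0 < S := by positivity
  have hRS : R < S := (le_abs_self R).trans_lt (lt_add_one _)
  have hout : ∀ x, x ∉ Ioo (-S) S → x ∉ tsupport θ := fun x hx hx' =>
    hx ⟨by linarith [(hR hx').1], by linarith [(hR hx').2]⟩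
  have hz : ∀ x, x ∉ Ioo (-S) S → θ x = 0 := fun x hx => image_eq_zero_of_notMem_tsupport (hout x hx)
  have hz' : ∀ x, x ∉ Ioo (-S) S → deriv θ x = 0 := fun x hx => by
    by_contra h
    exact hout x hx (tsupport_deriv_subset (f := θ) (subset_tsupport _ h))
  have hle : -S ≤ S := by linarith
  have key : ∀ g : ℝ → ℝ, (∀ x, x ∉ Ioo (-S) S → g x = 0) → ∫ x, g x = ∫ x in (-S)..S, g x := by
    intro g hg
    rw [intervalIntegral.integral_of_le hle, setIntegral_eq_integral_of_forall_compl_eq_zero]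
    intro x hx
    exact hg x fun h => hx (Ioo_subset_Ioc_self h)
  have h0 : (0 : ℝ) ∈ uIcc (-S) S := by rw [uIcc_of_le hle]; exact ⟨by linarith, hS.le⟩
  have hac := (hII (-S) S).absolutelyContinuousOnInterval_intervalIntegral h0
  have hθac : AbsolutelyContinuousOnInterval θ (-S) S :=
    (hθ.of_le (by exact_mod_cast le_top)).contDiffOn.absolutelyContinuousOnInterval
  rw [key _ fun x hx => by rw [hz' x hx, mul_zero], key _ fun x hx => by rw [hz x hx, mul_zero],
    hac.integral_mul_deriv_eq_deriv_mul hθac, hz S (by simp), hz (-S) (by simp)]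
  simp only [mul_zero, sub_zero, zero_sub, neg_inj]
  refine intervalIntegral.integral_congr_ae ?_
  filter_upwards [_root_.LocallyIntegrable.ae_hasDerivAt_integral hn] with x hx _
  rw [(hx 0).deriv]

theorem IsWeakDeriv.sub_eq_zero_const {g g' h : ℝ → ℝ} (H : IsWeakDeriv g h)
    (H' : IsWeakDeriv g' h) : ∃ c, g =ᵐ[volume] fun x => c + g' x := by
  obtain ⟨c, hc⟩ := exists_ae_eq_const_of_integral_deriv_mul (f := fun x => g x - g' x)
    isOpen_univ ordConnected_univ univ_nonempty
    ((H.1.sub H'.1).locallyIntegrableOn univ) (fun θ hθ hc _ => by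
      have cd : Continuous (deriv θ) := hθ.continuous_deriv (by simp)
      simp only [mul_comm (deriv θ _), sub_mul]
      rw [integral_sub (integrable_mul_test H.1 cd hc.deriv)
        (integrable_mul_test H'.1 cd hc.deriv), H.2.2 θ hθ hc, H'.2.2 θ hθ hc, sub_self])
  refine ⟨c, ?_⟩
  filter_upwards [hc] with x hx
  linarith [hx (mem_univ x)]

theorem IsWeakDeriv.ae_eq_primitive {g h : ℝ → ℝ} (H : IsWeakDeriv g h) :
    ∃ c, g =ᵐ[volume] fun x => c + ∫ y in (0 : ℝ)..x, h y :=
  H.sub_eq_zero_const (isWeakDeriv_primitive H.2.1)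

theorem IsWeakDeriv.unique {g h h' : ℝ → ℝ} (H : IsWeakDeriv g h) (H' : IsWeakDeriv g h') :
    h =ᵐ[volume] h' := by
  refine ae_eq_of_integral_contDiff_smul_eq H.2.1 H'.2.1 fun θ hθ hc => ?_
  have h1 := H.2.2 θ hθ hc
  have h2 := H'.2.2 θ hθ hc
  simp only [smul_eq_mul, mul_comm (θ _)]
  linarith

/-! ### Curves in Hilbert space: time derivatives and energy identities. -/

/-- Tested against a fixed vector `g`, the difference between `⟪g, u⟫` and the primitive of `⟪g, v⟫`
has zero weak derivative on the open interval, hence is constant there by du Bois-Reymond. -/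
theorem IsWeakTimeDeriv.eq_add_integral {T : ℝ} (hT : 0 < T) {u v : ℝ → L2}
    (H : IsWeakTimeDeriv T u v) (hu : ContinuousOn u (Icc 0 T)) (hv : IntegrableOn v (Ioo 0 T))
    {t : ℝ} (ht : t ∈ Icc 0 T) : u t = u 0 + ∫ τ in (0 : ℝ)..t, v τ := by
  have hvI : ∀ s ∈ Icc 0 T, IntervalIntegrable v volume 0 s := fun s hs =>
    (intervalIntegrable_iff_integrableOn_Ioo_of_le hs.1).2
      (hv.mono_set (Ioo_subset_Ioo le_rfl hs.2))
  refine ext_inner_left ℝ fun g => ?_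
  set n : ℝ → ℝ := (Ioo 0 T).indicator fun τ => ⟪g, v τ⟫
  have hgv : IntegrableOn (fun τ => ⟪g, v τ⟫) (Ioo 0 T) := hv.const_inner g
  have hn : Integrable n := (integrable_indicator_iff measurableSet_Ioo).2 hgv
  have hW := isWeakDeriv_primitive hn.locallyIntegrable
  have hPc : Continuous fun x => ∫ y in (0 : ℝ)..x, n y :=
    intervalIntegral.continuous_primitive (fun a b => hn.intervalIntegrable) 0
  have hm : ContinuousOn (fun s => ⟪g, u s⟫) (Icc 0 T) := continuousOn_const.inner hu
  have hf : ContinuousOn (fun s => ⟪g, u s⟫ - ∫ y in (0 : ℝ)..s, n y) (Icc 0 T) :=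
    hm.sub hPc.continuousOn
  obtain ⟨c, hc⟩ := exists_ae_eq_const_of_integral_deriv_mul isOpen_Ioo ordConnected_Ioo
    (nonempty_Ioo.2 hT) ((hf.mono Ioo_subset_Icc_self).locallyIntegrableOn measurableSet_Ioo) (by
      intro θ hθ hcs hsub
      have hsub' : tsupport (deriv θ) ⊆ Ioo 0 T := tsupport_deriv_subset.trans hsub
      have hd : Continuous (deriv θ) := hθ.continuous_deriv (by simp)
      have huI : IntegrableOn (fun s => deriv θ s • u s) (Ioo 0 T) :=
        ((hd.continuousOn.smul hu).integrableOn_Icc).mono_set Ioo_subset_Icc_self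
      have hθv : IntegrableOn (fun s => θ s • v s) (Ioo 0 T) := by
        obtain ⟨C, hC⟩ := hcs.exists_bound_of_continuous hθ.continuous
        exact Integrable.bdd_smul hv C hθ.continuous.aestronglyMeasurable (Eventually.of_forall hC)
      have e1 : ∫ s in Ioo 0 T, deriv θ s * ⟪g, u s⟫ = -∫ s in Ioo 0 T, θ s * ⟪g, v s⟫ := by
        have h1 := congrArg (fun z => ⟪g, z⟫) (H θ hθ hcs hsub)
        simp only [inner_neg_right] at h1
        rw [← integral_inner huI, ← integral_inner hθv] at h1
        simpa [inner_smul_right] using h1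
      have e2 := hW.2.2 θ hθ hcs
      have e3 : ∫ x, n x * θ x = ∫ s in Ioo 0 T, θ s * ⟪g, v s⟫ := by
        rw [← integral_indicator measurableSet_Ioo]
        refine integral_congr_ae (Eventually.of_forall fun x => ?_)
        by_cases hx : x ∈ Ioo 0 T <;> simp [n, hx, mul_comm]
      have e4 : ∫ x, deriv θ x * (⟪g, u x⟫ - ∫ y in (0 : ℝ)..x, n y)
          = ∫ x in Ioo 0 T, deriv θ x * (⟪g, u x⟫ - ∫ y in (0 : ℝ)..x, n y) := by
        rw [setIntegral_eq_integral_of_forall_compl_eq_zero]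
        intro x hx
        rw [image_eq_zero_of_notMem_tsupport fun h => hx (hsub' h), zero_mul]
      have e5 : ∫ x, (∫ y in (0 : ℝ)..x, n y) * deriv θ x
          = ∫ x in Ioo 0 T, deriv θ x * ∫ y in (0 : ℝ)..x, n y := by
        rw [← setIntegral_eq_integral_of_forall_compl_eq_zero (s := Ioo 0 T)]
        · simp only [mul_comm]
        intro x hx
        rw [image_eq_zero_of_notMem_tsupport fun h => hx (hsub' h), mul_zero]
      rw [e4]
      simp only [mul_sub]
      rw [integral_sub, e1, ← e5, e2, e3]
      · ring
      · exact ((hd.continuousOn.mul hm).integrableOn_Icc).mono_set Ioo_subset_Icc_self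
      · exact ((hd.mul hPc).continuousOn.integrableOn_Icc).mono_set Ioo_subset_Icc_self)
  -- Continuity carries the almost everywhere equality to the closed interval, in particular to the
  -- initial time, which test functions supported in `(0, T)` do not see.
  have heq : EqOn (fun s => ⟪g, u s⟫ - ∫ y in (0 : ℝ)..s, n y) (fun _ => c) (Icc 0 T) := by
    refine Measure.eqOn_Icc_of_ae_eq volume hT.ne ?_ hf continuousOn_const
    rw [Filter.EventuallyEq, ← restrict_Ioo_eq_restrict_Icc, ae_restrict_iff' measurableSet_Ioo]
    exact hc
  have h0 := heq (left_mem_Icc.2 hT.le)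
  have h1 := heq ht
  simp only [intervalIntegral.integral_same, sub_zero] at h0 h1
  have h2 : ∫ y in (0 : ℝ)..t, n y = ⟪g, ∫ y in (0 : ℝ)..t, v y⟫ := by
    have := (innerSL ℝ g).intervalIntegral_comp_comm (hvI t ht)
    simp only [innerSL_apply_apply] at this
    rw [← this, intervalIntegral.integral_of_le ht.1, intervalIntegral.integral_of_le ht.1,
      integral_Ioc_eq_integral_Ioo, integral_Ioc_eq_integral_Ioo]
    refine setIntegral_congr_fun measurableSet_Ioo fun x hx => ?_
    exact indicator_of_mem (Ioo_subset_Ioo le_rfl ht.2 hx) _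
  rw [inner_add_right, ← h2, h0]
  linarith

theorem _root_.AbsolutelyContinuousOnInterval.of_dist_le {X Y : Type*} [PseudoMetricSpace X]
    [PseudoMetricSpace Y] {f : ℝ → X} {g : ℝ → Y} {a b K : ℝ}
    (hg : AbsolutelyContinuousOnInterval g a b)
    (h : ∀ x ∈ uIcc a b, ∀ y ∈ uIcc a b, dist (f x) (f y) ≤ K * dist (g x) (g y)) :
    AbsolutelyContinuousOnInterval f a b := by
  rw [absolutelyContinuousOnInterval_iff] at hg ⊢
  intro ε hε
  obtain ⟨δ, hδ, H⟩ := hg (ε / (|K| + 1)) (by positivity)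
  refine ⟨δ, hδ, fun E hE hlen => ?_⟩
  have h1 := H E hE hlen
  rw [lt_div_iff₀ (by positivity)] at h1
  refine lt_of_le_of_lt ?_ h1
  rw [Finset.sum_mul]
  refine Finset.sum_le_sum fun i hi => ?_
  have hm := hE.1 i hi
  refine (h _ hm.1 _ hm.2).trans ?_
  rw [mul_comm]
  gcongr
  linarith [le_abs_self K]

/-- The increments of `u` are dominated by those of the primitive of `‖v‖`. Since `u` is bounded,
`‖u‖²` is then absolutely continuous, and the fundamental theorem applies with the derivative found
almost everywhere by Lebesgue differentiation. -/
theorem norm_sq_add_integral {H : Type*} [NormedAddCommGroup H] [InnerProductSpace ℝ H]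
    [CompleteSpace H] (u₀ : H) {v : ℝ → H} {b : ℝ} (hb : 0 ≤ b)
    (hv : IntervalIntegrable v volume 0 b) :
    ‖u₀ + ∫ τ in (0 : ℝ)..b, v τ‖ ^ 2
      = ‖u₀‖ ^ 2 + 2 * ∫ s in (0 : ℝ)..b, ⟪v s, u₀ + ∫ τ in (0 : ℝ)..s, v τ⟫ := by
  set u : ℝ → H := fun s => u₀ + ∫ τ in (0 : ℝ)..s, v τ with hu
  have h0 : (0 : ℝ) ∈ uIcc 0 b := left_mem_uIcc
  have hP := hv.norm.absolutelyContinuousOnInterval_intervalIntegral h0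
  have hsub : ∀ x ∈ uIcc 0 b, ∀ y ∈ uIcc 0 b, IntervalIntegrable v volume x y := fun x hx y hy =>
    hv.mono_set (uIcc_subset_uIcc hx hy)
  have hdist : ∀ x ∈ uIcc 0 b, ∀ y ∈ uIcc 0 b,
      ‖u x - u y‖ ≤ |(∫ τ in (0 : ℝ)..x, ‖v τ‖) - ∫ τ in (0 : ℝ)..y, ‖v τ‖| := by
    intro x hx y hy
    rw [hu]
    simp only [add_sub_add_left_eq_sub]
    rw [intervalIntegral.integral_interval_sub_left (hsub _ h0 _ hx) (hsub _ h0 _ hy),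
      intervalIntegral.integral_interval_sub_left (hsub _ h0 _ hx).norm (hsub _ h0 _ hy).norm]
    exact intervalIntegral.norm_integral_le_abs_integral_norm
  set M := ‖u₀‖ + ∫ τ in (0 : ℝ)..b, ‖v τ‖
  have hM : ∀ x ∈ uIcc 0 b, ‖u x‖ ≤ M := by
    intro x hx
    have hx' := hx
    rw [uIcc_of_le hb] at hx'
    refine (norm_add_le _ _).trans (add_le_add le_rfl ?_)
    refine (intervalIntegral.norm_integral_le_integral_norm hx'.1).trans ?_
    refine intervalIntegral.integral_mono_interval le_rfl hx'.1 hx'.2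
      (Eventually.of_forall fun _ => norm_nonneg _) hv.norm
  have hac : AbsolutelyContinuousOnInterval (fun s => ‖u s‖ ^ 2) 0 b := by
    refine hP.of_dist_le (K := M + M) fun x hx y hy => ?_
    rw [Real.dist_eq, Real.dist_eq]
    have h1 : ‖u x‖ ^ 2 - ‖u y‖ ^ 2 = (‖u x‖ + ‖u y‖) * (‖u x‖ - ‖u y‖) := by ring
    rw [h1, abs_mul, abs_of_nonneg (by positivity)]
    exact mul_le_mul (add_le_add (hM x hx) (hM y hy))
      ((abs_norm_sub_norm_le _ _).trans (hdist x hx y hy)) (abs_nonneg _)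
      (by linarith [(norm_nonneg _).trans (hM x hx)])
  have h1 := hac.integral_deriv_eq_sub
  have h2 : ∫ s in (0 : ℝ)..b, deriv (fun s => ‖u s‖ ^ 2) s
      = ∫ s in (0 : ℝ)..b, 2 * ⟪v s, u s⟫ := by
    refine intervalIntegral.integral_congr_ae ?_
    filter_upwards [hv.ae_hasDerivAt_integral] with x hx hxm
    have := ((hx (uIoc_subset_uIcc hxm) 0 h0).const_add u₀).norm_sq
    rw [this.deriv, real_inner_comm]
  rw [h2, intervalIntegral.integral_const_mul] at h1
  have h3 : u 0 = u₀ := by simp [hu]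
  rw [h3] at h1
  change ‖u b‖ ^ 2 = _
  linarith

theorem _root_.MeasureTheory.MemLp.integrable_real_inner {α H : Type*} {mα : MeasurableSpace α}
    {μ : Measure α} [NormedAddCommGroup H] [InnerProductSpace ℝ H] {f g : α → H}
    (hf : MemLp f 2 μ) (hg : MemLp g 2 μ) : Integrable (fun t => ⟪f t, g t⟫) μ := by
  refine (hf.norm.integrable_mul hg.norm).mono' (hf.1.inner hg.1) (Eventually.of_forall fun t => ?_)
  exact norm_inner_le_norm _ _

/-- If `w ∈ C([0,T]; H¹)`, `∂ₓ²w ∈ L²(0,T; L²)` and `∂ₜw = s ∈ L²(0,T; L²)`, then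
`‖∂ₓw(t)‖² = ‖∂ₓw(0)‖² - 2 ∫₀ᵗ ⟨∂ₜw, ∂ₓ²w⟩`. -/
theorem norm_sq_shiftDeriv_eq {T : ℝ} {w w₁ w₂ s : ℝ → L2}
    (hw : ContinuousOn w (Icc 0 T))
    (hs : MemLp s 2 (volume.restrict (Ioo 0 T))) (hw₂ : MemLp w₂ 2 (volume.restrict (Ioo 0 T)))
    (heq : ∀ t ∈ Icc 0 T, w t = w 0 + ∫ τ in (0 : ℝ)..t, s τ)
    (h₁ : ∀ t ∈ Icc 0 T, IsShiftDeriv (w t) (w₁ t))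
    (h₂ : ∀ᵐ t ∂volume.restrict (Ioo 0 T), IsShiftDeriv (w₁ t) (w₂ t)) {t : ℝ}
    (ht : t ∈ Icc 0 T) :
    ‖w₁ t‖ ^ 2 = ‖w₁ 0‖ ^ 2 - 2 * ∫ τ in (0 : ℝ)..t, ⟪s τ, w₂ τ⟫ := by
  have hsub : Ioo 0 t ⊆ Ioo 0 T := Ioo_subset_Ioo le_rfl ht.2
  have hrt : volume.restrict (uIoc 0 t) = volume.restrict (Ioo 0 t) := by
    rw [uIoc_of_le ht.1, restrict_Ioo_eq_restrict_Ioc]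
  have hle : volume.restrict (Ioo 0 t) ≤ volume.restrict (Ioo 0 T) :=
    Measure.restrict_mono hsub le_rfl
  have hsi : ∀ r ∈ Icc 0 t, IntervalIntegrable s volume 0 r := fun r hr =>
    (intervalIntegrable_iff_integrableOn_Ioo_of_le hr.1).2
      ((hs.integrable (by norm_num)).mono_measure
        (Measure.restrict_mono (Ioo_subset_Ioo le_rfl (hr.2.trans ht.2)) le_rfl))
  have h0T : (0 : ℝ) ∈ Icc 0 T := ⟨le_rfl, ht.1.trans ht.2⟩
  -- The curve `w₁` need not have a time derivative in `L²`, but a difference quotient of `w` does.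
  -- Moving one quotient onto the other factor leaves `s` undifferentiated.
  have hid : ∀ h : ℝ, ‖diffQuot h (w t)‖ ^ 2 = ‖diffQuot h (w 0)‖ ^ 2
      - 2 * ∫ τ in (0 : ℝ)..t, ⟪s τ, diffQuot (-h) (diffQuot h (w τ))⟫ := by
    intro h
    have hcomm : ∀ r ∈ Icc 0 t, diffQuot h (w r)
        = diffQuot h (w 0) + ∫ τ in (0 : ℝ)..r, diffQuot h (s τ) := fun r hr => by
      rw [heq r ⟨hr.1, hr.2.trans ht.2⟩, map_add,
        (diffQuot h).intervalIntegral_comp_comm (hsi r hr)]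
    have hi : IntervalIntegrable (fun τ => diffQuot h (s τ)) volume 0 t :=
      ⟨(diffQuot h).integrable_comp (hsi t ⟨ht.1, le_rfl⟩).1,
        (diffQuot h).integrable_comp (hsi t ⟨ht.1, le_rfl⟩).2⟩
    rw [hcomm t ⟨ht.1, le_rfl⟩, norm_sq_add_integral _ ht.1 hi]
    have : ∫ r in (0 : ℝ)..t, ⟪diffQuot h (s r), diffQuot h (w 0)
        + ∫ τ in (0 : ℝ)..r, diffQuot h (s τ)⟫
        = ∫ r in (0 : ℝ)..t, -⟪s r, diffQuot (-h) (diffQuot h (w r))⟫ := by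
      refine intervalIntegral.integral_congr fun r hr => ?_
      rw [uIcc_of_le ht.1] at hr
      simp only [← hcomm r hr, inner_diffQuot_left]
    rw [this, intervalIntegral.integral_neg]
    ring
  have hl : ∀ r ∈ Icc 0 T, Tendsto (fun h => ‖diffQuot h (w r)‖ ^ 2) (𝓝[≠] 0)
      (𝓝 (‖w₁ r‖ ^ 2)) := fun r hr => ((h₁ r hr).tendsto_diffQuot.norm).pow 2
  have hwm : AEStronglyMeasurable w (volume.restrict (Ioo 0 T)) :=
    (hw.mono Ioo_subset_Icc_self).aestronglyMeasurable measurableSet_Ioo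
  -- Both quotients are contractive relative to the derivatives, so the integrands are dominated by
  -- `‖s‖ ‖w₂‖`, integrable as a product of two square integrable functions.
  have hlim : Tendsto (fun h => ∫ τ in (0 : ℝ)..t, ⟪s τ, diffQuot (-h) (diffQuot h (w τ))⟫)
      (𝓝[≠] 0) (𝓝 (∫ τ in (0 : ℝ)..t, ⟪s τ, w₂ τ⟫)) := by
    refine intervalIntegral.tendsto_integral_filter_of_dominated_convergence
      (fun τ => ‖s τ‖ * ‖w₂ τ‖) ?_ ?_ ?_ ?_
    · refine Eventually.of_forall fun h => ?_
      rw [hrt]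
      refine (hs.1.inner ?_).mono_measure hle
      exact (((diffQuot (-h)).comp (diffQuot h)).continuous.comp_aestronglyMeasurable hwm)
    · refine Eventually.of_forall fun h => ?_
      rw [← ae_restrict_iff' measurableSet_uIoc, hrt]
      filter_upwards [ae_mono hle h₂, ae_restrict_mem measurableSet_Ioo] with τ hτ hm
      refine (norm_inner_le_norm _ _).trans ?_
      gcongr
      exact (((h₁ τ (Ioo_subset_Icc_self (hsub hm))).diffQuot h).norm_diffQuot_le (-h)).trans
        (hτ.norm_diffQuot_le h)
    · rw [intervalIntegrable_iff_integrableOn_Ioo_of_le ht.1]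
      exact (hs.norm.integrable_mul hw₂.norm).mono_measure hle
    · rw [← ae_restrict_iff' measurableSet_uIoc, hrt]
      filter_upwards [ae_mono hle h₂, ae_restrict_mem measurableSet_Ioo] with τ hτ hm
      exact tendsto_const_nhds.inner
        ((h₁ τ (Ioo_subset_Icc_self (hsub hm))).tendsto_diffQuot_diffQuot hτ)
  have hR := (hl 0 h0T).sub (hlim.const_mul 2)
  simp only [← hid] at hR
  exact tendsto_nhds_unique (hl t ht) hR

/-! ### Classical representatives and the perturbed flux. -/

theorem IsWeakDeriv.exists_contDiff_repr {v v₁ v₂ : L2} (h₁ : IsWeakDeriv v v₁)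
    (h₂ : IsWeakDeriv v₁ v₂) : ∃ g g₁ : ℝ → ℝ, v =ᵐ[volume] g ∧ v₁ =ᵐ[volume] g₁ ∧
      Continuous g₁ ∧ ∀ x, HasDerivAt g (g₁ x) x := by
  obtain ⟨c₁, hc₁⟩ := h₂.ae_eq_primitive
  obtain ⟨c, hc⟩ := h₁.ae_eq_primitive
  set g₁ : ℝ → ℝ := fun x => c₁ + ∫ y in (0 : ℝ)..x, v₂ y
  have hg₁ : Continuous g₁ := continuous_const.add (intervalIntegral.continuous_primitive
    (fun a b => (L2.locallyIntegrable v₂).integrableOn_isCompact isCompact_uIcc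
      |>.intervalIntegrable) 0)
  refine ⟨fun x => c + ∫ y in (0 : ℝ)..x, g₁ y, g₁, ?_, hc₁, hg₁, fun x => ?_⟩
  · filter_upwards [hc] with x hx
    rw [hx]
    congr 1
    exact intervalIntegral.integral_congr_ae (hc₁.mono fun y hy _ => hy)
  · exact (intervalIntegral.integral_hasDerivAt_right (hg₁.intervalIntegrable _ _)
      hg₁.aestronglyMeasurable.stronglyMeasurableAtFilter hg₁.continuousAt).const_add c

/-- `g²` vanishes at `-∞`, so `g(x)²` is the integral of `2 g g₁` over `(-∞, x]`, and `2 g g₁ ≤ g² +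
g₁²`. -/
theorem sq_le_integral_of_hasDerivAt {g g₁ : ℝ → ℝ} (hd : ∀ x, HasDerivAt g (g₁ x) x)
    (hg : MemLp g 2 (volume : Measure ℝ)) (hg₁ : MemLp g₁ 2 (volume : Measure ℝ)) (x : ℝ) :
    g x ^ 2 ≤ (∫ y, g y ^ 2) + ∫ y, g₁ y ^ 2 := by
  have h2 : ∀ y, HasDerivAt (fun y => g y ^ 2) (2 * g y * g₁ y) y := fun y => by
    simpa using! (hd y).pow 2
  have hi : Integrable fun y => 2 * g y * g₁ y := by
    simpa [mul_assoc] using! (hg.integrable_mul hg₁).const_mul 2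
  have hlim := tendsto_zero_of_hasDerivAt_of_integrableOn_Iic (a := x) (fun y _ => h2 y)
    hi.integrableOn hg.integrable_sq.integrableOn
  have := integral_Iic_of_hasDerivAt_of_tendsto' (a := x) (fun y _ => h2 y) hi.integrableOn hlim
  rw [sub_zero] at this
  rw [← this, ← integral_add hg.integrable_sq hg₁.integrable_sq]
  have hs : Integrable fun y => g y ^ 2 + g₁ y ^ 2 := hg.integrable_sq.add hg₁.integrable_sq
  calc ∫ y in Iic x, 2 * g y * g₁ y ≤ ∫ y in Iic x, (g y ^ 2 + g₁ y ^ 2) :=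
        setIntegral_mono hi.integrableOn hs.integrableOn fun y => by
          nlinarith [sq_nonneg (g y - g₁ y)]
    _ ≤ ∫ y, (g y ^ 2 + g₁ y ^ 2) :=
        setIntegral_le_integral hs (Eventually.of_forall fun y => by positivity)

/-- On `J` the function `f - (c/2) x²` is convex, hence lies above its tangent at `u`. -/
theorem taylor_lower_bound {J : Set ℝ} (hJ : Convex ℝ J) {f f₁ f₂ : ℝ → ℝ}
    (hf : ∀ x, HasDerivAt f (f₁ x) x) (hf₁ : ∀ x, HasDerivAt f₁ (f₂ x) x) {c : ℝ}
    (hc : ∀ x ∈ J, c ≤ f₂ x) {u z : ℝ} (hu : u ∈ J) (hz : z + u ∈ J) :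
    c / 2 * z ^ 2 ≤ f (z + u) - f u - f₁ u * z := by
  have hd : ∀ x, HasDerivAt (fun x => f x - c / 2 * x ^ 2) (f₁ x - c * x) x := fun x => by
    convert! (hf x).sub (((hasDerivAt_id x).pow 2).const_mul (c / 2)) using 1
    simp; ring
  have hd₁ : ∀ x, HasDerivAt (fun x => f₁ x - c * x) (f₂ x - c) x := fun x => by
    simpa using! (hf₁ x).sub ((hasDerivAt_id x).const_mul c)
  have hcv : ConvexOn ℝ J fun x => f x - c / 2 * x ^ 2 :=
    convexOn_of_hasDerivWithinAt2_nonneg hJ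
      (fun x _ => (hd x).continuousAt.continuousWithinAt) (fun x _ => (hd x).hasDerivWithinAt)
      (fun x _ => (hd₁ x).hasDerivWithinAt) (fun x hx => sub_nonneg.2 (hc x (interior_subset hx)))
  rcases lt_trichotomy z 0 with h | h | h
  · have := hcv.slope_le_of_hasDerivAt hz hu (by linarith) (hd u)
    rw [slope_def_field, div_le_iff₀ (by linarith)] at this
    nlinarith
  · subst h; simp
  · have := hcv.le_slope_of_hasDerivAt hu hz (by linarith) (hd u)
    rw [slope_def_field, le_div_iff₀ (by linarith)] at this
    nlinarith

/-- Cancellation and bounds for the perturbed flux around a monotone bounded profile `U`. -/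
theorem flux_estimate_classical {f f₁ f₂ : ℝ → ℝ} (hf : ∀ x, HasDerivAt f (f₁ x) x)
    (hf₁ : ∀ x, HasDerivAt f₁ (f₂ x) x) {J : Set ℝ} (hJ : Convex ℝ J) {c L B : ℝ} (hL : 0 ≤ L)
    (hc : ∀ x ∈ J, c ≤ f₂ x) (hL₁ : ∀ x ∈ J, |f₁ x| ≤ L) (hL₂ : ∀ x ∈ J, |f₂ x| ≤ L)
    {U Ux g g₁ : ℝ → ℝ} (hU : ∀ x, HasDerivAt U (Ux x) x) (hUc : Continuous Ux)
    (hU0 : ∀ x, 0 ≤ Ux x) (hUB : ∀ x, Ux x ≤ B) (hUJ : ∀ x, U x ∈ J) (hgJ : ∀ x, g x + U x ∈ J)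
    (hg : ∀ x, HasDerivAt g (g₁ x) x) (hg₁ : Continuous g₁)
    (hgm : MemLp g 2 (volume : Measure ℝ)) (hgm₁ : MemLp g₁ 2 (volume : Measure ℝ)) :
    let N := fun x => f₁ (g x + U x) * (g₁ x + Ux x) - f₁ (U x) * Ux x
    MemLp N 2 (volume : Measure ℝ) ∧ c / 2 * ∫ x, Ux x * g x ^ 2 ≤ ∫ x, N x * g x ∧
      ∫ x, N x ^ 2 ≤ 2 * L ^ 2 * (1 + B) * ((∫ x, g₁ x ^ 2) + ∫ x, Ux x * g x ^ 2) := by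
  intro N
  have hB : 0 ≤ B := (hU0 0).trans (hUB 0)
  have hgc : Continuous g := continuous_iff_continuousAt.2 fun x => (hg x).continuousAt
  have hUcc : Continuous U := continuous_iff_continuousAt.2 fun x => (hU x).continuousAt
  have hfc : Continuous f := continuous_iff_continuousAt.2 fun x => (hf x).continuousAt
  have hf₁c : Continuous f₁ := continuous_iff_continuousAt.2 fun x => (hf₁ x).continuousAt
  have hNc : Continuous N := by fun_prop
  have hseg : ∀ x, ∀ s ∈ uIcc 0 (g x), s + U x ∈ J := by
    intro x s hs
    have h1 : s + U x ∈ segment ℝ (U x) (g x + U x) := by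
      rw [segment_eq_uIcc]
      rcases le_total 0 (g x) with h | h
      · rw [uIcc_of_le h] at hs; rw [uIcc_of_le (by linarith)]
        exact ⟨by linarith [hs.1], by linarith [hs.2]⟩
      · rw [uIcc_of_ge h] at hs; rw [uIcc_of_ge (by linarith)]
        exact ⟨by linarith [hs.1], by linarith [hs.2]⟩
    exact hJ.segment_subset (hUJ x) (hgJ x) h1
  have habs : ∀ x, ∀ s ∈ uIcc 0 (g x), |s| ≤ |g x| := fun x s hs => by
    simpa using abs_sub_left_of_mem_uIcc hs
  have hmv : ∀ x, ∀ (k k' : ℝ → ℝ), (∀ s, HasDerivAt k (k' s) s) → ∀ C,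
      (∀ s ∈ uIcc 0 (g x), |k' s| ≤ C) → |k (g x) - k 0| ≤ C * |g x| := by
    intro x k k' hk C hC
    simpa using Convex.norm_image_sub_le_of_norm_hasDerivWithin_le (s := uIcc 0 (g x))
      (fun s _ => (hk s).hasDerivWithinAt) hC (convex_uIcc _ _) left_mem_uIcc right_mem_uIcc
  have hlip : ∀ x, ∀ s ∈ uIcc 0 (g x), |f₁ (s + U x) - f₁ (U x)| ≤ L * |s| := by
    intro x s hs
    have := Convex.norm_image_sub_le_of_norm_hasDerivWithin_le (f := f₁) (f' := f₂) (C := L)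
      (fun y _ => (hf₁ y).hasDerivWithinAt) hL₂ hJ (hUJ x) (hseg x s hs)
    simpa using this
  -- The part of `N` containing `Uₓ` comes with an increment of `f₁`, so it carries a factor `g`;
  -- this is what makes `N` square integrable although `Uₓ` alone is not assumed to be.
  have hNb : ∀ x, |N x| ≤ L * |g₁ x| + L * |g x| * Ux x := by
    intro x
    have e : N x = f₁ (g x + U x) * g₁ x + (f₁ (g x + U x) - f₁ (U x)) * Ux x := by
      simp only [N]; ring
    rw [e]
    refine (abs_add_le _ _).trans (add_le_add ?_ ?_)
    · rw [abs_mul]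
      exact mul_le_mul_of_nonneg_right (hL₁ _ (hgJ x)) (abs_nonneg _)
    · rw [abs_mul, abs_of_nonneg (hU0 x)]
      exact mul_le_mul_of_nonneg_right (hlip x _ right_mem_uIcc) (hU0 x)
  have hNm : MemLp N 2 (volume : Measure ℝ) := by
    refine MemLp.mono' (g := fun x => L * |g₁ x| + L * B * |g x|)
      ((hgm₁.abs.const_mul L).add (hgm.abs.const_mul (L * B))) hNc.aestronglyMeasurable
      (Eventually.of_forall fun x => (hNb x).trans ?_)
    have := mul_le_mul_of_nonneg_left (hUB x) (mul_nonneg hL (abs_nonneg (g x)))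
    linarith
  have hQi : Integrable fun x => Ux x * g x ^ 2 := by
    refine (hgm.integrable_sq.const_mul B).mono' (by fun_prop) (Eventually.of_forall fun x => ?_)
    rw [Real.norm_eq_abs, abs_of_nonneg (mul_nonneg (hU0 x) (sq_nonneg _))]
    exact mul_le_mul_of_nonneg_right (hUB x) (sq_nonneg _)
  have hNg : Integrable fun x => N x * g x := hNm.integrable_mul hgm
  refine ⟨hNm, ?_, ?_⟩
  · set 𝓕 : ℝ → ℝ := fun x => ∫ y in (0 : ℝ)..x, f y
    have h𝓕 : ∀ x, HasDerivAt 𝓕 (f x) x := fun x =>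
      intervalIntegral.integral_hasDerivAt_right (hfc.intervalIntegrable _ _)
        hfc.aestronglyMeasurable.stronglyMeasurableAtFilter hfc.continuousAt
    have h𝓕c : Continuous 𝓕 := continuous_iff_continuousAt.2 fun x => (h𝓕 x).continuousAt
    set Q : ℝ → ℝ := fun x => (f (g x + U x) - f (U x) - f₁ (U x) * g x) * Ux x
    -- `Φ` is the potential that absorbs every term of `N g` except the Taylor remainder `Q`; its
    -- derivative integrates to zero.
    set Φ : ℝ → ℝ := fun x => f (g x + U x) * g x - 𝓕 (g x + U x) + 𝓕 (U x)
    have hΦ : ∀ x, HasDerivAt Φ (N x * g x - Q x) x := by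
      intro x
      have h1 := (hg x).add (hU x)
      have h2 := (HasDerivAt.comp x (hf _) h1).mul (hg x)
      have h3 := HasDerivAt.comp x (h𝓕 _) h1
      have h4 := HasDerivAt.comp x (h𝓕 _) (hU x)
      convert! (h2.sub h3).add h4 using 1
      simp only [N, Q, Function.comp_apply, Pi.add_apply]
      ring
    -- As a function of the value `s` of the perturbation, the expression vanishes at `s = 0` and
    -- has derivative `f₁(s + U) s`; hence `|Φ| ≤ L g²`.
    have hΦi : Integrable Φ := by
      refine (hgm.integrable_sq.const_mul L).mono' (by fun_prop) (Eventually.of_forall fun x => ?_)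
      have hk : ∀ s, HasDerivAt (fun s => f (s + U x) * s - 𝓕 (s + U x) + 𝓕 (U x))
          (f₁ (s + U x) * s) s := by
        intro s
        have h1 := (hasDerivAt_id s).add_const (U x)
        have h2 := (HasDerivAt.comp s (hf _) h1).mul (hasDerivAt_id s)
        have h3 := HasDerivAt.comp s (h𝓕 _) h1
        convert! (h2.sub h3).add_const (𝓕 (U x)) using 1
        simp
      have := hmv x _ _ hk (L * |g x|) fun s hs => by
        rw [abs_mul]
        exact mul_le_mul (hL₁ _ (hseg x s hs)) (habs x s hs) (abs_nonneg _) hL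
      simp only [zero_add, mul_zero, zero_sub, neg_add_cancel, sub_zero] at this
      refine this.trans (le_of_eq ?_)
      rw [mul_assoc, ← sq, sq_abs]
    have hQint : Integrable Q := by
      refine (hQi.const_mul L).mono' (by fun_prop) (Eventually.of_forall fun x => ?_)
      have hk : ∀ s, HasDerivAt (fun s => f (s + U x) - f₁ (U x) * s)
          (f₁ (s + U x) - f₁ (U x)) s := by
        intro s
        have h1 := (hasDerivAt_id s).add_const (U x)
        convert! (HasDerivAt.comp s (hf _) h1).sub ((hasDerivAt_id s).const_mul (f₁ (U x))) using 1
        simp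
      have := hmv x _ _ hk (L * |g x|) fun s hs =>
        (hlip x s hs).trans (mul_le_mul_of_nonneg_left (habs x s hs) hL)
      simp only [zero_add, mul_zero, sub_zero] at this
      rw [Real.norm_eq_abs, abs_mul, abs_of_nonneg (hU0 x)]
      have e : f (g x + U x) - f (U x) - f₁ (U x) * g x
        = f (g x + U x) - f₁ (U x) * g x - f (U x) := by ring
      rw [e]
      refine (mul_le_mul_of_nonneg_right this (hU0 x)).trans (le_of_eq ?_)
      rw [mul_assoc L, ← sq, sq_abs]
      ring
    have h0 := integral_eq_zero_of_hasDerivAt_of_integrable hΦ (hNg.sub hQint) hΦi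
    rw [integral_sub hNg hQint] at h0
    have h1 : c / 2 * ∫ x, Ux x * g x ^ 2 ≤ ∫ x, Q x := by
      rw [← integral_const_mul]
      refine integral_mono (hQi.const_mul _) hQint fun x => ?_
      have := mul_le_mul_of_nonneg_right
        (taylor_lower_bound hJ hf hf₁ hc (hUJ x) (hgJ x)) (hU0 x)
      simp only [Q]
      linarith
    linarith
  · rw [← integral_add hgm₁.integrable_sq hQi, ← integral_const_mul]
    refine integral_mono hNm.integrable_sq ((hgm₁.integrable_sq.add hQi).const_mul _) fun x => ?_
    have h1 : N x ^ 2 ≤ (L * |g₁ x| + L * |g x| * Ux x) ^ 2 := by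
      rw [← sq_abs]
      exact pow_le_pow_left₀ (abs_nonneg _) (hNb x) 2
    have h2 : (L * |g₁ x| + L * |g x| * Ux x) ^ 2
        ≤ 2 * L ^ 2 * (|g₁ x| ^ 2 + |g x| ^ 2 * Ux x * Ux x) := by
      nlinarith [sq_nonneg (L * |g₁ x| - L * |g x| * Ux x)]
    simp only [sq_abs] at h2
    -- Only one factor `Uₓ` is bounded by `B`; the other is kept, so that the bound is by the
    -- dissipated quantity `Uₓ g²`.
    have h3 : g x ^ 2 * Ux x * Ux x ≤ g x ^ 2 * Ux x * B :=
      mul_le_mul_of_nonneg_left (hUB x) (mul_nonneg (sq_nonneg _) (hU0 x))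
    have h4 : g₁ x ^ 2 + g x ^ 2 * Ux x * Ux x ≤ (1 + B) * (g₁ x ^ 2 + Ux x * g x ^ 2) := by
      nlinarith [mul_nonneg hB (sq_nonneg (g₁ x)), mul_nonneg (hU0 x) (sq_nonneg (g x))]
    have h5 : 0 ≤ 2 * L ^ 2 := by positivity
    have := mul_le_mul_of_nonneg_left h4 h5
    simp only
    linarith

theorem isWeakDeriv_of_hasDerivAt {g g' : ℝ → ℝ} (hg : ∀ x, HasDerivAt g (g' x) x)
    (hg' : Continuous g') : IsWeakDeriv g g' := by
  have hgc : Continuous g := continuous_iff_continuousAt.2 fun x => (hg x).continuousAt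
  have h := isWeakDeriv_primitive hg'.locallyIntegrable
  have hc : IsWeakDeriv (fun _ => g 0) (fun _ => (0 : ℝ)) := by
    refine ⟨locallyIntegrable_const _, locallyIntegrable_const _, fun θ hθ hcs => ?_⟩
    have : ∫ x, deriv θ x = 0 := integral_eq_zero_of_hasDerivAt_of_integrable
      (fun x => (hθ.differentiable (by simp) x).hasDerivAt)
      ((hθ.continuous_deriv (by simp)).integrable_of_hasCompactSupport hcs.deriv)
      (hθ.continuous.integrable_of_hasCompactSupport hcs)
    rw [integral_const_mul, this]
    simp
  have := hc.add h
  simp only [zero_add] at this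
  convert this using 2 with x
  rw [intervalIntegral.integral_eq_sub_of_hasDerivAt (fun y _ => hg y)
    (hg'.intervalIntegrable _ _)]
  ring

/-- The `H¹` bound gives `|v| ≤ M`, so all arguments of `f` stay in `[um - M, up + M]`. Compactness
of this interval supplies `c` and `L` before the wave and the perturbation are chosen, which keeps
them independent of time. -/
theorem flux_estimate {f : ℝ → ℝ} (hf : ContDiff ℝ 2 f) (hconv : ∀ u, 0 < iteratedDeriv 2 f u)
    (um up B M : ℝ) (hu : um ≤ up) (hM : 0 ≤ M) : ∃ c > 0, ∃ L ≥ 0, ∀ U Ux : ℝ → ℝ,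
      (∀ x, HasDerivAt U (Ux x) x) → Continuous Ux → (∀ x, 0 ≤ Ux x) → (∀ x, Ux x ≤ B) →
      (∀ x, U x ∈ Icc um up) → ∀ v v₁ v₂ : L2, IsWeakDeriv v v₁ → IsWeakDeriv v₁ v₂ →
      ‖v‖ ^ 2 + ‖v₁‖ ^ 2 ≤ M ^ 2 → ∀ N, IsWeakDeriv (fun x => f (v x + U x) - f (U x)) N →
      MemLp N 2 (volume : Measure ℝ) ∧ c * ∫ x, Ux x * v x ^ 2 ≤ ∫ x, N x * v x ∧
        ∫ x, N x ^ 2 ≤ L * (‖v₁‖ ^ 2 + ∫ x, Ux x * v x ^ 2) := by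
  set f₁ := deriv f
  set f₂ := deriv f₁
  have e2 : iteratedDeriv 2 f = f₂ := by
    rw [iteratedDeriv_succ, iteratedDeriv_one]
  have hf₁C : ContDiff ℝ 1 f₁ := (contDiff_succ_iff_deriv (n := 1)).1 hf |>.2.2
  have hf₂c : Continuous f₂ := hf₁C.continuous_deriv le_rfl
  have hd : ∀ x, HasDerivAt f (f₁ x) x := fun x => (hf.differentiable (by simp) x).hasDerivAt
  have hd₁ : ∀ x, HasDerivAt f₁ (f₂ x) x := fun x =>
    (hf₁C.differentiable (by simp) x).hasDerivAt
  set J := Icc (um - M) (up + M)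
  have hJne : J.Nonempty := ⟨um, by constructor <;> linarith⟩
  have hJc : IsCompact J := isCompact_Icc
  obtain ⟨x₀, -, hx₀⟩ := hJc.exists_isMinOn hJne hf₂c.continuousOn
  obtain ⟨L₁, hL₁⟩ := hJc.exists_bound_of_continuousOn hf₁C.continuous.continuousOn
  obtain ⟨L₂, hL₂⟩ := hJc.exists_bound_of_continuousOn hf₂c.continuousOn
  have hc0 : 0 < f₂ x₀ := e2 ▸ hconv x₀
  set L := max 0 (max L₁ L₂)
  refine ⟨f₂ x₀ / 2, by positivity, 2 * L ^ 2 * (1 + |B|), by positivity, ?_⟩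
  intro U Ux hU hUc hU0 hUB hUJ v v₁ v₂ hv hv₁ hvM N hN
  obtain ⟨g, g₁, hg, hg₁, hg₁c, hgd⟩ := hv.exists_contDiff_repr hv₁
  have hgm : MemLp g 2 (volume : Measure ℝ) := (memLp_congr_ae hg).1 (Lp.memLp v)
  have hgm₁ : MemLp g₁ 2 (volume : Measure ℝ) := (memLp_congr_ae hg₁).1 (Lp.memLp v₁)
  have hn0 : ‖v‖ ^ 2 = ∫ x, g x ^ 2 := by
    rw [L2.norm_sq_eq_integral]
    exact integral_congr_ae (hg.mono fun x hx => by simp only [hx])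
  have hn1 : ‖v₁‖ ^ 2 = ∫ x, g₁ x ^ 2 := by
    rw [L2.norm_sq_eq_integral]
    exact integral_congr_ae (hg₁.mono fun x hx => by simp only [hx])
  have hq : ∫ x, Ux x * v x ^ 2 = ∫ x, Ux x * g x ^ 2 :=
    integral_congr_ae (hg.mono fun x hx => by simp only [hx])
  have hsup : ∀ x, |g x| ≤ M := fun x => by
    refine abs_le_of_sq_le_sq ?_ hM
    have := sq_le_integral_of_hasDerivAt hgd hgm hgm₁ x
    linarith
  have hUcc : Continuous U := continuous_iff_continuousAt.2 fun x => (hU x).continuousAt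
  have hgc : Continuous g := continuous_iff_continuousAt.2 fun x => (hgd x).continuousAt
  have key := flux_estimate_classical hd hd₁ (convex_Icc (um - M) (up + M)) (c := f₂ x₀) (L := L)
    (B := |B|) (le_max_left _ _) (fun x hx => hx₀ hx)
    (fun x hx => (hL₁ x hx).trans ((le_max_left _ _).trans (le_max_right _ _)))
    (fun x hx => (hL₂ x hx).trans ((le_max_right _ _).trans (le_max_right _ _)))
    hU hUc hU0 (fun x => (hUB x).trans (le_abs_self B))
    (fun x => ⟨by linarith [(hUJ x).1], by linarith [(hUJ x).2]⟩)
    (fun x => ⟨by linarith [(hUJ x).1, neg_le_of_abs_le (hsup x)],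
      by linarith [(hUJ x).2, le_of_abs_le (hsup x)]⟩) hgd hg₁c hgm hgm₁
  have hclass : IsWeakDeriv (fun x => f (g x + U x) - f (U x))
      (fun x => f₁ (g x + U x) * (g₁ x + Ux x) - f₁ (U x) * Ux x) := by
    refine isWeakDeriv_of_hasDerivAt (fun x => ?_) ?_
    · exact (HasDerivAt.comp x (hd _) ((hgd x).add (hU x))).sub (HasDerivAt.comp x (hd _) (hU x))
    · have := hf₁C.continuous
      fun_prop
  -- Weak derivatives are unique, so the given `N` agrees almost everywhere with the chain rule
  -- expression for the `C¹` representative.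
  have hNe := hN.unique (hclass.congr_ae (hg.mono fun x hx => by simp only [hx]) ae_eq_rfl)
  refine ⟨(memLp_congr_ae hNe).2 key.1, ?_, ?_⟩
  · rw [hq]
    refine key.2.1.trans (le_of_eq (integral_congr_ae ?_))
    filter_upwards [hNe, hg] with x h1 h2
    rw [h1, h2]
  · rw [hq, hn1]
    refine le_trans (le_of_eq (integral_congr_ae ?_)) key.2.2
    filter_upwards [hNe] with x h1
    rw [h1]

/-! ## Symbol classes -/

/-- `H t` is `n` times differentiable, and `H t` and its first `n` derivatives are
bounded by a constant multiple of `W t`, uniformly in `t ≥ 0`. -/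
def SymbolBound : ℕ → (ℝ → ℝ → ℝ) → (ℝ → ℝ → ℝ) → Prop
  | 0, W, H => ∃ C, ∀ t, 0 ≤ t → ∀ y, |H t y| ≤ C * W t y
  | n + 1, W, H => (∃ C, ∀ t, 0 ≤ t → ∀ y, |H t y| ≤ C * W t y) ∧
      ∃ H' : ℝ → ℝ → ℝ, (∀ t, 0 ≤ t → ∀ y, HasDerivAt (H t) (H' t y) y) ∧ SymbolBound n W H'

namespace SymbolBound

variable {n : ℕ} {W W' H G : ℝ → ℝ → ℝ}

theorem bound (h : SymbolBound n W H) : ∃ C, ∀ t, 0 ≤ t → ∀ y, |H t y| ≤ C * W t y := by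
  cases n with
  | zero => exact h
  | succ n => exact h.1

theorem of_succ (h : SymbolBound (n + 1) W H) : SymbolBound n W H := by
  induction n generalizing H with
  | zero => exact h.1
  | succ n ih =>
    obtain ⟨h1, H', h2, h3⟩ := h
    exact ⟨h1, H', h2, ih h3⟩

theorem add (h : SymbolBound n W H) (g : SymbolBound n W G) :
    SymbolBound n W (fun t y => H t y + G t y) := by
  have key : ∀ {H G : ℝ → ℝ → ℝ}, (∃ C, ∀ t, 0 ≤ t → ∀ y, |H t y| ≤ C * W t y) →
      (∃ C, ∀ t, 0 ≤ t → ∀ y, |G t y| ≤ C * W t y) →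
      ∃ C, ∀ t, 0 ≤ t → ∀ y, |H t y + G t y| ≤ C * W t y := by
    rintro H G ⟨C, hC⟩ ⟨D, hD⟩
    refine ⟨C + D, fun t ht y => (abs_add_le _ _).trans ?_⟩
    linarith [hC t ht y, hD t ht y]
  induction n generalizing H G with
  | zero => exact key h g
  | succ n ih =>
    obtain ⟨h1, H', h2, h3⟩ := h
    obtain ⟨g1, G', g2, g3⟩ := g
    exact ⟨key h1 g1, _, fun t ht y => (h2 t ht y).add (g2 t ht y), ih h3 g3⟩

theorem const_mul (c : ℝ) (h : SymbolBound n W H) : SymbolBound n W (fun t y => c * H t y) := by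
  have key : ∀ {H : ℝ → ℝ → ℝ}, (∃ C, ∀ t, 0 ≤ t → ∀ y, |H t y| ≤ C * W t y) →
      ∃ C, ∀ t, 0 ≤ t → ∀ y, |c * H t y| ≤ C * W t y := by
    rintro H ⟨C, hC⟩
    refine ⟨|c| * C, fun t ht y => ?_⟩
    rw [abs_mul, mul_assoc]
    exact mul_le_mul_of_nonneg_left (hC t ht y) (abs_nonneg _)
  induction n generalizing H with
  | zero => exact key h
  | succ n ih =>
    obtain ⟨h1, H', h2, h3⟩ := h
    exact ⟨key h1, _, fun t ht y => (h2 t ht y).const_mul c, ih h3⟩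

theorem mul (h : SymbolBound n W H) (g : SymbolBound n W' G) :
    SymbolBound n (fun t y => W t y * W' t y) (fun t y => H t y * G t y) := by
  have key : ∀ {H G : ℝ → ℝ → ℝ}, (∃ C, ∀ t, 0 ≤ t → ∀ y, |H t y| ≤ C * W t y) →
      (∃ C, ∀ t, 0 ≤ t → ∀ y, |G t y| ≤ C * W' t y) →
      ∃ C, ∀ t, 0 ≤ t → ∀ y, |H t y * G t y| ≤ C * (W t y * W' t y) := by
    rintro H G ⟨C, hC⟩ ⟨D, hD⟩
    refine ⟨C * D, fun t ht y => ?_⟩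
    rw [abs_mul]
    refine (mul_le_mul (hC t ht y) (hD t ht y) (abs_nonneg _)
      ((abs_nonneg _).trans (hC t ht y))).trans (le_of_eq (by ring))
  induction n generalizing H G with
  | zero => exact key h g
  | succ n ih =>
    have h' := h
    have g' := g
    obtain ⟨h1, H', h2, h3⟩ := h
    obtain ⟨g1, G', g2, g3⟩ := g
    exact ⟨key h1 g1, _, fun t ht y => (h2 t ht y).mul (g2 t ht y),
      (ih h3 g'.of_succ).add (ih h'.of_succ g3)⟩

theorem mono (h : SymbolBound n W H) {K : ℝ} (hW : ∀ t, 0 ≤ t → ∀ y, 0 ≤ W t y)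
    (hWW : ∀ t, 0 ≤ t → ∀ y, W t y ≤ K * W' t y) : SymbolBound n W' H := by
  have key : ∀ {H : ℝ → ℝ → ℝ}, (∃ C, ∀ t, 0 ≤ t → ∀ y, |H t y| ≤ C * W t y) →
      ∃ C, ∀ t, 0 ≤ t → ∀ y, |H t y| ≤ C * W' t y := by
    rintro H ⟨C, hC⟩
    refine ⟨|C| * K, fun t ht y => (hC t ht y).trans ?_⟩
    rw [mul_assoc]
    exact (mul_le_mul_of_nonneg_right (le_abs_self C) (hW t ht y)).trans
      (mul_le_mul_of_nonneg_left (hWW t ht y) (abs_nonneg _))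
  induction n generalizing H with
  | zero => exact key h
  | succ n ih =>
    obtain ⟨h1, H', h2, h3⟩ := h
    exact ⟨key h1, H', h2, ih h3⟩

theorem congr_weight (h : SymbolBound n W H) (e : ∀ t y, W t y = W' t y) :
    SymbolBound n W' H := by
  have : W = W' := funext fun t => funext fun y => e t y
  exact this ▸ h

end SymbolBound

/-! ## The slope of the initial datum -/

/-- `(1 + (εy)²)⁻¹` -/
def decayBase (ε y : ℝ) : ℝ := (1 + (ε * y) ^ 2)⁻¹

/-- `(1 + (εy)²)^{-1/2}` -/
def decayRoot (ε y : ℝ) : ℝ := √(decayBase ε y)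

/-- `κ (1 + (εy)²)^{-q}` -/
def waveSlope (κ ε q y : ℝ) : ℝ := κ * decayBase ε y ^ q

/-- The reciprocal of the derivative `1 + t w₀'(y)` of the characteristic map. -/
def invStretch (κ ε q t y : ℝ) : ℝ := (1 + t * waveSlope κ ε q y)⁻¹

/-- The logarithmic derivative of `waveSlope`. -/
def logSlope (ε q y : ℝ) : ℝ := -(2 * q * ε ^ 2) * (y * decayBase ε y)

section

variable {κ ε q : ℝ}

theorem decayBase_pos (ε y : ℝ) : 0 < decayBase ε y := by unfold decayBase; positivity

theorem decayBase_le_one (ε y : ℝ) : decayBase ε y ≤ 1 :=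
  inv_le_one_of_one_le₀ (by nlinarith [sq_nonneg (ε * y)])

theorem decayRoot_pos (ε y : ℝ) : 0 < decayRoot ε y := Real.sqrt_pos.2 (decayBase_pos ε y)

theorem decayRoot_sq (ε y : ℝ) : decayRoot ε y ^ 2 = decayBase ε y :=
  Real.sq_sqrt (decayBase_pos ε y).le

theorem decayRoot_le_one (ε y : ℝ) : decayRoot ε y ≤ 1 :=
  Real.sqrt_le_one.2 (decayBase_le_one ε y)

theorem abs_mul_decayBase_le (hε : 0 < ε) (y : ℝ) :
    |y * decayBase ε y| ≤ ε⁻¹ * decayRoot ε y := by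
  refine abs_le_of_sq_le_sq ?_ (mul_nonneg (inv_nonneg.2 hε.le) (decayRoot_pos ε y).le)
  rw [mul_pow, mul_pow, decayRoot_sq, inv_pow, sq (decayBase ε y), ← mul_assoc]
  refine mul_le_mul_of_nonneg_right ?_ (decayBase_pos ε y).le
  rw [decayBase, ← div_eq_mul_inv, div_le_iff₀ (by positivity), inv_mul_eq_div,
    le_div_iff₀ (by positivity)]
  nlinarith

theorem hasDerivAt_decayBase (ε y : ℝ) :
    HasDerivAt (decayBase ε) (-(2 * ε ^ 2) * ((y * decayBase ε y) * decayBase ε y)) y := by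
  have h : HasDerivAt (fun y => 1 + (ε * y) ^ 2) (2 * (ε * y) * ε) y := by
    simpa using! (((hasDerivAt_id y).const_mul ε).pow 2).const_add 1
  have hp : (1 + (ε * y) ^ 2) ≠ 0 := by positivity
  convert! h.inv hp using 1
  unfold decayBase
  field_simp

theorem hasDerivAt_mul_decayBase (ε y : ℝ) : HasDerivAt (fun y => y * decayBase ε y)
    (decayBase ε y + -(2 * ε ^ 2) * ((y * decayBase ε y) * (y * decayBase ε y))) y := by
  convert! (hasDerivAt_id y).mul (hasDerivAt_decayBase ε y) using 1
  simp
  ring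

/-- The two functions must be treated together: with `b` the first and `yb` the second, `b' = -2ε²
(yb) b` and `(yb)' = b - 2ε² (yb)²`, so the pair is closed under differentiation. Quadratic terms
are absorbed since the weight is at most one. -/
theorem symbolBound_decay (hε : 0 < ε) (n : ℕ) :
    SymbolBound n (fun _ => decayRoot ε) (fun _ => decayBase ε) ∧
      SymbolBound n (fun _ => decayRoot ε) (fun _ y => y * decayBase ε y) := by
  have h1 : ∃ C, ∀ t : ℝ, 0 ≤ t → ∀ y, |decayBase ε y| ≤ C * decayRoot ε y :=
    ⟨1, fun t _ y => by
      rw [abs_of_pos (decayBase_pos ε y), ← decayRoot_sq]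
      nlinarith [decayRoot_pos ε y, decayRoot_le_one ε y]⟩
  have h2 : ∃ C, ∀ t : ℝ, 0 ≤ t → ∀ y, |y * decayBase ε y| ≤ C * decayRoot ε y :=
    ⟨ε⁻¹, fun t _ y => abs_mul_decayBase_le hε y⟩
  have h3 : ∀ (m : ℕ) (H : ℝ → ℝ → ℝ), SymbolBound m (fun _ y => decayRoot ε y * decayRoot ε y) H →
      SymbolBound m (fun _ => decayRoot ε) H := fun m H h =>
    h.mono (K := 1) (fun t _ y => mul_self_nonneg _) fun t _ y => by
      nlinarith [decayRoot_pos ε y, decayRoot_le_one ε y]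
  induction n with
  | zero => exact ⟨h1, h2⟩
  | succ n ih =>
    exact ⟨⟨h1, _, fun _ _ y => hasDerivAt_decayBase ε y,
        h3 _ _ ((ih.2.mul ih.1).const_mul (-(2 * ε ^ 2)))⟩,
      ⟨h2, _, fun _ _ y => hasDerivAt_mul_decayBase ε y,
        ih.1.add (h3 _ _ ((ih.2.mul ih.2).const_mul (-(2 * ε ^ 2))))⟩⟩

theorem symbolBound_logSlope (hε : 0 < ε) (q : ℝ) (n : ℕ) :
    SymbolBound n (fun _ => decayRoot ε) (fun _ => logSlope ε q) :=
  (symbolBound_decay hε n).2.const_mul _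

theorem waveSlope_pos (hκ : 0 < κ) (ε q y : ℝ) : 0 < waveSlope κ ε q y :=
  mul_pos hκ (Real.rpow_pos_of_pos (decayBase_pos ε y) q)

theorem waveSlope_le (hκ : 0 < κ) (ε : ℝ) (hq : 0 < q) (y : ℝ) : waveSlope κ ε q y ≤ κ :=
  mul_le_of_le_one_right hκ.le
    (Real.rpow_le_one (decayBase_pos ε y).le (decayBase_le_one ε y) hq.le)

theorem hasDerivAt_waveSlope (κ ε q y : ℝ) :
    HasDerivAt (waveSlope κ ε q) (logSlope ε q y * waveSlope κ ε q y) y := by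
  have h := ((hasDerivAt_decayBase ε y).rpow_const (p := q)
    (Or.inl (decayBase_pos ε y).ne')).const_mul κ
  convert! h using 1
  rw [Real.rpow_sub_one (decayBase_pos ε y).ne']
  have := (decayBase_pos ε y).ne'
  unfold logSlope waveSlope
  field_simp

/-- The logarithmic derivative is a bounded symbol, so every derivative of the slope is again
bounded by a multiple of the slope. -/
theorem symbolBound_waveSlope (hκ : 0 < κ) (hε : 0 < ε) (q : ℝ) (n : ℕ) :
    SymbolBound n (fun _ => waveSlope κ ε q) (fun _ => waveSlope κ ε q) := by
  have h1 : ∃ C, ∀ t : ℝ, 0 ≤ t → ∀ y, |waveSlope κ ε q y| ≤ C * waveSlope κ ε q y :=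
    ⟨1, fun t _ y => by rw [abs_of_pos (waveSlope_pos hκ ε q y), one_mul]⟩
  induction n with
  | zero => exact h1
  | succ n ih =>
    refine ⟨h1, _, fun _ _ y => hasDerivAt_waveSlope κ ε q y, ?_⟩
    refine ((symbolBound_logSlope hε q n).mul ih).mono (K := 1)
      (fun t _ y => (mul_pos (decayRoot_pos ε y) (waveSlope_pos hκ ε q y)).le) fun t _ y => ?_
    exact mul_le_mul_of_nonneg_right (decayRoot_le_one ε y) (waveSlope_pos hκ ε q y).le

theorem stretch_pos (hκ : 0 < κ) (ε q : ℝ) {t : ℝ} (ht : 0 ≤ t) (y : ℝ) :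
    0 < 1 + t * waveSlope κ ε q y := by
  have := waveSlope_pos hκ ε q y
  positivity

theorem invStretch_pos (hκ : 0 < κ) (ε q : ℝ) {t : ℝ} (ht : 0 ≤ t) (y : ℝ) :
    0 < invStretch κ ε q t y := inv_pos.2 (stretch_pos hκ ε q ht y)

theorem invStretch_le_one (hκ : 0 < κ) (ε q : ℝ) {t : ℝ} (ht : 0 ≤ t) (y : ℝ) :
    invStretch κ ε q t y ≤ 1 := by
  refine inv_le_one_of_one_le₀ ?_
  have := waveSlope_pos hκ ε q y
  nlinarith [mul_nonneg ht this.le]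

theorem time_mul_slope_mul_invStretch (hκ : 0 < κ) (ε q : ℝ) {t : ℝ} (ht : 0 ≤ t) (y : ℝ) :
    t * waveSlope κ ε q y * invStretch κ ε q t y = 1 - invStretch κ ε q t y := by
  have := (stretch_pos hκ ε q ht y).ne'
  unfold invStretch
  field_simp
  ring

theorem hasDerivAt_invStretch (hκ : 0 < κ) (ε q : ℝ) {t : ℝ} (ht : 0 ≤ t) (y : ℝ) :
    HasDerivAt (invStretch κ ε q t)
      (-1 * (logSlope ε q y * invStretch κ ε q t y)
        + logSlope ε q y * (invStretch κ ε q t y * invStretch κ ε q t y)) y := by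
  have h0 := (stretch_pos hκ ε q ht y).ne'
  have h := (((hasDerivAt_waveSlope κ ε q y).const_mul t).const_add 1).inv h0
  convert! h using 1
  unfold invStretch
  field_simp
  ring

/-- With `r` the logarithmic slope, `E' = -r E + r E²`. Time has disappeared from the right side,
because `t p E = 1 - E`; hence the bounds are uniform in `t`. -/
theorem symbolBound_invStretch (hκ : 0 < κ) (hε : 0 < ε) (q : ℝ) (n : ℕ) :
    SymbolBound n (invStretch κ ε q) (invStretch κ ε q) := by
  have h1 : ∃ C, ∀ t : ℝ, 0 ≤ t → ∀ y, |invStretch κ ε q t y| ≤ C * invStretch κ ε q t y :=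
    ⟨1, fun t ht y => by rw [abs_of_pos (invStretch_pos hκ ε q ht y), one_mul]⟩
  induction n with
  | zero => exact h1
  | succ n ih =>
    refine ⟨h1, _, fun t ht y => hasDerivAt_invStretch hκ ε q ht y, ?_⟩
    have hr := symbolBound_logSlope hε q n
    refine (((hr.mul ih).mono (K := 1) ?_ ?_).const_mul (-1)).add
      ((hr.mul (ih.mul ih)).mono (K := 1) ?_ ?_)
    · exact fun t ht y => (mul_pos (decayRoot_pos ε y) (invStretch_pos hκ ε q ht y)).le
    · intro t ht y
      exact mul_le_mul_of_nonneg_right (decayRoot_le_one ε y) (invStretch_pos hκ ε q ht y).le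
    · intro t ht y
      have := invStretch_pos hκ ε q ht y
      have := decayRoot_pos ε y
      positivity
    · intro t ht y
      exact mul_le_mul (decayRoot_le_one ε y)
        (mul_le_of_le_one_left (invStretch_pos hκ ε q ht y).le (invStretch_le_one hκ ε q ht y))
        (mul_self_nonneg _) zero_le_one

end

theorem SymbolBound.bound_nonneg {n : ℕ} {W H : ℝ → ℝ → ℝ} (h : SymbolBound n W H)
    (hW : ∀ t, 0 ≤ t → ∀ y, 0 ≤ W t y) : ∃ C ≥ 0, ∀ t, 0 ≤ t → ∀ y, |H t y| ≤ C * W t y := by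
  obtain ⟨C, hC⟩ := h.bound
  exact ⟨|C|, abs_nonneg _, fun t ht y => (hC t ht y).trans
    (mul_le_mul_of_nonneg_right (le_abs_self C) (hW t ht y))⟩

/-! ## The Burgers datum and its characteristics -/

/-- `∫₀^∞ dy / (1 + y²)^q` -/
def kernelMass (q : ℝ) : ℝ := ∫ y in Ioi (0 : ℝ), 1 / (1 + y ^ 2) ^ q

theorem integrable_kernel {q : ℝ} (hq : 1 / 2 < q) :
    Integrable fun y : ℝ => 1 / (1 + y ^ 2) ^ q := by
  have h := integrable_rpow_neg_one_add_norm_sq (E := ℝ) (μ := volume) (r := 2 * q)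
    (by simp; linarith)
  refine h.congr (Eventually.of_forall fun y => ?_)
  have : (0 : ℝ) ≤ 1 + y ^ 2 := by positivity
  simp only [Real.norm_eq_abs, sq_abs]
  rw [show -(2 * q) / 2 = -q by ring, Real.rpow_neg this, one_div]

theorem kernelMass_pos {q : ℝ} (hq : 1 / 2 < q) : 0 < kernelMass q := by
  have hpos : ∀ y : ℝ, 0 < 1 / (1 + y ^ 2) ^ q := fun y => by positivity
  rw [kernelMass, setIntegral_pos_iff_support_of_nonneg_ae
    (Eventually.of_forall fun y => (hpos y).le) (integrable_kernel hq).integrableOn]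
  have : Function.support (fun y : ℝ => 1 / (1 + y ^ 2) ^ q) = univ :=
    eq_univ_of_forall fun y => (hpos y).ne'
  rw [this, univ_inter]
  simp

theorem abs_integral_kernel_le {q : ℝ} (hq : 1 / 2 < q) (z : ℝ) :
    |∫ y in (0 : ℝ)..z, 1 / (1 + y ^ 2) ^ q| ≤ kernelMass q := by
  have hpos : ∀ y : ℝ, 0 ≤ 1 / (1 + y ^ 2) ^ q := fun y => by positivity
  have key : ∀ z : ℝ, 0 ≤ z → |∫ y in (0 : ℝ)..z, 1 / (1 + y ^ 2) ^ q| ≤ kernelMass q := by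
    intro z hz
    rw [abs_of_nonneg (intervalIntegral.integral_nonneg hz fun y _ => hpos y),
      intervalIntegral.integral_of_le hz]
    exact setIntegral_mono_set (integrable_kernel hq).integrableOn
      (Eventually.of_forall hpos) Ioc_subset_Ioi_self.eventuallyLE
  rcases le_total 0 z with h | h
  · exact key z h
  · have := intervalIntegral.integral_comp_neg (a := 0) (b := z)
      (fun y : ℝ => 1 / (1 + y ^ 2) ^ q)
    simp only [neg_sq, neg_zero] at this
    rw [this, intervalIntegral.integral_symm, abs_neg]
    exact key (-z) (neg_nonneg.2 h)

/-- The maximal slope of `burgersData`. -/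
def slopeMax (wm wp ε q : ℝ) : ℝ := (wp - wm) / 2 * (kernelMass q)⁻¹ * ε

section

variable {wm wp ε q : ℝ}

theorem slopeMax_pos (hw : wm < wp) (hε : 0 < ε) (hq : 1 / 2 < q) : 0 < slopeMax wm wp ε q := by
  have := kernelMass_pos hq
  have : 0 < wp - wm := sub_pos.2 hw
  unfold slopeMax
  positivity

theorem burgersData_mem_Icc (hw : wm < wp) (hq : 1 / 2 < q) (x : ℝ) :
    burgersData wm wp ε q x ∈ Icc wm wp := by
  have h := abs_le.1 (abs_integral_kernel_le hq (ε * x))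
  have hK := kernelMass_pos hq
  have h1 : (kernelMass q)⁻¹ * (∫ y in (0 : ℝ)..(ε * x), 1 / (1 + y ^ 2) ^ q) ≤ 1 := by
    rw [inv_mul_le_iff₀ hK]; linarith [h.2]
  have h2 : -1 ≤ (kernelMass q)⁻¹ * ∫ y in (0 : ℝ)..(ε * x), 1 / (1 + y ^ 2) ^ q := by
    rw [le_inv_mul_iff₀ hK]; linarith [h.1]
  have e : burgersData wm wp ε q x = (wm + wp) / 2 + (wp - wm) / 2 *
      ((kernelMass q)⁻¹ * ∫ y in (0 : ℝ)..(ε * x), 1 / (1 + y ^ 2) ^ q) := by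
    rw [burgersData, kernelMass, mul_assoc]
  rw [e]
  constructor <;> nlinarith

theorem hasDerivAt_burgersData (wm wp ε q x : ℝ) : HasDerivAt (burgersData wm wp ε q)
    (waveSlope (slopeMax wm wp ε q) ε q x) x := by
  have hk := continuous_kernel q
  have h1 : HasDerivAt (fun z : ℝ => ∫ y in (0 : ℝ)..z, 1 / (1 + y ^ 2) ^ q)
      (1 / (1 + (ε * x) ^ 2) ^ q) (ε * x) :=
    intervalIntegral.integral_hasDerivAt_right (hk.intervalIntegrable _ _)
      hk.aestronglyMeasurable.stronglyMeasurableAtFilter hk.continuousAt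
  have h2 : HasDerivAt (fun x : ℝ => ε * x) ε x := by
    simpa using (hasDerivAt_id x).const_mul ε
  have h3 := ((HasDerivAt.comp x h1 h2).const_mul
    ((wp - wm) / 2 * (kernelMass q)⁻¹)).const_add ((wm + wp) / 2)
  convert! h3 using 1
  rw [waveSlope, slopeMax, decayBase, Real.inv_rpow (by positivity), one_div]
  ring

theorem hasDerivAt_charFoot (hw : wm < wp) (hε : 0 < ε) (hq : 1 / 2 < q) {t : ℝ} (ht : 0 ≤ t)
    (x : ℝ) : HasDerivAt (charFoot wm wp ε q t)
      (invStretch (slopeMax wm wp ε q) ε q t (charFoot wm wp ε q t x)) x := by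
  set κ := slopeMax wm wp ε q
  have hκ : 0 < κ := slopeMax_pos hw hε hq
  have hd : ∀ y, HasDerivAt (charMap wm wp ε q t) (1 + t * waveSlope κ ε q y) y := fun y => by
    convert! (hasDerivAt_id y).add ((hasDerivAt_burgersData wm wp ε q y).mul_const t) using 1
    ring
  have hp : Continuous (waveSlope κ ε q) :=
    continuous_iff_continuousAt.2 fun y => (hasDerivAt_waveSlope κ ε q y).continuousAt
  have hs : HasStrictDerivAt (charMap wm wp ε q t)
      (1 + t * waveSlope κ ε q (charFoot wm wp ε q t x)) (charFoot wm wp ε q t x) :=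
    hasStrictDerivAt_of_hasDerivAt_of_continuousAt (Eventually.of_forall hd)
      (by fun_prop : Continuous fun y => 1 + t * waveSlope κ ε q y).continuousAt
  have hinv := hs.to_local_left_inverse (stretch_pos hκ ε q ht _).ne'
    (g := Function.invFun (charMap wm wp ε q t))
    (Eventually.of_forall (Function.leftInverse_invFun (charMap_bijective hw.le hε.le ht q).1))
  have e : charMap wm wp ε q t (charFoot wm wp ε q t x) = x := charFoot_spec hw.le hε.le ht q x
  rw [e] at hinv
  exact hinv.hasDerivAt

/-- Subtracting the characteristic equations at times `s` and `t` expresses the increment of the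
foot exactly through the divided slope of `w`. Monotonicity makes that slope nonnegative, so the
factor to be divided by is at least one; this gives continuity first and then the derivative. -/
theorem hasDerivAt_charFoot_time (hw : wm < wp) (hε : 0 < ε) {t : ℝ} (ht : 0 < t) (x : ℝ) :
    HasDerivAt (fun s => charFoot wm wp ε q s x)
      (-burgersData wm wp ε q (charFoot wm wp ε q t x) *
        invStretch (slopeMax wm wp ε q) ε q t (charFoot wm wp ε q t x)) t := by
  set w := burgersData wm wp ε q
  set φ : ℝ → ℝ := fun s => charFoot wm wp ε q s x
  have hmono : Monotone w := monotone_burgersData hw.le hε.le q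
  have hspec : ∀ s, 0 ≤ s → φ s + w (φ s) * s = x := fun s hs => charFoot_spec hw.le hε.le hs q x
  have hdw := hasDerivAt_burgersData wm wp ε q (φ t)
  have hd0 : ∀ s, 0 ≤ dslope w (φ t) (φ s) := by
    intro s
    rcases eq_or_ne (φ s) (φ t) with h | h
    · rw [h, dslope_same]
      exact hmono.deriv_nonneg
    · rw [dslope_of_ne _ h]
      exact (hmono.monotoneOn univ).slope_nonneg (mem_univ _) (mem_univ _)
  have hid : ∀ s, 0 ≤ s → (φ s - φ t) * (1 + s * dslope w (φ t) (φ s)) = -w (φ t) * (s - t) := by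
    intro s hs
    have h1 := sub_smul_dslope w (φ t) (φ s)
    rw [smul_eq_mul] at h1
    have h2 := hspec s hs
    have h3 := hspec t ht.le
    linear_combination h2 - h3 + s * h1
  have hnear : ∀ᶠ s in 𝓝 t, 0 ≤ s := by
    filter_upwards [lt_mem_nhds ht] with s hs using hs.le
  have hcont : Tendsto φ (𝓝 t) (𝓝 (φ t)) := by
    rw [tendsto_iff_norm_sub_tendsto_zero]
    refine squeeze_zero' (Eventually.of_forall fun _ => norm_nonneg _)
      (g := fun s => |w (φ t)| * |s - t|) ?_ ?_
    · filter_upwards [hnear] with s hs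
      have h1 := congrArg abs (hid s hs)
      have h2 : 0 ≤ s * dslope w (φ t) (φ s) := mul_nonneg hs (hd0 s)
      have h3 : 0 ≤ 1 + s * dslope w (φ t) (φ s) := by linarith
      rw [abs_mul, abs_mul, abs_neg, abs_of_nonneg h3] at h1
      rw [← h1, Real.norm_eq_abs]
      exact le_mul_of_one_le_right (abs_nonneg _) (by linarith)
    · have : Continuous fun s => |w (φ t)| * |s - t| := by fun_prop
      simpa using this.tendsto t
  have hdl : Tendsto (fun s => dslope w (φ t) (φ s)) (𝓝 t)
      (𝓝 (waveSlope (slopeMax wm wp ε q) ε q (φ t))) := by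
    have h1 : ContinuousAt (dslope w (φ t)) (φ t) :=
      continuousAt_dslope_same.2 hdw.differentiableAt
    have h2 := h1.tendsto.comp hcont
    rwa [dslope_same, hdw.deriv] at h2
  rw [hasDerivAt_iff_tendsto_slope]
  have hlim : Tendsto (fun s => -w (φ t) * (1 + s * dslope w (φ t) (φ s))⁻¹) (𝓝[≠] t)
      (𝓝 (-w (φ t) * invStretch (slopeMax wm wp ε q) ε q t (φ t))) := by
    refine (Tendsto.const_mul _ (Tendsto.inv₀ ?_ ?_)).mono_left nhdsWithin_le_nhds
    · exact (tendsto_id.mul hdl).const_add 1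
    · have hp := hmono.deriv_nonneg (x := φ t)
      rw [hdw.deriv] at hp
      have := mul_nonneg ht.le hp
      positivity
  refine hlim.congr' ?_
  filter_upwards [nhdsWithin_le_nhds hnear, self_mem_nhdsWithin] with s hs hne
  have h2 : 0 ≤ s * dslope w (φ t) (φ s) := mul_nonneg hs (hd0 s)
  have h3 : s - t ≠ 0 := sub_ne_zero.2 hne
  rw [slope_def_field, eq_div_iff h3, mul_right_comm, ← hid s hs]
  field_simp

end

/-! ## Composition with the inverse of `f'` -/

section

variable {f : ℝ → ℝ} {um up ε q : ℝ}

/-- `(f')⁻¹ ∘ w₀` -/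
def waveProfile (f : ℝ → ℝ) (um up ε q y : ℝ) : ℝ :=
  Function.invFun (deriv f) (burgersData (deriv f um) (deriv f up) ε q y)

theorem strictMono_deriv_of_convex (hconv : ∀ u, 0 < iteratedDeriv 2 f u) :
    StrictMono (deriv f) := by
  refine strictMono_of_deriv_pos fun u => ?_
  have := hconv u
  rwa [iteratedDeriv_succ, iteratedDeriv_one] at this

theorem waveProfile_spec (hf : ContDiff ℝ 5 f) (hconv : ∀ u, 0 < iteratedDeriv 2 f u)
    (hu : um < up) (hq : 1 / 2 < q) (y : ℝ) :
    deriv f (waveProfile f um up ε q y) = burgersData (deriv f um) (deriv f up) ε q y ∧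
      waveProfile f um up ε q y ∈ Icc um up := by
  have hm := strictMono_deriv_of_convex hconv
  have hc : Continuous (deriv f) := hf.continuous_deriv (by norm_num)
  obtain ⟨u, hu1, hu2⟩ := intermediate_value_Icc hu.le hc.continuousOn
    (burgersData_mem_Icc (ε := ε) (hm hu) hq y)
  have e : waveProfile f um up ε q y = u := by
    rw [waveProfile, ← hu2]
    exact Function.leftInverse_invFun hm.injective u
  rw [e]
  exact ⟨hu2, hu1⟩

theorem hasDerivAt_waveProfile (hf : ContDiff ℝ 5 f) (hconv : ∀ u, 0 < iteratedDeriv 2 f u)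
    (hu : um < up) (hq : 1 / 2 < q) (y : ℝ) : HasDerivAt (waveProfile f um up ε q)
      ((iteratedDeriv 2 f (waveProfile f um up ε q y))⁻¹ *
        waveSlope (slopeMax (deriv f um) (deriv f up) ε q) ε q y) y := by
  have hm := strictMono_deriv_of_convex hconv
  have hspec := waveProfile_spec (ε := ε) hf hconv hu hq y
  set u := waveProfile f um up ε q y
  have hC : ContDiff ℝ 4 (deriv f) := (contDiff_succ_iff_deriv (n := 4)).1 hf |>.2.2
  have hs : HasStrictDerivAt (deriv f) (iteratedDeriv 2 f u) u := by
    rw [iteratedDeriv_succ, iteratedDeriv_one]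
    exact hC.contDiffAt.hasStrictDerivAt (by norm_num)
  have hinv := (hs.to_local_left_inverse (hconv u).ne'
    (Eventually.of_forall (Function.leftInverse_invFun hm.injective))).hasDerivAt
  rw [hspec.1] at hinv
  exact HasDerivAt.comp y hinv (hasDerivAt_burgersData _ _ ε q y)

end

/-! ## Derivatives of the approximate rarefaction wave -/

/-- `1 / f''` along the wave profile. -/
def invCurv (f : ℝ → ℝ) (um up ε q y : ℝ) : ℝ :=
  (iteratedDeriv 2 f (waveProfile f um up ε q y))⁻¹

/-- The slope of the datum for the Burgers variable `f'(u)`. -/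
def profileSlope (f : ℝ → ℝ) (um up ε q y : ℝ) : ℝ :=
  waveSlope (slopeMax (deriv f um) (deriv f up) ε q) ε q y

/-- The coefficient of `invStretch ^ 2` in the second derivative of the wave. -/
def secondCoefA (f : ℝ → ℝ) (um up ε q y : ℝ) : ℝ :=
  -1 * ((invCurv f um up ε q y * invCurv f um up ε q y * invCurv f um up ε q y *
    iteratedDeriv 3 f (waveProfile f um up ε q y)) *
      (profileSlope f um up ε q y * profileSlope f um up ε q y))

/-- The coefficient of `invStretch ^ 3` in the second derivative of the wave. -/
def secondCoefB (f : ℝ → ℝ) (um up ε q y : ℝ) : ℝ :=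
  invCurv f um up ε q y * (profileSlope f um up ε q y * logSlope ε q y)

/-- `invStretch` for the Burgers variable `f'(u)`. -/
def profileStretch (f : ℝ → ℝ) (um up ε q t y : ℝ) : ℝ :=
  invStretch (slopeMax (deriv f um) (deriv f up) ε q) ε q t y

/-- The weight controlling all derivatives of the wave from the second one on. -/
def waveWeight (f : ℝ → ℝ) (um up ε q t y : ℝ) : ℝ :=
  profileSlope f um up ε q y * (profileSlope f um up ε q y + decayRoot ε y) *
    (profileStretch f um up ε q t y * profileStretch f um up ε q t y)

/-- The second space derivative of the wave, along characteristics. -/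
def waveSecond (f : ℝ → ℝ) (um up ε q t y : ℝ) : ℝ :=
  secondCoefA f um up ε q y * (profileStretch f um up ε q t y * profileStretch f um up ε q t y) +
    secondCoefB f um up ε q y * (profileStretch f um up ε q t y *
      (profileStretch f um up ε q t y * profileStretch f um up ε q t y))

/-- The foot of the characteristic for the Burgers variable `f'(u)`. -/
def profileFoot (f : ℝ → ℝ) (um up ε q t x : ℝ) : ℝ :=
  charFoot (deriv f um) (deriv f up) ε q t x

theorem rarefaction_eq (f : ℝ → ℝ) (um up ε q t x : ℝ) :
    rarefaction f um up ε q t x = waveProfile f um up ε q (profileFoot f um up ε q t x) := rfl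

theorem hasDerivAt_iteratedDeriv {f : ℝ → ℝ} {n : ℕ} (hf : ContDiff ℝ n f) {k : ℕ} (hk : k < n)
    (u : ℝ) : HasDerivAt (iteratedDeriv k f) (iteratedDeriv (k + 1) f u) u := by
  rw [iteratedDeriv_succ]
  exact (hf.differentiable_iteratedDeriv k (by exact_mod_cast hk) u).hasDerivAt

section

variable {f : ℝ → ℝ} {um up ε q : ℝ}

theorem slope_lt (hconv : ∀ u, 0 < iteratedDeriv 2 f u) (hu : um < up) :
    deriv f um < deriv f up := strictMono_deriv_of_convex hconv hu

theorem profileMax_pos (hconv : ∀ u, 0 < iteratedDeriv 2 f u) (hu : um < up) (hε : 0 < ε)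
    (hq : 1 / 2 < q) : 0 < slopeMax (deriv f um) (deriv f up) ε q :=
  slopeMax_pos (slope_lt hconv hu) hε hq

theorem hasDerivAt_waveProfile' (hf : ContDiff ℝ 5 f) (hconv : ∀ u, 0 < iteratedDeriv 2 f u)
    (hu : um < up) (hq : 1 / 2 < q) (y : ℝ) : HasDerivAt (waveProfile f um up ε q)
      (invCurv f um up ε q y * profileSlope f um up ε q y) y :=
  hasDerivAt_waveProfile hf hconv hu hq y

theorem hasDerivAt_iteratedDeriv_waveProfile (hf : ContDiff ℝ 5 f)
    (hconv : ∀ u, 0 < iteratedDeriv 2 f u) (hu : um < up) (hq : 1 / 2 < q) {k : ℕ} (hk : k < 5)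
    (y : ℝ) : HasDerivAt (fun y => iteratedDeriv k f (waveProfile f um up ε q y))
      (iteratedDeriv (k + 1) f (waveProfile f um up ε q y) *
        (invCurv f um up ε q y * profileSlope f um up ε q y)) y :=
  HasDerivAt.comp y (hasDerivAt_iteratedDeriv (n := 5) hf hk _)
    (hasDerivAt_waveProfile' hf hconv hu hq y)

theorem hasDerivAt_invCurv (hf : ContDiff ℝ 5 f) (hconv : ∀ u, 0 < iteratedDeriv 2 f u)
    (hu : um < up) (hq : 1 / 2 < q) (y : ℝ) : HasDerivAt (invCurv f um up ε q)
      (-1 * ((invCurv f um up ε q y * invCurv f um up ε q y * invCurv f um up ε q y *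
        iteratedDeriv 3 f (waveProfile f um up ε q y)) * profileSlope f um up ε q y)) y := by
  have h := (hasDerivAt_iteratedDeriv_waveProfile (ε := ε) hf hconv hu hq (k := 2) (by norm_num)
    y).inv (hconv _).ne'
  convert! h using 1
  rw [invCurv]
  have := (hconv (waveProfile f um up ε q y)).ne'
  field_simp

theorem exists_bound_iteratedDeriv_waveProfile (hf : ContDiff ℝ 5 f)
    (hconv : ∀ u, 0 < iteratedDeriv 2 f u) (hu : um < up) (hq : 1 / 2 < q) {k : ℕ} (hk : k ≤ 5) :
    ∃ C, ∀ y, |iteratedDeriv k f (waveProfile f um up ε q y)| ≤ C := by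
  obtain ⟨C, hC⟩ := (isCompact_Icc (a := um) (b := up)).exists_bound_of_continuousOn
    (hf.continuous_iteratedDeriv k (by exact_mod_cast hk)).continuousOn
  exact ⟨C, fun y => hC _ (waveProfile_spec hf hconv hu hq y).2⟩

theorem exists_bound_invCurv (hf : ContDiff ℝ 5 f)
    (hconv : ∀ u, 0 < iteratedDeriv 2 f u) (hu : um < up) (hq : 1 / 2 < q) :
    ∃ C, ∀ y, |invCurv f um up ε q y| ≤ C := by
  have hc : Continuous fun u => (iteratedDeriv 2 f u)⁻¹ :=
    (hf.continuous_iteratedDeriv 2 (by norm_num)).inv₀ fun u => (hconv u).ne'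
  obtain ⟨C, hC⟩ := (isCompact_Icc (a := um) (b := up)).exists_bound_of_continuousOn hc.continuousOn
  exact ⟨C, fun y => hC _ (waveProfile_spec hf hconv hu hq y).2⟩

theorem symbolBound_profileSlope (hconv : ∀ u, 0 < iteratedDeriv 2 f u) (hu : um < up)
    (hε : 0 < ε) (hq : 1 / 2 < q) (n : ℕ) :
    SymbolBound n (fun _ => profileSlope f um up ε q) (fun _ => profileSlope f um up ε q) :=
  symbolBound_waveSlope (profileMax_pos hconv hu hε hq) hε q n

theorem profileSlope_pos (hconv : ∀ u, 0 < iteratedDeriv 2 f u) (hu : um < up)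
    (hε : 0 < ε) (hq : 1 / 2 < q) (y : ℝ) : 0 < profileSlope f um up ε q y :=
  waveSlope_pos (profileMax_pos hconv hu hε hq) ε q y

theorem profileSlope_le (hconv : ∀ u, 0 < iteratedDeriv 2 f u) (hu : um < up)
    (hε : 0 < ε) (hq : 1 / 2 < q) (y : ℝ) :
    profileSlope f um up ε q y ≤ slopeMax (deriv f um) (deriv f up) ε q :=
  waveSlope_le (profileMax_pos hconv hu hε hq) ε (by linarith) y

theorem profileStretch_pos (hconv : ∀ u, 0 < iteratedDeriv 2 f u) (hu : um < up)
    (hε : 0 < ε) (hq : 1 / 2 < q) {t : ℝ} (ht : 0 ≤ t) (y : ℝ) :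
    0 < profileStretch f um up ε q t y :=
  invStretch_pos (profileMax_pos hconv hu hε hq) ε q ht y

theorem profileStretch_le_one (hconv : ∀ u, 0 < iteratedDeriv 2 f u) (hu : um < up)
    (hε : 0 < ε) (hq : 1 / 2 < q) {t : ℝ} (ht : 0 ≤ t) (y : ℝ) :
    profileStretch f um up ε q t y ≤ 1 :=
  invStretch_le_one (profileMax_pos hconv hu hε hq) ε q ht y

theorem waveWeight_nonneg (hconv : ∀ u, 0 < iteratedDeriv 2 f u) (hu : um < up)
    (hε : 0 < ε) (hq : 1 / 2 < q) (t : ℝ) (y : ℝ) : 0 ≤ waveWeight f um up ε q t y := by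
  have h1 := profileSlope_pos hconv hu hε hq y
  have h2 := decayRoot_pos ε y
  have h3 := mul_self_nonneg (profileStretch f um up ε q t y)
  unfold waveWeight
  positivity

/-- The two families are coupled: differentiating `f⁽ᵏ⁾` along the profile brings in `1/f''`, and
differentiating `1/f''` brings in `f'''`. The restriction `k + m ≤ 5` is the regularity of `f`; the
coefficient `f'''` then limits `1/f''` to three derivatives. -/
theorem symbolBound_curv (hf : ContDiff ℝ 5 f) (hconv : ∀ u, 0 < iteratedDeriv 2 f u)
    (hu : um < up) (hε : 0 < ε) (hq : 1 / 2 < q) (m : ℕ) :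
    (∀ k, 2 ≤ k → k + m ≤ 5 → SymbolBound m (fun _ _ => 1)
      (fun _ y => iteratedDeriv k f (waveProfile f um up ε q y))) ∧
    (m ≤ 3 → SymbolBound m (fun _ _ => 1) (fun _ => invCurv f um up ε q)) := by
  have h1 : ∀ k ≤ 5, ∃ C, ∀ t : ℝ, 0 ≤ t → ∀ y,
      |iteratedDeriv k f (waveProfile f um up ε q y)| ≤ C * 1 := by
    intro k hk
    obtain ⟨C, hC⟩ := exists_bound_iteratedDeriv_waveProfile (ε := ε) hf hconv hu hq hk
    exact ⟨C, fun _ _ y => by rw [mul_one]; exact hC y⟩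
  have h2 : ∃ C, ∀ t : ℝ, 0 ≤ t → ∀ y, |invCurv f um up ε q y| ≤ C * 1 := by
    obtain ⟨C, hC⟩ := exists_bound_invCurv (ε := ε) hf hconv hu hq
    exact ⟨C, fun _ _ y => by rw [mul_one]; exact hC y⟩
  induction m with
  | zero => exact ⟨fun k _ hk => h1 k hk, fun _ => h2⟩
  | succ m ih =>
    have hp : SymbolBound m (fun _ _ => 1) (fun _ => profileSlope f um up ε q) :=
      (symbolBound_profileSlope hconv hu hε hq m).mono
        (K := slopeMax (deriv f um) (deriv f up) ε q)
        (fun _ _ y => (profileSlope_pos hconv hu hε hq y).le)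
        (fun _ _ y => by rw [mul_one]; exact profileSlope_le hconv hu hε hq y)
    have hmul : ∀ {H G : ℝ → ℝ → ℝ}, SymbolBound m (fun _ _ => 1) H →
        SymbolBound m (fun _ _ => 1) G → SymbolBound m (fun _ _ => 1) (fun t y => H t y * G t y) :=
      fun h g => (h.mul g).congr_weight fun _ _ => mul_one 1
    refine ⟨fun k hk2 hk => ⟨h1 k (by omega), _, fun _ _ y =>
      hasDerivAt_iteratedDeriv_waveProfile hf hconv hu hq (by omega) y, ?_⟩,
      fun hm => ⟨h2, _, fun _ _ y => hasDerivAt_invCurv hf hconv hu hq y, ?_⟩⟩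
    · exact hmul (ih.1 (k + 1) (by omega) (by omega)) (hmul (ih.2 (by omega)) hp)
    · have hc := ih.2 (by omega)
      exact (hmul (hmul (hmul (hmul hc hc) hc) (ih.1 3 (by omega) (by omega))) hp).const_mul (-1)

theorem symbolBound_secondCoefA (hf : ContDiff ℝ 5 f) (hconv : ∀ u, 0 < iteratedDeriv 2 f u)
    (hu : um < up) (hε : 0 < ε) (hq : 1 / 2 < q) :
    SymbolBound 2 (fun _ y => profileSlope f um up ε q y * profileSlope f um up ε q y)
      (fun _ => secondCoefA f um up ε q) := by
  have h := symbolBound_curv hf hconv hu hε hq 2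
  have hc := h.2 (by norm_num)
  have hp := symbolBound_profileSlope hconv hu hε hq 2
  exact (((((hc.mul hc).mul hc).mul (h.1 3 (by norm_num) (by norm_num))).mul
    (hp.mul hp)).const_mul (-1)).congr_weight fun _ _ => by ring

theorem symbolBound_secondCoefB (hf : ContDiff ℝ 5 f) (hconv : ∀ u, 0 < iteratedDeriv 2 f u)
    (hu : um < up) (hε : 0 < ε) (hq : 1 / 2 < q) :
    SymbolBound 2 (fun _ y => profileSlope f um up ε q y * decayRoot ε y)
      (fun _ => secondCoefB f um up ε q) :=
  ((((symbolBound_curv hf hconv hu hε hq 2).2 (by norm_num)).mul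
    ((symbolBound_profileSlope hconv hu hε hq 2).mul
      (symbolBound_logSlope hε q 2)))).congr_weight fun _ _ => one_mul _

theorem symbolBound_profileStretch (hconv : ∀ u, 0 < iteratedDeriv 2 f u)
    (hu : um < up) (hε : 0 < ε) (hq : 1 / 2 < q) (n : ℕ) :
    SymbolBound n (profileStretch f um up ε q) (profileStretch f um up ε q) :=
  symbolBound_invStretch (profileMax_pos hconv hu hε hq) hε q n

/-- Two further derivatives of the second derivative are what the fourth derivative of the wave
needs. The extra factor `E` on the second coefficient is discarded. -/
theorem symbolBound_waveSecond (hf : ContDiff ℝ 5 f) (hconv : ∀ u, 0 < iteratedDeriv 2 f u)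
    (hu : um < up) (hε : 0 < ε) (hq : 1 / 2 < q) :
    SymbolBound 2 (waveWeight f um up ε q) (waveSecond f um up ε q) := by
  have hE := symbolBound_profileStretch hconv hu hε hq 2
  refine SymbolBound.add
    (((symbolBound_secondCoefA hf hconv hu hε hq).mul (hE.mul hE)).mono (K := 1) ?_ ?_)
    (((symbolBound_secondCoefB hf hconv hu hε hq).mul (hE.mul (hE.mul hE))).mono (K := 1) ?_ ?_)
  all_goals
    intro t ht y
    have h1 := profileSlope_pos hconv hu hε hq y
    have h2 := decayRoot_pos ε y
    have h3 := profileStretch_pos hconv hu hε hq ht y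
    have h4 := profileStretch_le_one hconv hu hε hq ht y
  · positivity
  · rw [one_mul, waveWeight]
    gcongr
    linarith
  · positivity
  · rw [one_mul, waveWeight]
    gcongr ?_ * ?_
    · gcongr; linarith
    · exact mul_le_of_le_one_left (by positivity) h4

theorem hasDerivAt_profileFoot (hconv : ∀ u, 0 < iteratedDeriv 2 f u) (hu : um < up) (hε : 0 < ε)
    (hq : 1 / 2 < q) {t : ℝ} (ht : 0 ≤ t) (x : ℝ) : HasDerivAt (profileFoot f um up ε q t)
      (profileStretch f um up ε q t (profileFoot f um up ε q t x)) x :=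
  hasDerivAt_charFoot (slope_lt hconv hu) hε hq ht x

theorem deriv_comp_profileFoot (hconv : ∀ u, 0 < iteratedDeriv 2 f u) (hu : um < up)
    (hε : 0 < ε) (hq : 1 / 2 < q) {t : ℝ} (ht : 0 ≤ t) {H H' : ℝ → ℝ}
    (hH : ∀ y, HasDerivAt H (H' y) y) {G : ℝ → ℝ}
    (hG : ∀ x, G x = H (profileFoot f um up ε q t x)) (x : ℝ) :
    HasDerivAt G (H' (profileFoot f um up ε q t x) *
      profileStretch f um up ε q t (profileFoot f um up ε q t x)) x := by
  have e : G = fun x => H (profileFoot f um up ε q t x) := funext hG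
  rw [e]
  exact HasDerivAt.comp x (hH _) (hasDerivAt_profileFoot hconv hu hε hq ht x)

theorem hasDerivAt_rarefaction (hf : ContDiff ℝ 5 f) (hconv : ∀ u, 0 < iteratedDeriv 2 f u)
    (hu : um < up) (hε : 0 < ε) (hq : 1 / 2 < q) {t : ℝ} (ht : 0 ≤ t) (x : ℝ) :
    HasDerivAt (rarefaction f um up ε q t)
      ((fun y => invCurv f um up ε q y * profileSlope f um up ε q y *
        profileStretch f um up ε q t y) (profileFoot f um up ε q t x)) x :=
  deriv_comp_profileFoot hconv hu hε hq ht (hasDerivAt_waveProfile' hf hconv hu hq)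
    (rarefaction_eq f um up ε q t) x

theorem iteratedDeriv_two_rarefaction (hf : ContDiff ℝ 5 f)
    (hconv : ∀ u, 0 < iteratedDeriv 2 f u) (hu : um < up) (hε : 0 < ε) (hq : 1 / 2 < q) {t : ℝ}
    (ht : 0 ≤ t) (x : ℝ) : iteratedDeriv 2 (rarefaction f um up ε q t) x
      = waveSecond f um up ε q t (profileFoot f um up ε q t x) := by
  rw [iteratedDeriv_succ, iteratedDeriv_one]
  -- The contribution `r p E` from the slope cancels against the `-r E` part of `E'`, leaving only
  -- the `E²` term with coefficient `secondCoefB`.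
  have h1 : ∀ y, HasDerivAt (fun y => invCurv f um up ε q y * profileSlope f um up ε q y *
      profileStretch f um up ε q t y) (secondCoefA f um up ε q y * profileStretch f um up ε q t y +
        secondCoefB f um up ε q y *
          (profileStretch f um up ε q t y * profileStretch f um up ε q t y)) y := by
    intro y
    have := ((hasDerivAt_invCurv (ε := ε) hf hconv hu hq y).mul
      (hasDerivAt_waveSlope (slopeMax (deriv f um) (deriv f up) ε q) ε q y)).mul
      (hasDerivAt_invStretch (profileMax_pos hconv hu hε hq) ε q ht y)
    convert! this using 1
    simp only [secondCoefA, secondCoefB, profileSlope, profileStretch, Pi.mul_apply]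
    ring
  rw [(deriv_comp_profileFoot hconv hu hε hq ht h1 (G := deriv (rarefaction f um up ε q t))
    (fun x => (hasDerivAt_rarefaction hf hconv hu hε hq ht x).deriv) x).deriv, waveSecond]
  ring

/-- Each further space derivative differentiates the symbol in `y` and multiplies by `E ≤ 1`, so the
weight found for the second derivative serves the third and the fourth. -/
theorem exists_bound_iteratedDeriv_rarefaction (hf : ContDiff ℝ 5 f)
    (hconv : ∀ u, 0 < iteratedDeriv 2 f u) (hu : um < up) (hε : 0 < ε) (hq : 1 / 2 < q) :
    ∃ C ≥ 0, ∀ t, 0 ≤ t → ∀ x, ∀ k ∈ ({2, 3, 4} : Set ℕ),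
      |iteratedDeriv k (rarefaction f um up ε q t) x|
        ≤ C * waveWeight f um up ε q t (profileFoot f um up ε q t x) := by
  have hW : ∀ t, 0 ≤ t → ∀ y, 0 ≤ waveWeight f um up ε q t y :=
    fun t _ y => waveWeight_nonneg hconv hu hε hq t y
  have hstep : ∀ {n : ℕ} {H' : ℝ → ℝ → ℝ}, SymbolBound n (waveWeight f um up ε q) H' →
      SymbolBound n (waveWeight f um up ε q) (fun t y => H' t y * profileStretch f um up ε q t y) := by
    intro n H' h
    refine (h.mul (symbolBound_profileStretch hconv hu hε hq n)).mono (K := 1) ?_ ?_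
    · exact fun t ht y => mul_nonneg (hW t ht y) (profileStretch_pos hconv hu hε hq ht y).le
    · intro t ht y
      rw [one_mul]
      exact mul_le_of_le_one_right (hW t ht y) (profileStretch_le_one hconv hu hε hq ht y)
  have h2 := symbolBound_waveSecond hf hconv hu hε hq
  obtain ⟨C₂, hC₂, hb2⟩ := h2.bound_nonneg hW
  obtain ⟨-, H₂', hd2, hs2⟩ := h2
  obtain ⟨C₃, hC₃, hb3⟩ := (hstep hs2).bound_nonneg hW
  obtain ⟨-, H₃', hd3, hs3⟩ := hstep hs2
  obtain ⟨C₄, hC₄, hb4⟩ := (hstep hs3).bound_nonneg hW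
  have e3 : ∀ t, 0 ≤ t → ∀ x, iteratedDeriv 3 (rarefaction f um up ε q t) x
      = H₂' t (profileFoot f um up ε q t x) *
        profileStretch f um up ε q t (profileFoot f um up ε q t x) := by
    intro t ht x
    rw [iteratedDeriv_succ]
    exact (deriv_comp_profileFoot hconv hu hε hq ht (hd2 t ht)
      (iteratedDeriv_two_rarefaction hf hconv hu hε hq ht) x).deriv
  have e4 : ∀ t, 0 ≤ t → ∀ x, iteratedDeriv 4 (rarefaction f um up ε q t) x
      = H₃' t (profileFoot f um up ε q t x) *
        profileStretch f um up ε q t (profileFoot f um up ε q t x) := by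
    intro t ht x
    rw [iteratedDeriv_succ]
    exact (deriv_comp_profileFoot hconv hu hε hq ht (hd3 t ht) (e3 t ht) x).deriv
  refine ⟨C₂ + C₃ + C₄, by positivity, fun t ht x k hk => ?_⟩
  have hw := hW t ht (profileFoot f um up ε q t x)
  simp only [mem_insert_iff, mem_singleton_iff] at hk
  rcases hk with rfl | rfl | rfl
  · rw [iteratedDeriv_two_rarefaction hf hconv hu hε hq ht]
    exact (hb2 t ht _).trans (mul_le_mul_of_nonneg_right (by linarith) hw)
  · rw [e3 t ht]
    exact (hb3 t ht _).trans (mul_le_mul_of_nonneg_right (by linarith) hw)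
  · rw [e4 t ht]
    exact (hb4 t ht _).trans (mul_le_mul_of_nonneg_right (by linarith) hw)

/-- The foot moves with velocity `-w E`, which is bounded. Differentiating `1 + t p` along it
creates an explicit factor `t`, but only in the combination `t p E = 1 - E ≤ 1`. Thus `E` has a time
derivative of size `E²` and no growth in `t` appears. -/
theorem exists_bound_time_deriv (hf : ContDiff ℝ 5 f)
    (hconv : ∀ u, 0 < iteratedDeriv 2 f u) (hu : um < up) (hε : 0 < ε) (hq : 1 / 2 < q) :
    ∃ C ≥ 0, ∀ t, 0 < t → ∀ x,
      |deriv (fun s => iteratedDeriv 2 (rarefaction f um up ε q s) x) t|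
        ≤ C * waveWeight f um up ε q t (profileFoot f um up ε q t x) := by
  set κ := slopeMax (deriv f um) (deriv f up) ε q
  have hκ : 0 < κ := profileMax_pos hconv hu hε hq
  have hpp : ∀ t : ℝ, 0 ≤ t → ∀ y, 0 ≤ profileSlope f um up ε q y * profileSlope f um up ε q y :=
    fun t _ y => mul_self_nonneg _
  have hpr : ∀ t : ℝ, 0 ≤ t → ∀ y, 0 ≤ profileSlope f um up ε q y * decayRoot ε y :=
    fun t _ y => (mul_pos (profileSlope_pos hconv hu hε hq y) (decayRoot_pos ε y)).le
  have hA := symbolBound_secondCoefA hf hconv hu hε hq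
  have hB := symbolBound_secondCoefB hf hconv hu hε hq
  obtain ⟨a₀, ha₀, hA0⟩ := hA.bound_nonneg hpp
  obtain ⟨b₀, hb₀, hB0⟩ := hB.bound_nonneg hpr
  obtain ⟨-, A', hdA, hA'⟩ := hA
  obtain ⟨-, B', hdB, hB'⟩ := hB
  obtain ⟨a₁, ha₁, hA1⟩ := hA'.bound_nonneg hpp
  obtain ⟨b₁, hb₁, hB1⟩ := hB'.bound_nonneg hpr
  obtain ⟨R, hR, hRb⟩ := (symbolBound_logSlope hε q 0).bound_nonneg
    (fun _ _ y => (decayRoot_pos ε y).le)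
  set Mw := max |deriv f um| |deriv f up|
  have hMw : 0 ≤ Mw := (abs_nonneg _).trans (le_max_left _ _)
  set K := κ + R * Mw
  have hK : 0 ≤ K := by positivity
  refine ⟨a₁ * Mw + 2 * a₀ * K + (b₁ * Mw + 3 * b₀ * K), by positivity, fun t ht x => ?_⟩
  set φ : ℝ → ℝ := fun s => profileFoot f um up ε q s x
  set y := φ t with hy
  set w := burgersData (deriv f um) (deriv f up) ε q y
  set E := profileStretch f um up ε q t y
  set p := profileSlope f um up ε q y
  set r := logSlope ε q y
  have hE0 : 0 < E := profileStretch_pos hconv hu hε hq ht.le y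
  have hE1 : E ≤ 1 := profileStretch_le_one hconv hu hε hq ht.le y
  have hp0 : 0 < p := profileSlope_pos hconv hu hε hq y
  have hm0 := decayRoot_pos ε y
  have hφ : HasDerivAt φ (-w * E) t := hasDerivAt_charFoot_time (slope_lt hconv hu) hε ht x
  have hyw : |-w * E| ≤ Mw := by
    have hw := burgersData_mem_Icc (ε := ε) (slope_lt hconv hu) hq y
    have h1 : |w| ≤ Mw := abs_le_max_abs_abs hw.1 hw.2
    rw [abs_mul, abs_neg, abs_of_pos hE0]
    exact (mul_le_of_le_one_right (abs_nonneg _) hE1).trans h1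
  set e' := -(p + t * (r * p * (-w * E))) * (E * E)
  have he : HasDerivAt (fun s => profileStretch f um up ε q s (φ s)) e' t := by
    have h1 := HasDerivAt.comp t (hasDerivAt_waveSlope κ ε q y) hφ
    have h2 := (((hasDerivAt_id t).mul h1).const_add 1).inv (stretch_pos hκ ε q ht.le y).ne'
    convert! h2 using 1
    have hE : E = (1 + t * p)⁻¹ := rfl
    have h0 : 1 + t * p ≠ 0 := (stretch_pos hκ ε q ht.le y).ne'
    simp only [e', id, Function.comp_apply]
    change _ = -(1 * p + t * (r * p * (-w * E))) / (1 + t * p) ^ 2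
    rw [one_mul, div_eq_mul_inv, ← inv_pow, ← hE]
    ring
  have he' : |e'| ≤ K * (E * E) := by
    simp only [e']
    rw [abs_mul, abs_neg, abs_of_pos (mul_pos hE0 hE0)]
    refine mul_le_mul_of_nonneg_right ?_ (mul_pos hE0 hE0).le
    refine (abs_add_le _ _).trans (add_le_add ?_ ?_)
    · rw [abs_of_pos hp0]; exact profileSlope_le hconv hu hε hq y
    · have h1 : t * (r * p * (-w * E)) = (t * p * E) * r * (-w) := by ring
      have h2 : t * p * E ≤ 1 := by
        have := time_mul_slope_mul_invStretch hκ ε q ht.le y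
        change t * p * E = 1 - E at this
        linarith
      have h3 : |r| ≤ R := (hRb 0 le_rfl y).trans
        (mul_le_of_le_one_right hR (decayRoot_le_one ε y))
      have h4 : |-w| ≤ Mw := by
        have hw := burgersData_mem_Icc (ε := ε) (slope_lt hconv hu) hq y
        rw [abs_neg]
        exact abs_le_max_abs_abs hw.1 hw.2
      rw [h1, abs_mul, abs_mul, abs_of_nonneg (by positivity : 0 ≤ t * p * E)]
      refine mul_le_mul ?_ h4 (abs_nonneg _) hR
      exact (mul_le_of_le_one_left (abs_nonneg _) h2).trans h3
  have hZ := ((HasDerivAt.comp t (hdA t ht.le y) hφ).mul (he.mul he)).add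
    ((HasDerivAt.comp t (hdB t ht.le y) hφ).mul (he.mul (he.mul he)))
  -- The formula along characteristics holds for nonnegative times only; strict positivity of `t`
  -- makes it valid in a neighbourhood.
  have hloc : (fun s => iteratedDeriv 2 (rarefaction f um up ε q s) x) =ᶠ[𝓝 t]
      fun s => waveSecond f um up ε q s (φ s) := by
    filter_upwards [lt_mem_nhds ht] with s hs
    exact iteratedDeriv_two_rarefaction hf hconv hu hε hq hs.le x
  have hZ' : HasDerivAt (fun s => waveSecond f um up ε q s (φ s)) _ t := hZ
  rw [hloc.deriv_eq, hZ'.deriv]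
  simp only [Function.comp_apply, Pi.mul_apply]
  change |A' t y * (-w * E) * (E * E) + secondCoefA f um up ε q y * (e' * E + E * e') +
    (B' t y * (-w * E) * (E * (E * E)) + secondCoefB f um up ε q y *
      (e' * (E * E) + E * (e' * E + E * e')))| ≤ _
  have hEE : 0 ≤ E * E := mul_self_nonneg E
  have hpp0 : 0 ≤ p * p := mul_self_nonneg p
  have hpm0 : 0 ≤ p * decayRoot ε y := (mul_pos hp0 hm0).le
  have t1 : |A' t y * (-w * E) * (E * E)| ≤ a₁ * (p * p) * Mw * (E * E) := by
    rw [abs_mul, abs_mul, abs_of_nonneg hEE]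
    refine mul_le_mul_of_nonneg_right ?_ hEE
    exact mul_le_mul (hA1 t ht.le y) hyw (abs_nonneg _) (mul_nonneg ha₁ hpp0)
  have hEe : |E * e'| ≤ K * (E * E) := by
    rw [abs_mul, abs_of_pos hE0]
    exact (mul_le_of_le_one_left (abs_nonneg _) hE1).trans he'
  have t2 : |secondCoefA f um up ε q y * (e' * E + E * e')| ≤ a₀ * (p * p) * (2 * (K * (E * E))) := by
    rw [abs_mul]
    refine mul_le_mul (hA0 t ht.le y) ?_ (abs_nonneg _) (mul_nonneg ha₀ hpp0)
    rw [mul_comm e' E, ← two_mul, abs_mul, abs_two]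
    linarith
  have t3 : |B' t y * (-w * E) * (E * (E * E))| ≤ b₁ * (p * decayRoot ε y) * Mw * (E * E) := by
    rw [abs_mul, abs_mul, abs_of_nonneg (mul_nonneg hE0.le hEE)]
    refine mul_le_mul ?_ (mul_le_of_le_one_left hEE hE1) (mul_nonneg hE0.le hEE)
      (by positivity)
    exact mul_le_mul (hB1 t ht.le y) hyw (abs_nonneg _) (mul_nonneg hb₁ hpm0)
  have t4 : |secondCoefB f um up ε q y * (e' * (E * E) + E * (e' * E + E * e'))|
      ≤ b₀ * (p * decayRoot ε y) * (3 * (K * (E * E))) := by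
    rw [abs_mul]
    refine mul_le_mul (hB0 t ht.le y) ?_ (abs_nonneg _) (mul_nonneg hb₀ hpm0)
    have e : e' * (E * E) + E * (e' * E + E * e') = 3 * (E * (E * e')) := by ring
    rw [e, abs_mul, abs_of_pos (by norm_num : (0 : ℝ) < 3), abs_mul, abs_of_pos hE0]
    have := mul_le_of_le_one_left (abs_nonneg (E * e')) hE1
    linarith
  have hW : waveWeight f um up ε q t y = p * (p + decayRoot ε y) * (E * E) := rfl
  refine (abs_add_le _ _).trans ((add_le_add ((abs_add_le _ _).trans (add_le_add t1 t2))
    ((abs_add_le _ _).trans (add_le_add t3 t4))).trans ?_)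
  rw [hW]
  have q1 : 0 ≤ (a₁ * Mw + 2 * a₀ * K) * (p * decayRoot ε y * (E * E)) := by positivity
  have q2 : 0 ≤ (b₁ * Mw + 3 * b₀ * K) * (p * p * (E * E)) := by positivity
  linarith

theorem exists_bound_source (hf : ContDiff ℝ 5 f) (hconv : ∀ u, 0 < iteratedDeriv 2 f u)
    (hu : um < up) (hε : 0 < ε) (hq : 1 / 2 < q) (α β γ δ : ℝ) :
    ∃ C ≥ 0, ∀ t, 0 < t → ∀ x, |source α β γ δ (rarefaction f um up ε q) t x|
        ≤ C * waveWeight f um up ε q t (profileFoot f um up ε q t x) := by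
  obtain ⟨C, hC, h⟩ := exists_bound_iteratedDeriv_rarefaction hf hconv hu hε hq
  obtain ⟨D, hD, h'⟩ := exists_bound_time_deriv hf hconv hu hε hq
  refine ⟨|α| * D + |β| * C + |δ| * C + |γ| * C, by positivity, fun t ht x => ?_⟩
  have h2 := mul_le_mul_of_nonneg_left (h t ht.le x 2 (by simp)) (abs_nonneg β)
  have h3 := mul_le_mul_of_nonneg_left (h t ht.le x 3 (by simp)) (abs_nonneg δ)
  have h4 := mul_le_mul_of_nonneg_left (h t ht.le x 4 (by simp)) (abs_nonneg γ)
  have h1 := mul_le_mul_of_nonneg_left (h' t ht x) (abs_nonneg α)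
  rw [← abs_mul] at h1 h2 h3 h4
  unfold source
  refine (abs_sub _ _).trans ?_
  have := abs_sub (α * deriv (fun s => iteratedDeriv 2 (rarefaction f um up ε q s) x) t +
    β * iteratedDeriv 2 (rarefaction f um up ε q t) x)
    (δ * iteratedDeriv 3 (rarefaction f um up ε q t) x)
  have := abs_add_le (α * deriv (fun s => iteratedDeriv 2 (rarefaction f um up ε q s) x) t)
    (β * iteratedDeriv 2 (rarefaction f um up ε q t) x)
  linarith

end

/-! ### Uniform bounds on the wave and `L²` decay of the source. -/

section

variable {f : ℝ → ℝ} {um up ε q : ℝ}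

theorem rarefaction_profile (hf : ContDiff ℝ 5 f) (hconv : ∀ u, 0 < iteratedDeriv 2 f u)
    (hu : um < up) (hε : 0 < ε) (hq : 1 / 2 < q) : ∃ B, ∀ t, 0 ≤ t → ∃ Ux : ℝ → ℝ,
      (∀ x, HasDerivAt (rarefaction f um up ε q t) (Ux x) x) ∧ Continuous Ux ∧ (∀ x, 0 ≤ Ux x) ∧
      (∀ x, Ux x ≤ B) ∧ ∀ x, rarefaction f um up ε q t x ∈ Icc um up := by
  obtain ⟨C, hC⟩ := exists_bound_invCurv (ε := ε) hf hconv hu hq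
  set κ := slopeMax (deriv f um) (deriv f up) ε q
  have hκ : 0 < κ := profileMax_pos hconv hu hε hq
  refine ⟨C * κ * 1, fun t ht => ⟨_, hasDerivAt_rarefaction hf hconv hu hε hq ht, ?_, ?_, ?_,
    fun x => (waveProfile_spec hf hconv hu hq _).2⟩⟩
  · have h1 : Continuous (invCurv f um up ε q) := continuous_iff_continuousAt.2 fun y =>
      (hasDerivAt_invCurv hf hconv hu hq y).continuousAt
    have h2 : Continuous (profileSlope f um up ε q) := continuous_iff_continuousAt.2 fun y =>
      (hasDerivAt_waveSlope κ ε q y).continuousAt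
    have h3 : Continuous (profileStretch f um up ε q t) := continuous_iff_continuousAt.2 fun y =>
      (hasDerivAt_invStretch hκ ε q ht y).continuousAt
    have h4 : Continuous (profileFoot f um up ε q t) := continuous_iff_continuousAt.2 fun x =>
      (hasDerivAt_profileFoot hconv hu hε hq ht x).continuousAt
    exact ((h1.mul h2).mul h3).comp h4
  · intro x
    have h1 : 0 < invCurv f um up ε q (profileFoot f um up ε q t x) := inv_pos.2 (hconv _)
    have h2 := profileSlope_pos hconv hu hε hq (profileFoot f um up ε q t x)
    have h3 := profileStretch_pos hconv hu hε hq ht (profileFoot f um up ε q t x)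
    positivity
  · intro x
    have h1 := (le_abs_self _).trans (hC (profileFoot f um up ε q t x))
    have h0 : 0 < invCurv f um up ε q (profileFoot f um up ε q t x) := inv_pos.2 (hconv _)
    have h2 := profileSlope_pos hconv hu hε hq (profileFoot f um up ε q t x)
    have h3 := profileStretch_pos hconv hu hε hq ht (profileFoot f um up ε q t x)
    exact mul_le_mul (mul_le_mul h1 (profileSlope_le hconv hu hε hq _) h2.le (h0.le.trans h1))
      (profileStretch_le_one hconv hu hε hq ht _) h3.le (mul_nonneg (h0.le.trans h1) hκ.le)

/-- Change of variables along the characteristic map, whose Jacobian is `1 + t p`. The lower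
integral form needs no measurability of `g`. -/
theorem lintegral_comp_profileFoot (hconv : ∀ u, 0 < iteratedDeriv 2 f u) (hu : um < up)
    (hε : 0 < ε) (q : ℝ) {t : ℝ} (ht : 0 ≤ t) (g : ℝ → ℝ≥0∞) :
    ∫⁻ x, g (profileFoot f um up ε q t x)
      = ∫⁻ y, ENNReal.ofReal |1 + t * profileSlope f um up ε q y| * g y := by
  have hw := slope_lt hconv hu
  have hb := charMap_bijective hw.le hε.le ht q
  have hd : ∀ y ∈ univ, HasDerivWithinAt (charMap (deriv f um) (deriv f up) ε q t)
      (1 + t * profileSlope f um up ε q y) univ y := fun y _ => by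
    have h := (hasDerivAt_id y).add ((hasDerivAt_burgersData (deriv f um) (deriv f up) ε q y).mul_const t)
    refine HasDerivAt.hasDerivWithinAt ?_
    convert! h using 1
    rw [profileSlope]
    ring
  have := lintegral_image_eq_lintegral_abs_deriv_mul MeasurableSet.univ hd hb.1.injOn
    fun x => g (profileFoot f um up ε q t x)
  rw [image_univ, hb.2.range_eq, Measure.restrict_univ] at this
  rw [this]
  refine lintegral_congr fun y => ?_
  rw [show profileFoot f um up ε q t (charMap (deriv f um) (deriv f up) ε q t y) = y from
    Function.leftInverse_invFun hb.1 y]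

/-- Since `(1 + t p) E = 1`, the left side is `p² (p + μ)² E³`. Time decay comes from `p E = O(1/(1
+ t))`. Only the power `σ = 2 + 2η` of `p E` is spent, so that an integrable function of `y`
remains; with `η = 1/(8q)` one has `2ηq = 1/4`, which leaves the exponent `3/4 > 1/2` on
`decayBase`. -/
theorem waveWeight_sq_mul_le (hconv : ∀ u, 0 < iteratedDeriv 2 f u) (hu : um < up)
    (hε : 0 < ε) (hq : 1 / 2 < q) : ∃ C ≥ 0, ∀ t, 0 ≤ t → ∀ y,
      |1 + t * profileSlope f um up ε q y| * waveWeight f um up ε q t y ^ 2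
        ≤ C * (1 + t) ^ (-(2 + 2 * (1 / (8 * q)))) *
          (profileSlope f um up ε q y + decayBase ε y ^ (3 / 4 : ℝ)) := by
  set κ := slopeMax (deriv f um) (deriv f up) ε q
  have hκ : 0 < κ := profileMax_pos hconv hu hε hq
  set η := 1 / (8 * q) with hη
  have hη0 : 0 < η := by positivity
  have hηq : η * q = 1 / 8 := by rw [hη]; field_simp
  have hη1 : 2 * η < 1 := by
    rw [hη, ← mul_div_assoc, div_lt_one (by linarith)]; linarith
  set σ := 2 + 2 * η
  refine ⟨2 * (κ + 1) ^ σ * (κ ^ (1 - 2 * η) + κ ^ (-(2 * η))), by positivity, fun t ht y => ?_⟩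
  set p := profileSlope f um up ε q y with hp
  set E := profileStretch f um up ε q t y with hE
  set b := decayBase ε y
  set μ := decayRoot ε y
  have hp0 : 0 < p := profileSlope_pos hconv hu hε hq y
  have hpκ : p ≤ κ := profileSlope_le hconv hu hε hq y
  have hE0 : 0 < E := profileStretch_pos hconv hu hε hq ht y
  have hE1 : E ≤ 1 := profileStretch_le_one hconv hu hε hq ht y
  have hb0 : 0 < b := decayBase_pos ε y
  have hμ0 : 0 < μ := decayRoot_pos ε y
  have hμb : μ ^ 2 = b := decayRoot_sq ε y
  have hD : (1 + t * p) * E = 1 := mul_inv_cancel₀ (stretch_pos hκ ε q ht y).ne'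
  have hDpos : 0 < 1 + t * p := stretch_pos hκ ε q ht y
  set z := p * E with hz
  have hz0 : 0 < z := mul_pos hp0 hE0
  have hzκ : z ≤ κ := (mul_le_of_le_one_right hp0.le hE1).trans hpκ
  have ht1 : 0 < 1 + t := by linarith
  have hzt : z ≤ (κ + 1) * (1 + t)⁻¹ := by
    rw [← div_eq_mul_inv, le_div_iff₀ ht1]
    -- `z (1 + t) = z + (1 - E)`, which is at most `κ + 1`.
    have h1 : z * (1 + t) = z + t * p * E := by rw [hz]; ring
    have h2 : t * p * E = 1 - E := by linarith
    rw [h1, h2]; linarith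
  have hzσ : z ^ σ ≤ (κ + 1) ^ σ * (1 + t) ^ (-σ) := by
    refine (Real.rpow_le_rpow hz0.le hzt (by positivity)).trans (le_of_eq ?_)
    rw [Real.mul_rpow (by positivity) (by positivity), Real.inv_rpow ht1.le, Real.rpow_neg ht1.le]
  have hlhs : |1 + t * p| * waveWeight f um up ε q t y ^ 2 = (p * (p + μ)) ^ 2 * E ^ 3 := by
    rw [abs_of_pos hDpos]
    change (1 + t * p) * (p * (p + μ) * (E * E)) ^ 2 = _
    calc (1 + t * p) * (p * (p + μ) * (E * E)) ^ 2
        = (p * (p + μ)) ^ 2 * E ^ 3 * ((1 + t * p) * E) := by ring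
      _ = _ := by rw [hD, mul_one]
  have h1 : z ^ 3 ≤ z ^ σ * κ ^ (1 - 2 * η) := by
    have : z ^ 3 = z ^ σ * z ^ (1 - 2 * η) := by
      rw [← Real.rpow_add hz0, ← Real.rpow_natCast]
      congr 1
      simp only [σ]; push_cast; ring
    rw [this]
    exact mul_le_mul_of_nonneg_left (Real.rpow_le_rpow hz0.le hzκ (by linarith)) (by positivity)
  have h2 : p ^ 2 * b * E ^ 3 ≤ z ^ σ * (κ ^ (-(2 * η)) * b ^ (3 / 4 : ℝ)) := by
    have e1 : E ^ 3 ≤ E ^ σ := by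
      rw [← Real.rpow_natCast]
      exact Real.rpow_le_rpow_of_exponent_ge hE0 hE1 (by simp only [σ]; push_cast; linarith)
    have e2 : p ^ 2 = p ^ σ * p ^ (-(2 * η)) := by
      rw [← Real.rpow_add hp0, ← Real.rpow_natCast]
      congr 1
      simp only [σ]; push_cast; ring
    -- Here `p = κ b^q`, so the negative power of `p` costs `b^{-2ηq} = b^{-1/4}` of the available
    -- factor `b`.
    have e3 : p ^ (-(2 * η)) * b = κ ^ (-(2 * η)) * b ^ (3 / 4 : ℝ) := by
      have : p = κ * b ^ q := rfl
      rw [this, Real.mul_rpow hκ.le (by positivity), ← Real.rpow_mul hb0.le, mul_assoc]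
      congr 1
      nth_rewrite 2 [← Real.rpow_one b]
      rw [← Real.rpow_add hb0]
      congr 1
      linarith
    calc p ^ 2 * b * E ^ 3 ≤ p ^ 2 * b * E ^ σ := mul_le_mul_of_nonneg_left e1 (by positivity)
      _ = p ^ σ * E ^ σ * (p ^ (-(2 * η)) * b) := by rw [e2]; ring
      _ = _ := by rw [e3, hz, Real.mul_rpow hp0.le hE0.le]
  have h3 : (p * (p + μ)) ^ 2 * E ^ 3 ≤ 2 * (z ^ 3 * p) + 2 * (p ^ 2 * b * E ^ 3) := by
    rw [← hμb, hz]
    have : 0 ≤ p ^ 2 * E ^ 3 * (p - μ) ^ 2 := by positivity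
    nlinarith
  rw [hlhs]
  have hs0 : 0 ≤ z ^ σ := by positivity
  have ha : 0 < κ ^ (1 - 2 * η) := by positivity
  have hb : 0 < κ ^ (-(2 * η)) := by positivity
  have hb4 : 0 < b ^ (3 / 4 : ℝ) := by positivity
  calc (p * (p + μ)) ^ 2 * E ^ 3
      ≤ 2 * (z ^ σ * κ ^ (1 - 2 * η) * p) + 2 * (z ^ σ * (κ ^ (-(2 * η)) * b ^ (3 / 4 : ℝ))) := by
        have := mul_le_mul_of_nonneg_right h1 hp0.le
        linarith
    _ = z ^ σ * (2 * (κ ^ (1 - 2 * η) * p + κ ^ (-(2 * η)) * b ^ (3 / 4 : ℝ))) := by ring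
    _ ≤ z ^ σ * (2 * (κ ^ (1 - 2 * η) + κ ^ (-(2 * η))) * (p + b ^ (3 / 4 : ℝ))) := by
        refine mul_le_mul_of_nonneg_left ?_ hs0
        have := mul_pos ha hb4
        have := mul_pos hb hp0
        nlinarith
    _ ≤ (κ + 1) ^ σ * (1 + t) ^ (-σ) *
          (2 * (κ ^ (1 - 2 * η) + κ ^ (-(2 * η))) * (p + b ^ (3 / 4 : ℝ))) :=
        mul_le_mul_of_nonneg_right hzσ (by positivity)
    _ = _ := by ring

theorem integrable_decayBase_rpow {s : ℝ} (hε : 0 < ε) (hs : 1 / 2 < s) :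
    Integrable fun y => decayBase ε y ^ s := by
  refine ((integrable_kernel hs).comp_mul_left' hε.ne').congr (Eventually.of_forall fun y => ?_)
  change 1 / (1 + (ε * y) ^ 2) ^ s = decayBase ε y ^ s
  rw [decayBase, Real.inv_rpow (by positivity), one_div]

theorem integral_decay_le {η : ℝ} (hη : 0 < η) {T : ℝ} (hT : 0 ≤ T) :
    ∫ t in (0 : ℝ)..T, (1 + |t|) ^ (-(1 + η)) ≤ 1 / η := by
  have hd : ∀ t ∈ uIcc 0 T, HasDerivAt (fun t => -(1 / η) * (1 + t) ^ (-η))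
      ((1 + t) ^ (-(1 + η))) t := by
    intro t ht
    rw [uIcc_of_le hT] at ht
    have h := (((hasDerivAt_id t).const_add 1).rpow_const (p := -η)
      (Or.inl (by simp only [id]; linarith [ht.1]))).const_mul (-(1 / η))
    convert! h using 1
    rw [show -(1 + η) = -η - 1 by ring]
    simp only [id]
    field_simp
  have e : ∫ t in (0 : ℝ)..T, (1 + |t|) ^ (-(1 + η)) = ∫ t in (0 : ℝ)..T, (1 + t) ^ (-(1 + η)) := by
    refine intervalIntegral.integral_congr fun t ht => ?_
    rw [uIcc_of_le hT] at ht
    simp only [abs_of_nonneg ht.1]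
  have hc : ContinuousOn (fun t : ℝ => (1 + t) ^ (-(1 + η))) (uIcc 0 T) := by
    rw [uIcc_of_le hT]
    exact (continuousOn_const.add continuousOn_id).rpow_const fun t ht =>
      Or.inl (by linarith [ht.1] : (0 : ℝ) < 1 + t).ne'
  rw [e, intervalIntegral.integral_eq_sub_of_hasDerivAt hd hc.intervalIntegrable]
  have h1 : 0 ≤ (1 / η) * (1 + T) ^ (-η) := by positivity
  simp only [add_zero, Real.one_rpow]
  linarith

/-- The source term is integrable in time with values in `L²(ℝ)`. -/
theorem source_decay (hf : ContDiff ℝ 5 f) (hconv : ∀ u, 0 < iteratedDeriv 2 f u)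
    (hu : um < up) (hε : 0 < ε) (hq : 1 / 2 < q) (α β γ δ : ℝ) : ∃ (h : ℝ → ℝ) (K : ℝ),
      Continuous h ∧ (∀ t, 0 ≤ h t) ∧ (∀ t, h t ≤ K) ∧ (∀ T, 0 ≤ T → ∫ t in (0 : ℝ)..T, h t ≤ K) ∧
      ∀ t, 0 < t → ∫⁻ x, ENNReal.ofReal (source α β γ δ (rarefaction f um up ε q) t x ^ 2)
        ≤ ENNReal.ofReal (h t ^ 2) := by
  obtain ⟨C, hC, hsrc⟩ := exists_bound_source hf hconv hu hε hq α β γ δ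
  obtain ⟨D, hD, hww⟩ := waveWeight_sq_mul_le hconv hu hε hq
  set η := 1 / (8 * q)
  have hη : 0 < η := by positivity
  set G : ℝ → ℝ := fun y => profileSlope f um up ε q y + decayBase ε y ^ (3 / 4 : ℝ)
  have hG0 : ∀ y, 0 ≤ G y := fun y => add_nonneg (profileSlope_pos hconv hu hε hq y).le
    (Real.rpow_nonneg (decayBase_pos ε y).le _)
  have hGi : Integrable G :=
    ((integrable_decayBase_rpow hε hq).const_mul _).add
      (integrable_decayBase_rpow hε (by norm_num))
  have hI : 0 ≤ ∫ y, G y := integral_nonneg hG0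
  set M := C ^ 2 * D * ∫ y, G y
  have hM : 0 ≤ M := by positivity
  have hcont : Continuous fun t : ℝ => (1 + |t|) ^ (-(1 + η)) :=
    (continuous_const.add continuous_abs).rpow_const fun t =>
      Or.inl (by positivity : (0 : ℝ) < 1 + |t|).ne'
  -- The absolute value makes the majorant continuous on the whole line. One constant serves both as
  -- its supremum bound and as the bound of its time integrals.
  refine ⟨fun t => √M * (1 + |t|) ^ (-(1 + η)), √M * (1 + 1 / η), continuous_const.mul hcont,
    fun t => by positivity, fun t => ?_, fun T hT => ?_, fun t ht => ?_⟩
  · refine mul_le_mul_of_nonneg_left ?_ (Real.sqrt_nonneg _)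
    refine (Real.rpow_le_one_of_one_le_of_nonpos (by linarith [abs_nonneg t])
      (by linarith)).trans ?_
    have : 0 < 1 / η := by positivity
    linarith
  · rw [intervalIntegral.integral_const_mul]
    refine mul_le_mul_of_nonneg_left ?_ (Real.sqrt_nonneg _)
    linarith [integral_decay_le hη hT]
  · have e : (√M * (1 + |t|) ^ (-(1 + η))) ^ 2 = M * (1 + t) ^ (-(2 + 2 * η)) := by
      rw [mul_pow, Real.sq_sqrt hM, abs_of_pos ht, ← Real.rpow_natCast,
        ← Real.rpow_mul (by positivity)]
      congr 2
      push_cast; ring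
    rw [e]
    calc ∫⁻ x, ENNReal.ofReal (source α β γ δ (rarefaction f um up ε q) t x ^ 2)
        ≤ ∫⁻ x, ENNReal.ofReal
            ((C * waveWeight f um up ε q t (profileFoot f um up ε q t x)) ^ 2) := by
          refine lintegral_mono fun x => ENNReal.ofReal_le_ofReal ?_
          rw [← sq_abs]
          exact pow_le_pow_left₀ (abs_nonneg _) (hsrc t ht x) 2
      _ = ∫⁻ y, ENNReal.ofReal |1 + t * profileSlope f um up ε q y| *
            ENNReal.ofReal ((C * waveWeight f um up ε q t y) ^ 2) :=
          lintegral_comp_profileFoot hconv hu hε q ht.le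
            fun y => ENNReal.ofReal ((C * waveWeight f um up ε q t y) ^ 2)
      _ ≤ ∫⁻ y, ENNReal.ofReal (C ^ 2 * D * (1 + t) ^ (-(2 + 2 * η)) * G y) := by
          refine lintegral_mono fun y => ?_
          rw [← ENNReal.ofReal_mul (abs_nonneg _)]
          refine ENNReal.ofReal_le_ofReal ?_
          have := mul_le_mul_of_nonneg_left (hww t ht.le y) (sq_nonneg C)
          calc _ = C ^ 2 * (|1 + t * profileSlope f um up ε q y| *
                waveWeight f um up ε q t y ^ 2) := by ring
            _ ≤ _ := this
            _ = _ := by ring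
      _ = ENNReal.ofReal (M * (1 + t) ^ (-(2 + 2 * η))) := by
          rw [← ofReal_integral_eq_lintegral_ofReal (hGi.const_mul _)
            (Eventually.of_forall fun y => mul_nonneg (by positivity) (hG0 y)), integral_const_mul]
          congr 1
          ring

end

/-! ## Components of Sobolev functions -/

/-- `wd · j` as a continuous linear map. -/
def wdL {k : ℕ} (j : Fin (k + 1)) : Sob k →L[ℝ] L2 :=
  (PiLp.proj 2 (fun _ : Fin (k + 1) => L2) j).comp (Sob k).subtypeL

theorem isWeakDeriv_wd {k : ℕ} (v : Sob k) (j : Fin k) :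
    IsWeakDeriv (wd v j.castSucc) (wd v j.succ) := v.2 j

theorem Sob.norm_sq {k : ℕ} (v : Sob k) : ‖v‖ ^ 2 = ∑ j, ‖wd v j‖ ^ 2 := by
  rw [Submodule.coe_norm, PiLp.norm_sq_eq_of_L2]
  rfl

theorem IsWeakDeriv.unique_L2 {g h h' : L2} (H : IsWeakDeriv g h) (H' : IsWeakDeriv g h') :
    h = h' := Lp.ext (H.unique H')

theorem IsWeakDeriv.integral {ν : Measure ℝ} {g h : ℝ → L2} (hg : Integrable g ν)
    (hh : Integrable h ν) (H : ∀ t, IsWeakDeriv (g t) (h t)) :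
    IsWeakDeriv (∫ t, g t ∂ν : L2) (∫ t, h t ∂ν : L2) := by
  rw [isWeakDeriv_iff_inner]
  intro θ hθ hc
  rw [real_inner_comm, real_inner_comm _ (∫ t, h t ∂ν), ← integral_inner hg, ← integral_inner hh,
    ← integral_neg]
  refine integral_congr_ae (Eventually.of_forall fun t => ?_)
  have := isWeakDeriv_iff_inner.1 (H t) θ hθ hc
  simp only [real_inner_comm (g t), real_inner_comm (h t)] at this ⊢
  exact this

theorem IsWeakDeriv.sub_L2 {g h g' h' : L2} (H : IsWeakDeriv g h) (H' : IsWeakDeriv g' h') :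
    IsWeakDeriv (g - g' : L2) (h - h' : L2) := by
  rw [isWeakDeriv_iff_inner] at *
  intro θ hθ hc
  rw [inner_sub_left, inner_sub_left, H θ hθ hc, H' θ hθ hc]
  ring

/-- A curve in `H³(ℝ)` together with its fourth space derivative `v₄` and its time derivative
`(s₀, s₁, s₂)` in `H²(ℝ)`, all in terms of the components in `L²(ℝ)`. -/
structure SobolevCurve (T : ℝ) (v₀ v₁ v₂ v₃ v₄ s₀ s₁ s₂ : ℝ → L2) : Prop where
  cont₀ : ContinuousOn v₀ (Icc 0 T)
  cont₁ : ContinuousOn v₁ (Icc 0 T)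
  cont₂ : ContinuousOn v₂ (Icc 0 T)
  cont₃ : ContinuousOn v₃ (Icc 0 T)
  memLp₄ : MemLp v₄ 2 (volume.restrict (Ioo 0 T))
  memLp_s₀ : MemLp s₀ 2 (volume.restrict (Ioo 0 T))
  memLp_s₁ : MemLp s₁ 2 (volume.restrict (Ioo 0 T))
  memLp_s₂ : MemLp s₂ 2 (volume.restrict (Ioo 0 T))
  deriv₀ : ∀ t, IsWeakDeriv (v₀ t) (v₁ t)
  deriv₁ : ∀ t, IsWeakDeriv (v₁ t) (v₂ t)
  deriv₂ : ∀ t, IsWeakDeriv (v₂ t) (v₃ t)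
  deriv₃ : ∀ᵐ t ∂volume.restrict (Ioo 0 T), IsWeakDeriv (v₃ t) (v₄ t)
  deriv_s₀ : ∀ t, IsWeakDeriv (s₀ t) (s₁ t)
  deriv_s₁ : ∀ t, IsWeakDeriv (s₁ t) (s₂ t)
  eq₀ : ∀ t ∈ Icc 0 T, v₀ t = v₀ 0 + ∫ τ in (0 : ℝ)..t, s₀ τ
  eq₁ : ∀ t ∈ Icc 0 T, v₁ t = v₁ 0 + ∫ τ in (0 : ℝ)..t, s₁ τ
  eq₂ : ∀ t ∈ Icc 0 T, v₂ t = v₂ 0 + ∫ τ in (0 : ℝ)..t, s₂ τ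

/-- A weak space derivative passes through the Bochner integral, and uniqueness of weak derivatives
transfers the integral representation from `u` to `u'`. -/
theorem eq_add_integral_of_isWeakDeriv {T : ℝ} {u u' s s' : ℝ → L2}
    (hs : Integrable s (volume.restrict (Ioo 0 T))) (hs' : Integrable s' (volume.restrict (Ioo 0 T)))
    (hu : ∀ t, IsWeakDeriv (u t) (u' t)) (hd : ∀ t, IsWeakDeriv (s t) (s' t))
    (H : ∀ t ∈ Icc 0 T, u t = u 0 + ∫ τ in (0 : ℝ)..t, s τ) :
    ∀ t ∈ Icc 0 T, u' t = u' 0 + ∫ τ in (0 : ℝ)..t, s' τ := by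
  intro t ht
  have hle : volume.restrict (Ioc 0 t) ≤ volume.restrict (Ioo 0 T) := by
    rw [← restrict_Ioo_eq_restrict_Ioc]
    exact Measure.restrict_mono (Ioo_subset_Ioo le_rfl ht.2) le_rfl
  have h1 := IsWeakDeriv.integral (hs.mono_measure hle) (hs'.mono_measure hle) hd
  have h2 := (hu t).sub_L2 (hu 0)
  rw [H t ht, intervalIntegral.integral_of_le ht.1, add_sub_cancel_left] at h2
  rw [intervalIntegral.integral_of_le ht.1, h1.unique_L2 h2, add_sub_cancel]

/-- A time derivative is given only for the zeroth component; those of the first two space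
derivatives follow by the transfer above. Likewise, equality of the zeroth component of `φx` with
`∂ₓφ` forces the next two, and the top component of `φx` becomes the weak derivative of `v₃`. -/
theorem IsSolution.exists_sobolevCurve {f : ℝ → ℝ} {α β γ δ : ℝ} {U : ℝ → ℝ → ℝ} {T : ℝ}
    (hT : 0 < T) {φ₀ : Sob 3} {φ φx : ℝ → Sob 3} {φt : ℝ → Sob 2}
    (S : IsSolution f α β γ δ U T φ₀ φ φx φt) :
    SobolevCurve T (fun t => wd (φ t) 0) (fun t => wd (φ t) 1) (fun t => wd (φ t) 2)
      (fun t => wd (φ t) 3) (fun t => wd (φx t) 3) (fun t => wd (φt t) 0) (fun t => wd (φt t) 1)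
      (fun t => wd (φt t) 2) ∧
    ∀ᵐ t ∂volume.restrict (Ioo 0 T), wd (φx t) 0 = wd (φ t) 1 ∧ wd (φx t) 1 = wd (φ t) 2 ∧
      wd (φx t) 2 = wd (φ t) 3 := by
  have hc : ∀ j, ContinuousOn (fun t => wd (φ t) j) (Icc 0 T) := fun j =>
    (wdL j).continuous.comp_continuousOn S.continuousOn
  have hs : ∀ j, MemLp (fun t => wd (φt t) j) 2 (volume.restrict (Ioo 0 T)) := fun j =>
    (wdL j).comp_memLp' S.memLp_dt
  have hsi : ∀ j, Integrable (fun t => wd (φt t) j) (volume.restrict (Ioo 0 T)) := fun j =>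
    (hs j).integrable (by norm_num)
  have hx : ∀ᵐ t ∂volume.restrict (Ioo 0 T), wd (φx t) 0 = wd (φ t) 1 ∧ wd (φx t) 1 = wd (φ t) 2 ∧
      wd (φx t) 2 = wd (φ t) 3 := by
    filter_upwards [S.dx_eq] with t h0
    have h1 : wd (φx t) 1 = wd (φ t) 2 := by
      have := isWeakDeriv_wd (φx t) 0
      rw [show wd (φx t) (Fin.castSucc 0) = wd (φ t) 1 from h0] at this
      exact this.unique_L2 (isWeakDeriv_wd (φ t) 1)
    have h2 : wd (φx t) 2 = wd (φ t) 3 := by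
      have := isWeakDeriv_wd (φx t) 1
      rw [show wd (φx t) (Fin.castSucc 1) = wd (φ t) 2 from h1] at this
      exact this.unique_L2 (isWeakDeriv_wd (φ t) 2)
    exact ⟨h0, h1, h2⟩
  have e0 : ∀ t ∈ Icc 0 T, wd (φ t) 0 = wd (φ 0) 0 + ∫ τ in (0 : ℝ)..t, wd (φt τ) 0 := fun t ht =>
    S.dt_eq.eq_add_integral hT (hc 0) (hsi 0) ht
  have e1 := eq_add_integral_of_isWeakDeriv (hsi 0) (hsi 1) (fun t => isWeakDeriv_wd (φ t) 0)
    (fun t => isWeakDeriv_wd (φt t) 0) e0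
  have e2 := eq_add_integral_of_isWeakDeriv (hsi 1) (hsi 2) (fun t => isWeakDeriv_wd (φ t) 1)
    (fun t => isWeakDeriv_wd (φt t) 1) e1
  refine ⟨⟨hc 0, hc 1, hc 2, hc 3, (wdL 3).comp_memLp' S.memLp_dx, hs 0, hs 1, hs 2,
    fun t => isWeakDeriv_wd (φ t) 0, fun t => isWeakDeriv_wd (φ t) 1,
    fun t => isWeakDeriv_wd (φ t) 2, ?_, fun t => isWeakDeriv_wd (φt t) 0,
    fun t => isWeakDeriv_wd (φt t) 1, e0, e1, e2⟩, hx⟩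
  filter_upwards [hx] with t ht
  rw [← ht.2.2]
  exact isWeakDeriv_wd (φx t) 2

namespace SobolevCurve

variable {T : ℝ} {v₀ v₁ v₂ v₃ v₄ s₀ s₁ s₂ : ℝ → L2}

theorem memLp_of_continuousOn {u : ℝ → L2} (hu : ContinuousOn u (Icc 0 T)) :
    MemLp u 2 (volume.restrict (Ioo 0 T)) := by
  obtain ⟨C, hC⟩ := isCompact_Icc.exists_bound_of_continuousOn hu
  refine MemLp.of_bound ((hu.mono Ioo_subset_Icc_self).aestronglyMeasurable measurableSet_Ioo) C ?_
  filter_upwards [ae_restrict_mem measurableSet_Ioo] with t ht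
  exact hC t (Ioo_subset_Icc_self ht)

theorem norm_sq_eq {u s : ℝ → L2} (hu : ∀ t ∈ Icc 0 T, u t = u 0 + ∫ τ in (0 : ℝ)..t, s τ)
    (hs : MemLp s 2 (volume.restrict (Ioo 0 T))) {t : ℝ} (ht : t ∈ Icc 0 T) :
    ‖u t‖ ^ 2 = ‖u 0‖ ^ 2 + 2 * ∫ τ in Ioo 0 t, ⟪s τ, u τ⟫ := by
  have hsi : IntervalIntegrable s volume 0 t :=
    (intervalIntegrable_iff_integrableOn_Ioo_of_le ht.1).2
      ((hs.integrable (by norm_num)).mono_measure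
        (Measure.restrict_mono (Ioo_subset_Ioo le_rfl ht.2) le_rfl))
  rw [hu t ht, norm_sq_add_integral _ ht.1 hsi, intervalIntegral.integral_of_le ht.1,
    integral_Ioc_eq_integral_Ioo]
  congr 2
  refine setIntegral_congr_fun measurableSet_Ioo fun τ hτ => ?_
  simp only [← hu τ ⟨hτ.1.le, hτ.2.le.trans ht.2⟩]

theorem norm_sq₀ (S : SobolevCurve T v₀ v₁ v₂ v₃ v₄ s₀ s₁ s₂) {t : ℝ} (ht : t ∈ Icc 0 T) :
    ‖v₀ t‖ ^ 2 = ‖v₀ 0‖ ^ 2 + 2 * ∫ τ in Ioo 0 t, ⟪s₀ τ, v₀ τ⟫ := norm_sq_eq S.eq₀ S.memLp_s₀ ht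

theorem norm_sq₁ (S : SobolevCurve T v₀ v₁ v₂ v₃ v₄ s₀ s₁ s₂) {t : ℝ} (ht : t ∈ Icc 0 T) :
    ‖v₁ t‖ ^ 2 = ‖v₁ 0‖ ^ 2 + 2 * ∫ τ in Ioo 0 t, ⟪s₁ τ, v₁ τ⟫ := norm_sq_eq S.eq₁ S.memLp_s₁ ht

theorem norm_sq₂ (S : SobolevCurve T v₀ v₁ v₂ v₃ v₄ s₀ s₁ s₂) {t : ℝ} (ht : t ∈ Icc 0 T) :
    ‖v₂ t‖ ^ 2 = ‖v₂ 0‖ ^ 2 + 2 * ∫ τ in Ioo 0 t, ⟪s₂ τ, v₂ τ⟫ := norm_sq_eq S.eq₂ S.memLp_s₂ ht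

/-- The time derivative has only two space derivatives, so the pairing of `∂ₜv₃` with `v₃` is
replaced by `-⟪s₂, v₄⟫`, obtained through difference quotients. -/
theorem norm_sq₃ (S : SobolevCurve T v₀ v₁ v₂ v₃ v₄ s₀ s₁ s₂) {t : ℝ} (ht : t ∈ Icc 0 T) :
    ‖v₃ t‖ ^ 2 = ‖v₃ 0‖ ^ 2 - 2 * ∫ τ in Ioo 0 t, ⟪s₂ τ, v₄ τ⟫ := by
  have := norm_sq_shiftDeriv_eq S.cont₂ S.memLp_s₂ S.memLp₄ S.eq₂
    (fun t _ => (S.deriv₂ t).isShiftDeriv) (S.deriv₃.mono fun t h => h.isShiftDeriv) ht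
  rwa [intervalIntegral.integral_of_le ht.1, integral_Ioc_eq_integral_Ioo] at this

end SobolevCurve

/-- The pairings of the linear part of the equation with `v`, `∂ₓ²v` and `∂ₓ⁴v`. -/
theorem linear_part_identities (α β γ : ℝ) {v₀ v₁ v₂ v₃ v₄ s₀ s₁ s₂ : L2}
    (h₀ : IsWeakDeriv v₀ v₁) (h₁ : IsWeakDeriv v₁ v₂) (h₂ : IsWeakDeriv v₂ v₃)
    (h₃ : IsWeakDeriv v₃ v₄) (k₀ : IsWeakDeriv s₀ s₁) (k₁ : IsWeakDeriv s₁ s₂) :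
    let R := s₀ - α • s₂ - β • v₂ + γ • v₄
    ⟪R, v₀⟫ = ⟪s₀, v₀⟫ + α * ⟪s₁, v₁⟫ + β * ‖v₁‖ ^ 2 + γ * ‖v₂‖ ^ 2 ∧
    ⟪R, v₂⟫ = -(⟪s₁, v₁⟫ + α * ⟪s₂, v₂⟫ + β * ‖v₂‖ ^ 2 + γ * ‖v₃‖ ^ 2) ∧
    ⟪R, v₄⟫ = ⟪s₂, v₂⟫ - α * ⟪s₂, v₄⟫ + β * ‖v₃‖ ^ 2 + γ * ‖v₄‖ ^ 2 ∧
    ‖s₀ - α • s₂‖ ^ 2 = ‖s₀‖ ^ 2 + 2 * α * ‖s₁‖ ^ 2 + α ^ 2 * ‖s₂‖ ^ 2 := by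
  intro R
  have h₀ := h₀.isShiftDeriv
  have h₁ := h₁.isShiftDeriv
  have h₂ := h₂.isShiftDeriv
  have h₃ := h₃.isShiftDeriv
  have k₀ := k₀.isShiftDeriv
  have k₁ := k₁.isShiftDeriv
  have a1 : ⟪s₂, v₀⟫ = -⟪s₁, v₁⟫ := k₁.inner_eq_neg h₀
  have a2 : ⟪v₂, v₀⟫ = -⟪v₁, v₁⟫ := h₁.inner_eq_neg h₀
  have a3 : ⟪v₄, v₀⟫ = ⟪v₂, v₂⟫ := by
    rw [h₃.inner_eq_neg h₀, h₂.inner_eq_neg h₁, neg_neg]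
  have a4 : ⟪s₀, v₂⟫ = -⟪s₁, v₁⟫ := by rw [k₀.inner_eq_neg h₁, neg_neg]
  have a5 : ⟪v₄, v₂⟫ = -⟪v₃, v₃⟫ := h₃.inner_eq_neg h₂
  have a6 : ⟪s₀, v₄⟫ = ⟪s₂, v₂⟫ := by
    have e1 := k₀.inner_eq_neg h₃
    have e2 := k₁.inner_eq_neg h₂
    linarith
  have a7 : ⟪v₂, v₄⟫ = -⟪v₃, v₃⟫ := by rw [h₂.inner_eq_neg h₃, neg_neg]
  have a8 : ⟪s₀, s₂⟫ = -⟪s₁, s₁⟫ := by rw [k₀.inner_eq_neg k₁, neg_neg]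
  refine ⟨?_, ?_, ?_, ?_⟩
  · simp only [R, inner_add_left, inner_sub_left, real_inner_smul_left, a1, a2, a3,
      real_inner_self_eq_norm_sq]
    ring
  · simp only [R, inner_add_left, inner_sub_left, real_inner_smul_left, a4, a5,
      real_inner_self_eq_norm_sq]
    ring
  · simp only [R, inner_add_left, inner_sub_left, real_inner_smul_left, a6, a7,
      real_inner_self_eq_norm_sq]
    ring
  · rw [norm_sub_sq_real, real_inner_smul_right, a8, norm_smul, mul_pow, Real.norm_eq_abs, sq_abs,
      real_inner_self_eq_norm_sq]
    ring

/-! ## Energy estimates -/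

namespace SobolevCurve

variable {T : ℝ} {v₀ v₁ v₂ v₃ v₄ s₀ s₁ s₂ : ℝ → L2}

theorem restrict_le {t : ℝ} (ht : t ∈ Icc 0 T) :
    (volume : Measure ℝ).restrict (Ioo 0 t) ≤ volume.restrict (Ioo 0 T) :=
  Measure.restrict_mono (Ioo_subset_Ioo le_rfl ht.2) le_rfl

theorem add_add_sq_le (a b c : ℝ) : (a + b + c) ^ 2 ≤ 3 * (a ^ 2 + b ^ 2 + c ^ 2) := by
  linarith [sq_nonneg (a - b), sq_nonneg (a - c), sq_nonneg (b - c)]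

/-- Basic energy estimate. -/
theorem first_energy (S : SobolevCurve T v₀ v₁ v₂ v₃ v₄ s₀ s₁ s₂) {α β γ K : ℝ} (hα : 0 < α)
    (hβ : 0 < β) (hγ : 0 < γ) {h : ℝ → ℝ} (hc : Continuous h) (h0 : ∀ t, 0 ≤ h t)
    (hK : ∀ t, 0 ≤ t → ∫ τ in (0 : ℝ)..t, h τ ≤ K)
    (hA : ∀ᵐ t ∂volume.restrict (Ioo 0 T),
      ⟪s₀ t - α • s₂ t - β • v₂ t + γ • v₄ t, v₀ t⟫ ≤ h t * ‖v₀ t‖) {t : ℝ} (ht : t ∈ Icc 0 T) :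
    ‖v₀ t‖ ^ 2 + α * ‖v₁ t‖ ^ 2 ≤ 2 * (‖v₀ 0‖ ^ 2 + α * ‖v₁ 0‖ ^ 2) + 4 * K ^ 2 := by
  have hEc : ContinuousOn (fun t => ‖v₀ t‖ ^ 2 + α * ‖v₁ t‖ ^ 2) (Icc 0 T) :=
    (S.cont₀.norm.pow 2).add (continuousOn_const.mul (S.cont₁.norm.pow 2))
  -- The identity is integrated up to the time `r` of maximal energy `m`, so that `‖v₀‖ ≤ √m` on the
  -- whole range of integration and no Gronwall argument is needed.
  obtain ⟨r, hr, hmax⟩ := isCompact_Icc.exists_isMaxOn ⟨t, ht⟩ hEc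
  set m := ‖v₀ r‖ ^ 2 + α * ‖v₁ r‖ ^ 2 with hm
  have hm0 : 0 ≤ m := by positivity
  have hmt : ∀ τ ∈ Icc 0 T, ‖v₀ τ‖ ^ 2 + α * ‖v₁ τ‖ ^ 2 ≤ m := fun τ hτ => hmax hτ
  have hν := restrict_le hr
  have i0 : Integrable (fun τ => ⟪s₀ τ, v₀ τ⟫) (volume.restrict (Ioo 0 r)) :=
    (S.memLp_s₀.integrable_real_inner (memLp_of_continuousOn S.cont₀)).mono_measure hν
  have i1 : Integrable (fun τ => ⟪s₁ τ, v₁ τ⟫) (volume.restrict (Ioo 0 r)) :=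
    (S.memLp_s₁.integrable_real_inner (memLp_of_continuousOn S.cont₁)).mono_measure hν
  have ih : Integrable h (volume.restrict (Ioo 0 r)) :=
    hc.continuousOn.integrableOn_Icc.mono_set Ioo_subset_Icc_self
  have e0 := S.norm_sq₀ hr
  have e1 := S.norm_sq₁ hr
  have hle : ∫ τ in Ioo 0 r, (⟪s₀ τ, v₀ τ⟫ + α * ⟪s₁ τ, v₁ τ⟫) ≤ ∫ τ in Ioo 0 r, √m * h τ := by
    refine integral_mono_ae (i0.fun_add (i1.const_mul α)) (ih.const_mul _) ?_
    filter_upwards [ae_mono hν hA, ae_mono hν S.deriv₃, ae_restrict_mem measurableSet_Ioo]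
      with τ h1 h2 h3
    have hid := (linear_part_identities α β γ (S.deriv₀ τ) (S.deriv₁ τ) (S.deriv₂ τ) h2
      (S.deriv_s₀ τ) (S.deriv_s₁ τ)).1
    rw [hid] at h1
    have h4 : ‖v₀ τ‖ ≤ √m := by
      refine Real.le_sqrt_of_sq_le ?_
      have := hmt τ ⟨h3.1.le, h3.2.le.trans hr.2⟩
      have : 0 ≤ α * ‖v₁ τ‖ ^ 2 := by positivity
      linarith
    have h5 := mul_le_mul_of_nonneg_left h4 (h0 τ)
    have : 0 ≤ β * ‖v₁ τ‖ ^ 2 := by positivity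
    have : 0 ≤ γ * ‖v₂ τ‖ ^ 2 := by positivity
    linarith
  have hKr := hK r hr.1
  rw [intervalIntegral.integral_of_le hr.1, integral_Ioc_eq_integral_Ioo] at hKr
  rw [integral_add i0 (i1.const_mul α), integral_const_mul, integral_const_mul] at hle
  have h1 := mul_le_mul_of_nonneg_left hKr (Real.sqrt_nonneg m)
  have h2 : m ≤ ‖v₀ 0‖ ^ 2 + α * ‖v₁ 0‖ ^ 2 + 2 * (√m * K) := by
    have h2 : m = ‖v₀ 0‖ ^ 2 + 2 * (∫ τ in Ioo 0 r, ⟪s₀ τ, v₀ τ⟫)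
        + α * (‖v₁ 0‖ ^ 2 + 2 * ∫ τ in Ioo 0 r, ⟪s₁ τ, v₁ τ⟫) := by rw [← e0, ← e1]
    linarith
  have h3 := Real.sq_sqrt hm0
  have h4 := hmt t ht
  -- From `m ≤ E(0) + 2√m K`, with `2√m K ≤ m/2 + 2K²`.
  nlinarith [sq_nonneg (√m - 2 * K)]

set_option maxHeartbeats 2000000 in
/-- All the energy estimates, given the sup bound of the basic one. -/
theorem exists_energy_bound {α β γ K c L : ℝ} (hα : 0 < α) (hβ : 0 < β) (hγ : 0 < γ)
    (hK0 : 0 ≤ K) (hc0 : 0 < c) (hL : 0 ≤ L) (M e : ℝ) (hM : 0 ≤ M) :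
    ∃ C ≥ 0, ∀ (T : ℝ) (v₀ v₁ v₂ v₃ v₄ s₀ s₁ s₂ : ℝ → L2)
      (_ : SobolevCurve T v₀ v₁ v₂ v₃ v₄ s₀ s₁ s₂) (h Q : ℝ → ℝ), Continuous h → (∀ t, 0 ≤ h t) →
      (∀ t, h t ≤ K) → (∀ t, 0 ≤ t → ∫ τ in (0 : ℝ)..t, h τ ≤ K) →
      ‖v₀ 0‖ ^ 2 + ‖v₁ 0‖ ^ 2 + ‖v₂ 0‖ ^ 2 + ‖v₃ 0‖ ^ 2 ≤ e →
      (∀ t ∈ Icc 0 T, ‖v₀ t‖ ^ 2 + α * ‖v₁ t‖ ^ 2 ≤ M) →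
      (∀ᵐ t ∂volume.restrict (Ioo 0 T), 0 ≤ Q t ∧
        c * Q t ≤ h t * ‖v₀ t‖ - ⟪s₀ t - α • s₂ t - β • v₂ t + γ • v₄ t, v₀ t⟫ ∧
        ‖s₀ t - α • s₂ t - β • v₂ t + γ • v₄ t‖ ^ 2
          ≤ 2 * h t ^ 2 + L * (‖v₁ t‖ ^ 2 + Q t)) →
      ∀ t ∈ Icc 0 T, ‖v₀ t‖ ^ 2 + ‖v₁ t‖ ^ 2 + ‖v₂ t‖ ^ 2 + ‖v₃ t‖ ^ 2 ≤ C ∧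
        ∫⁻ τ in Ioo 0 t, ENNReal.ofReal (Q τ) ≤ ENNReal.ofReal C ∧
        ∫ τ in Ioo 0 t, (‖v₁ τ‖ ^ 2 + ‖v₂ τ‖ ^ 2 + ‖v₃ τ‖ ^ 2 + ‖v₄ τ‖ ^ 2) ≤ C ∧
        ∫ τ in Ioo 0 t, (‖s₀ τ‖ ^ 2 + ‖s₁ τ‖ ^ 2 + ‖s₂ τ‖ ^ 2) ≤ C := by
  -- `e'` bounds the three initial energies, `M₁` the basic dissipation, `M₂` the integral of the
  -- majorant of `‖R‖²`, `M₃` and `M₄` the estimates obtained from `v₂` and `v₄`, and `M₅` the time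
  -- derivative.
  set e' := |e| * (1 + α)
  have he' : 0 ≤ e' := by positivity
  set M₁ := √M * K + e' / 2
  set M₂ := 2 * K ^ 2 + L * (M₁ / β + M₁ / c)
  set M₃ := e' / 2 + M₂ / 2 + M₁ / γ / 2
  set M₄ := e' / 2 + M₂ / (2 * γ)
  set M₅ := 3 * (M₂ + β ^ 2 * (M₁ / γ) + γ ^ 2 * (2 * M₄ / γ))
  have hM₁ : 0 ≤ M₁ := by positivity
  have hM₂ : 0 ≤ M₂ := by positivity
  have hM₃ : 0 ≤ M₃ := by positivity
  have hM₄ : 0 ≤ M₄ := by positivity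
  have hM₅ : 0 ≤ M₅ := by positivity
  refine ⟨(M + M / α + (2 * M₄ + 2 * M₄ / α)) + M₁ / c + (M₁ / β + M₁ / γ + M₃ / γ + 2 * M₄ / γ)
    + (M₅ + M₅ / (2 * α) + M₅ / α ^ 2), by positivity, ?_⟩
  intro T v₀ v₁ v₂ v₃ v₄ s₀ s₁ s₂ S h Q hc h0 hhK hhI hin hE hQ t ht
  have hν := restrict_le ht
  set ν := (volume : Measure ℝ).restrict (Ioo 0 t)
  have m0 := (memLp_of_continuousOn S.cont₀).mono_measure hν
  have m1 := (memLp_of_continuousOn S.cont₁).mono_measure hν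
  have m2 := (memLp_of_continuousOn S.cont₂).mono_measure hν
  have m3 := (memLp_of_continuousOn S.cont₃).mono_measure hν
  have m4 := S.memLp₄.mono_measure hν
  have n0 := S.memLp_s₀.mono_measure hν
  have n1 := S.memLp_s₁.mono_measure hν
  have n2 := S.memLp_s₂.mono_measure hν
  have hsq : ∀ {u : ℝ → L2}, MemLp u 2 ν → Integrable (fun τ => ‖u τ‖ ^ 2) ν := fun hu =>
    hu.norm.integrable_sq
  have j1 := hsq m1
  have j2 := hsq m2
  have j3 := hsq m3
  have j4 := hsq m4
  have k0 := hsq n0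
  have k1 := hsq n1
  have k2 := hsq n2
  have p00 := n0.integrable_real_inner m0
  have p11 := n1.integrable_real_inner m1
  have p22 := n2.integrable_real_inner m2
  have p24 := n2.integrable_real_inner m4
  have ih : Integrable h ν := hc.continuousOn.integrableOn_Icc.mono_set Ioo_subset_Icc_self
  have ih2 : Integrable (fun τ => h τ ^ 2) ν :=
    (hc.pow 2).continuousOn.integrableOn_Icc.mono_set Ioo_subset_Icc_self
  have hI : ∫ τ, h τ ∂ν ≤ K := by
    have := hhI t ht.1
    rwa [intervalIntegral.integral_of_le ht.1, integral_Ioc_eq_integral_Ioo] at this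
  -- The pointwise and the integral bounds on `h` combine to make it square integrable in time.
  have hI2 : ∫ τ, h τ ^ 2 ∂ν ≤ K ^ 2 := by
    have h1 : ∫ τ, h τ ^ 2 ∂ν ≤ ∫ τ, K * h τ ∂ν :=
      integral_mono ih2 (ih.const_mul K) fun τ => by
        simp only [sq]; exact mul_le_mul_of_nonneg_right (hhK τ) (h0 τ)
    rw [integral_const_mul] at h1
    nlinarith
  have nn : ∀ u : ℝ → L2, 0 ≤ ∫ τ, ‖u τ‖ ^ 2 ∂ν := fun u => integral_nonneg fun τ => by positivity
  have d0 := S.norm_sq₀ ht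
  have d1 := S.norm_sq₁ ht
  have d2 := S.norm_sq₂ ht
  have d3 := S.norm_sq₃ ht
  have hin' : ∀ a b : ℝ, 0 ≤ a → 0 ≤ b → a + b ≤ e → a + α * b ≤ e' := fun a b ha hb hab => by
    have h1 : a + b ≤ |e| := hab.trans (le_abs_self e)
    have h2 : 0 ≤ α * a := by positivity
    have h3 := mul_le_mul_of_nonneg_left h1 hα.le
    simp only [e']
    nlinarith
  have q0 := sq_nonneg ‖v₀ 0‖
  have q1 := sq_nonneg ‖v₁ 0‖
  have q2 := sq_nonneg ‖v₂ 0‖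
  have q3 := sq_nonneg ‖v₃ 0‖
  have E1 : ‖v₀ 0‖ ^ 2 + α * ‖v₁ 0‖ ^ 2 ≤ e' := hin' _ _ q0 q1 (by linarith)
  have E2 : ‖v₁ 0‖ ^ 2 + α * ‖v₂ 0‖ ^ 2 ≤ e' := hin' _ _ q1 q2 (by linarith)
  have E3 : ‖v₂ 0‖ ^ 2 + α * ‖v₃ 0‖ ^ 2 ≤ e' := hin' _ _ q2 q3 (by linarith)
  set R : ℝ → L2 := fun t => s₀ t - α • s₂ t - β • v₂ t + γ • v₄ t
  -- `Q` is not assumed measurable in time. It is replaced throughout by the integrable majorant `Y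
  -- / c`, the defect in the basic energy balance.
  set Y : ℝ → ℝ := fun τ => √M * h τ - (⟪s₀ τ, v₀ τ⟫ + α * ⟪s₁ τ, v₁ τ⟫)
    - (β * ‖v₁ τ‖ ^ 2 + γ * ‖v₂ τ‖ ^ 2)
  have iX1 : Integrable (fun τ => ⟪s₀ τ, v₀ τ⟫ + α * ⟪s₁ τ, v₁ τ⟫) ν := p00.fun_add (p11.const_mul α)
  have iD1 : Integrable (fun τ => β * ‖v₁ τ‖ ^ 2 + γ * ‖v₂ τ‖ ^ 2) ν :=
    (j1.const_mul β).fun_add (j2.const_mul γ)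
  have iHX : Integrable (fun τ => √M * h τ - (⟪s₀ τ, v₀ τ⟫ + α * ⟪s₁ τ, v₁ τ⟫)) ν :=
    (ih.const_mul _).sub iX1
  have i24 : Integrable (fun τ => ⟪s₂ τ, v₂ τ⟫ - α * ⟪s₂ τ, v₄ τ⟫) ν :=
    p22.sub (p24.const_mul α)
  have iY : Integrable Y ν := iHX.sub iD1
  have hYint : ∫ τ, Y τ ∂ν = √M * ∫ τ, h τ ∂ν - ((∫ τ, ⟪s₀ τ, v₀ τ⟫ ∂ν) + α * ∫ τ, ⟪s₁ τ, v₁ τ⟫ ∂ν)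
      - (β * ∫ τ, ‖v₁ τ‖ ^ 2 ∂ν + γ * ∫ τ, ‖v₂ τ‖ ^ 2 ∂ν) := by
    simp only [Y]
    rw [integral_sub iHX iD1, integral_sub (ih.const_mul _) iX1,
      integral_add p00 (p11.const_mul α), integral_add (j1.const_mul β) (j2.const_mul γ)]
    simp only [integral_const_mul]
  have hYQ : ∀ᵐ τ ∂ν, 0 ≤ Q τ ∧ Q τ ≤ Y τ / c ∧ ‖R τ‖ ^ 2
      ≤ 2 * h τ ^ 2 + L * (‖v₁ τ‖ ^ 2 + Y τ / c) := by
    filter_upwards [ae_mono hν hQ, ae_mono hν S.deriv₃, ae_restrict_mem measurableSet_Ioo]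
      with τ h1 h2 h3
    have hid := (linear_part_identities α β γ (S.deriv₀ τ) (S.deriv₁ τ) (S.deriv₂ τ) h2
      (S.deriv_s₀ τ) (S.deriv_s₁ τ)).1
    rw [hid] at h1
    have h4 : ‖v₀ τ‖ ≤ √M := by
      refine Real.le_sqrt_of_sq_le ?_
      have := hE τ ⟨h3.1.le, h3.2.le.trans ht.2⟩
      have : 0 ≤ α * ‖v₁ τ‖ ^ 2 := by positivity
      linarith
    have h5 := mul_le_mul_of_nonneg_left h4 (h0 τ)
    have h6 : Q τ ≤ Y τ / c := by
      rw [le_div_iff₀ hc0]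
      simp only [Y]
      linarith [h1.2.1]
    refine ⟨h1.1, h6, h1.2.2.trans ?_⟩
    gcongr
  have hY0 : 0 ≤ ∫ τ, Y τ ∂ν := integral_nonneg_of_ae (hYQ.mono fun τ hτ => by
    have := hτ.1.trans hτ.2.1
    rw [le_div_iff₀ hc0, zero_mul] at this
    exact this)
  have hfirst : (∫ τ, Y τ ∂ν) + β * ∫ τ, ‖v₁ τ‖ ^ 2 ∂ν + γ * ∫ τ, ‖v₂ τ‖ ^ 2 ∂ν ≤ M₁ := by
    have h1 := mul_le_mul_of_nonneg_left hI (Real.sqrt_nonneg M)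
    have h2 : 0 ≤ ‖v₀ t‖ ^ 2 + α * ‖v₁ t‖ ^ 2 := by positivity
    rw [d0, d1] at h2
    simp only [M₁]
    linarith
  have hV1 : ∫ τ, ‖v₁ τ‖ ^ 2 ∂ν ≤ M₁ / β := by
    rw [le_div_iff₀ hβ]
    have := mul_nonneg hγ.le (nn v₂)
    linarith
  have hV2 : ∫ τ, ‖v₂ τ‖ ^ 2 ∂ν ≤ M₁ / γ := by
    rw [le_div_iff₀ hγ]
    have := mul_nonneg hβ.le (nn v₁)
    linarith
  have hYb : ∫ τ, Y τ / c ∂ν ≤ M₁ / c := by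
    rw [integral_div]
    have := mul_nonneg hγ.le (nn v₂)
    have := mul_nonneg hβ.le (nn v₁)
    exact div_le_div_of_nonneg_right (by linarith) hc0.le
  set ρ : ℝ → ℝ := fun τ => 2 * h τ ^ 2 + L * (‖v₁ τ‖ ^ 2 + Y τ / c)
  have iρ : Integrable ρ ν := (ih2.const_mul 2).fun_add ((j1.fun_add (iY.div_const c)).const_mul L)
  have hρ : ∫ τ, ρ τ ∂ν ≤ M₂ := by
    simp only [ρ]
    rw [integral_add (ih2.const_mul 2) ((j1.fun_add (iY.div_const c)).const_mul L),
      integral_const_mul, integral_const_mul, integral_add j1 (iY.div_const c)]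
    have := mul_le_mul_of_nonneg_left (add_le_add hV1 hYb) hL
    simp only [M₂]
    linarith
  have hsecond : (‖v₁ t‖ ^ 2 + α * ‖v₂ t‖ ^ 2) / 2 + β * ∫ τ, ‖v₂ τ‖ ^ 2 ∂ν
      + γ * ∫ τ, ‖v₃ τ‖ ^ 2 ∂ν ≤ M₃ := by
    -- Young's inequality on `⟪R, v₂⟫`; the resulting `‖v₂‖²` is already integrable in time by the
    -- basic estimate, so no absorption is required.
    have h1 : ∫ τ, ((⟪s₁ τ, v₁ τ⟫ + α * ⟪s₂ τ, v₂ τ⟫) + (β * ‖v₂ τ‖ ^ 2 + γ * ‖v₃ τ‖ ^ 2)) ∂ν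
        ≤ ∫ τ, (ρ τ / 2 + ‖v₂ τ‖ ^ 2 / 2) ∂ν := by
      refine integral_mono_ae ((p11.fun_add (p22.const_mul α)).add
        ((j2.const_mul β).fun_add (j3.const_mul γ))) ((iρ.div_const 2).fun_add (j2.div_const 2)) ?_
      filter_upwards [hYQ, ae_mono hν S.deriv₃] with τ g1 g2
      have hid := (linear_part_identities α β γ (S.deriv₀ τ) (S.deriv₁ τ) (S.deriv₂ τ) g2
        (S.deriv_s₀ τ) (S.deriv_s₁ τ)).2.1
      have hcs := neg_le_of_abs_le (abs_real_inner_le_norm (R τ) (v₂ τ))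
      have hid' : ⟪R τ, v₂ τ⟫ = _ := hid
      rw [hid'] at hcs
      have g3 : ‖R τ‖ ^ 2 ≤ ρ τ := g1.2.2
      have g4 := two_mul_le_add_sq ‖R τ‖ ‖v₂ τ‖
      linarith
    rw [integral_add (p11.fun_add (p22.const_mul α)) ((j2.const_mul β).fun_add (j3.const_mul γ)),
      integral_add (iρ.div_const 2) (j2.div_const 2), integral_add p11 (p22.const_mul α),
      integral_add (j2.const_mul β) (j3.const_mul γ)] at h1
    simp only [integral_const_mul, integral_div] at h1
    rw [d1, d2]
    simp only [M₃]
    linarith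
  have hV3 : ∫ τ, ‖v₃ τ‖ ^ 2 ∂ν ≤ M₃ / γ := by
    rw [le_div_iff₀ hγ]
    have := mul_nonneg hβ.le (nn v₂)
    have : 0 ≤ (‖v₁ t‖ ^ 2 + α * ‖v₂ t‖ ^ 2) / 2 := by positivity
    linarith
  have hthird : (‖v₂ t‖ ^ 2 + α * ‖v₃ t‖ ^ 2) / 2 + γ / 2 * ∫ τ, ‖v₄ τ‖ ^ 2 ∂ν ≤ M₄ := by
    have h1 : ∫ τ, (⟪s₂ τ, v₂ τ⟫ - α * ⟪s₂ τ, v₄ τ⟫ + γ / 2 * ‖v₄ τ‖ ^ 2) ∂ν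
        ≤ ∫ τ, ρ τ / (2 * γ) ∂ν := by
      refine integral_mono_ae (i24.fun_add (j4.const_mul _))
        (iρ.div_const _) ?_
      filter_upwards [hYQ, ae_mono hν S.deriv₃] with τ g1 g2
      have hid := (linear_part_identities α β γ (S.deriv₀ τ) (S.deriv₁ τ) (S.deriv₂ τ) g2
        (S.deriv_s₀ τ) (S.deriv_s₁ τ)).2.2.1
      have hcs := le_of_abs_le (abs_real_inner_le_norm (R τ) (v₄ τ))
      have hid' : ⟪R τ, v₄ τ⟫ = _ := hid
      rw [hid'] at hcs
      have g3 := g1.2.2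
      have g4 : 0 ≤ β * ‖v₃ τ‖ ^ 2 := by positivity
      -- Here `‖v₄‖²` is not yet controlled: half of `γ‖v₄‖²` absorbs it, whence the weights
      -- `1/(2γ)` and `γ/2`.
      have g5 : ‖R τ‖ * ‖v₄ τ‖ ≤ ‖R τ‖ ^ 2 / (2 * γ) + γ / 2 * ‖v₄ τ‖ ^ 2 := by
        have : ‖R τ‖ ^ 2 / (2 * γ) + γ / 2 * ‖v₄ τ‖ ^ 2 - ‖R τ‖ * ‖v₄ τ‖
            = (‖R τ‖ - γ * ‖v₄ τ‖) ^ 2 / (2 * γ) := by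
          field_simp
          ring
        have : 0 ≤ (‖R τ‖ - γ * ‖v₄ τ‖) ^ 2 / (2 * γ) := by positivity
        linarith
      have g6 : ‖R τ‖ ^ 2 / (2 * γ) ≤ ρ τ / (2 * γ) :=
        div_le_div_of_nonneg_right g3 (by positivity)
      linarith
    rw [integral_add i24 (j4.const_mul _),
      integral_sub p22 (p24.const_mul α)] at h1
    simp only [integral_const_mul, integral_div] at h1
    have h2 : (∫ τ, ρ τ ∂ν) / (2 * γ) ≤ M₂ / (2 * γ) :=
      div_le_div_of_nonneg_right hρ (by positivity)
    rw [d2, d3]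
    simp only [M₄]
    linarith
  have hV4 : ∫ τ, ‖v₄ τ‖ ^ 2 ∂ν ≤ 2 * M₄ / γ := by
    rw [le_div_iff₀ hγ]
    have : 0 ≤ (‖v₂ t‖ ^ 2 + α * ‖v₃ t‖ ^ 2) / 2 := by positivity
    linarith
  have htime : (∫ τ, ‖s₀ τ‖ ^ 2 ∂ν) + 2 * α * ∫ τ, ‖s₁ τ‖ ^ 2 ∂ν + α ^ 2 * ∫ τ, ‖s₂ τ‖ ^ 2 ∂ν
      ≤ M₅ := by
    have h1 : ∫ τ, (‖s₀ τ‖ ^ 2 + 2 * α * ‖s₁ τ‖ ^ 2 + α ^ 2 * ‖s₂ τ‖ ^ 2) ∂ν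
        ≤ ∫ τ, 3 * (ρ τ + β ^ 2 * ‖v₂ τ‖ ^ 2 + γ ^ 2 * ‖v₄ τ‖ ^ 2) ∂ν := by
      refine integral_mono_ae ((k0.fun_add (k1.const_mul _)).fun_add (k2.const_mul _))
        (((iρ.fun_add (j2.const_mul _)).fun_add (j4.const_mul _)).const_mul 3) ?_
      filter_upwards [hYQ, ae_mono hν S.deriv₃] with τ g1 g2
      have hid := (linear_part_identities α β γ (S.deriv₀ τ) (S.deriv₁ τ) (S.deriv₂ τ) g2
        (S.deriv_s₀ τ) (S.deriv_s₁ τ)).2.2.2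
      have g3 := g1.2.2
      -- `s₀ - α s₂` is isolated from `R`; its squared norm expands, by integration by parts, into a
      -- positive combination of `‖s₀‖²`, `‖s₁‖²` and `‖s₂‖²`.
      have g4 : ‖s₀ τ - α • s₂ τ‖ ≤ ‖R τ‖ + β * ‖v₂ τ‖ + γ * ‖v₄ τ‖ := by
        have e : s₀ τ - α • s₂ τ = R τ + β • v₂ τ - γ • v₄ τ := by simp only [R]; abel
        rw [e]
        refine (norm_sub_le _ _).trans (add_le_add ((norm_add_le _ _).trans ?_) ?_)
        · rw [norm_smul, Real.norm_eq_abs, abs_of_pos hβ]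
        · rw [norm_smul, Real.norm_eq_abs, abs_of_pos hγ]
      have g5 := pow_le_pow_left₀ (norm_nonneg _) g4 2
      rw [hid] at g5
      have g6 : (‖R τ‖ + β * ‖v₂ τ‖ + γ * ‖v₄ τ‖) ^ 2
          ≤ 3 * (‖R τ‖ ^ 2 + (β * ‖v₂ τ‖) ^ 2 + (γ * ‖v₄ τ‖) ^ 2) := add_add_sq_le _ _ _
      simp only [mul_pow] at g6
      linarith
    rw [integral_const_mul, integral_add (iρ.fun_add (j2.const_mul _)) (j4.const_mul _),
      integral_add iρ (j2.const_mul _), integral_add (k0.fun_add (k1.const_mul _)) (k2.const_mul _),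
      integral_add k0 (k1.const_mul _)] at h1
    simp only [integral_const_mul] at h1
    have h2 := mul_le_mul_of_nonneg_left hV2 (sq_nonneg β)
    have h3 := mul_le_mul_of_nonneg_left hV4 (sq_nonneg γ)
    simp only [M₅]
    linarith
  have r1 := mul_nonneg (mul_nonneg zero_le_two hα.le) (nn s₁)
  have r2 := mul_nonneg (sq_nonneg α) (nn s₂)
  have hS1 : ∫ τ, ‖s₁ τ‖ ^ 2 ∂ν ≤ M₅ / (2 * α) := by
    rw [le_div_iff₀ (by positivity)]
    linarith [nn s₀]
  have hS2 : ∫ τ, ‖s₂ τ‖ ^ 2 ∂ν ≤ M₅ / α ^ 2 := by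
    rw [le_div_iff₀ (by positivity)]
    linarith [nn s₀]
  have hS0 : ∫ τ, ‖s₀ τ‖ ^ 2 ∂ν ≤ M₅ := by linarith
  have c1 : 0 ≤ M + M / α := by positivity
  have c2 : 0 ≤ 2 * M₄ + 2 * M₄ / α := by positivity
  have c3 : 0 ≤ M₁ / c := by positivity
  have c4 : 0 ≤ M₁ / β + M₁ / γ + M₃ / γ + 2 * M₄ / γ := by positivity
  have c5 : 0 ≤ M₅ + M₅ / (2 * α) + M₅ / α ^ 2 := by positivity
  refine ⟨?_, ?_, ?_, ?_⟩
  · have f0 := hE t ht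
    have f1 : ‖v₀ t‖ ^ 2 ≤ M := by
      have : 0 ≤ α * ‖v₁ t‖ ^ 2 := by positivity
      linarith
    have f2 : ‖v₁ t‖ ^ 2 ≤ M / α := by
      rw [le_div_iff₀ hα]
      linarith [sq_nonneg ‖v₀ t‖]
    have f3 : 0 ≤ γ / 2 * ∫ τ, ‖v₄ τ‖ ^ 2 ∂ν := mul_nonneg (by positivity) (nn v₄)
    have f4 : ‖v₂ t‖ ^ 2 ≤ 2 * M₄ := by
      have : 0 ≤ α * ‖v₃ t‖ ^ 2 := by positivity
      linarith
    have f5 : ‖v₃ t‖ ^ 2 ≤ 2 * M₄ / α := by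
      rw [le_div_iff₀ hα]
      linarith [sq_nonneg ‖v₂ t‖]
    linarith
  · calc ∫⁻ τ in Ioo 0 t, ENNReal.ofReal (Q τ) ≤ ∫⁻ τ in Ioo 0 t, ENNReal.ofReal (Y τ / c) :=
          lintegral_mono_ae (hYQ.mono fun τ hτ => ENNReal.ofReal_le_ofReal hτ.2.1)
      _ = ENNReal.ofReal (∫ τ in Ioo 0 t, Y τ / c) :=
          (ofReal_integral_eq_lintegral_ofReal (iY.div_const c)
            (hYQ.mono fun τ hτ => hτ.1.trans hτ.2.1)).symm
      _ ≤ _ := ENNReal.ofReal_le_ofReal (by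
          have hYb' : ∫ τ in Ioo 0 t, Y τ / c ≤ M₁ / c := hYb
          linarith)
  · rw [integral_add ((j1.fun_add j2).fun_add j3) j4, integral_add (j1.fun_add j2) j3, integral_add j1 j2]
    linarith
  · rw [integral_add (k0.fun_add k1) k2, integral_add k0 k1]
    linarith

end SobolevCurve

/-! ## The a priori estimate -/

theorem L2.norm_le_of_lintegral_le {G : L2} {F : ℝ → ℝ} {h : ℝ} (h0 : 0 ≤ h)
    (hG : G =ᵐ[volume] F) (hF : ∫⁻ x, ENNReal.ofReal (F x ^ 2) ≤ ENNReal.ofReal (h ^ 2)) :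
    ‖G‖ ≤ h := by
  refine (sq_le_sq₀ (norm_nonneg _) h0).1 ?_
  rw [L2.norm_sq_eq_integral, integral_eq_lintegral_of_nonneg_ae
    (Eventually.of_forall fun x => sq_nonneg _) ((Lp.memLp G).integrable_sq.aestronglyMeasurable)]
  refine ENNReal.toReal_le_of_le_ofReal (sq_nonneg h) (le_trans (le_of_eq ?_) hF)
  exact lintegral_congr_ae (hG.mono fun x hx => by simp only [hx])

/-- With `n` the class of `N`, the equation is `R + n = F` in `L²`. Cauchy-Schwarz gives the first
bound and `‖R‖² ≤ 2‖F‖² + 2‖n‖²` the second. -/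
theorem remainder_estimate {α β γ c L h Q A : ℝ} {v₀ v₂ v₄ s₀ s₂ : L2} {N F : ℝ → ℝ}
    (hN : MemLp N 2 volume)
    (heq : ∀ᵐ x, s₀ x + N x - α * s₂ x - β * v₂ x + γ * v₄ x = F x) (h0 : 0 ≤ h)
    (hF : ∫⁻ x, ENNReal.ofReal (F x ^ 2) ≤ ENNReal.ofReal (h ^ 2))
    (h1 : c * Q ≤ ∫ x, N x * v₀ x) (h2 : ∫ x, N x ^ 2 ≤ L * A) :
    c * Q ≤ h * ‖v₀‖ - ⟪s₀ - α • s₂ - β • v₂ + γ • v₄, v₀⟫ ∧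
      ‖s₀ - α • s₂ - β • v₂ + γ • v₄‖ ^ 2 ≤ 2 * h ^ 2 + 2 * L * A := by
  set R : L2 := s₀ - α • s₂ - β • v₂ + γ • v₄ with hR
  set n : L2 := hN.toLp N
  have hn : n =ᵐ[volume] N := hN.coeFn_toLp
  have hG : (R + n : L2) =ᵐ[volume] F := by
    filter_upwards [heq, hn, Lp.coeFn_add R n, Lp.coeFn_add (s₀ - α • s₂ - β • v₂) (γ • v₄),
      Lp.coeFn_sub (s₀ - α • s₂) (β • v₂), Lp.coeFn_sub s₀ (α • s₂), Lp.coeFn_smul α s₂,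
      Lp.coeFn_smul β v₂, Lp.coeFn_smul γ v₄] with x g0 g1 g2 g3 g4 g5 g6 g7 g8
    rw [g2, Pi.add_apply, g1, hR, g3, Pi.add_apply, g4, Pi.sub_apply, g5, Pi.sub_apply, g6, g7, g8,
      ← g0]
    simp only [Pi.smul_apply, smul_eq_mul]
    ring
  have hGn := L2.norm_le_of_lintegral_le h0 hG hF
  have en : ⟪n, v₀⟫ = ∫ x, N x * v₀ x := by
    rw [L2.inner_eq_integral]
    exact integral_congr_ae (hn.mono fun x hx => by simp only [hx])
  have en2 : ‖n‖ ^ 2 = ∫ x, N x ^ 2 := by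
    rw [L2.norm_sq_eq_integral]
    exact integral_congr_ae (hn.mono fun x hx => by simp only [hx])
  refine ⟨?_, ?_⟩
  · have h3 := real_inner_le_norm (R + n) v₀
    rw [inner_add_left, en] at h3
    have h4 := mul_le_mul_of_nonneg_right hGn (norm_nonneg v₀)
    linarith
  · have h3 : ‖R‖ ≤ ‖R + n‖ + ‖n‖ := by
      have := norm_sub_le (R + n) n
      rwa [add_sub_cancel_right] at this
    have h4 := pow_le_pow_left₀ (norm_nonneg _) h3 2
    have h5 := add_sq_le (a := ‖R + n‖) (b := ‖n‖)
    have h6 := pow_le_pow_left₀ (norm_nonneg _) hGn 2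
    rw [en2] at h5
    linarith

theorem integrable_mul_sq {Ux : ℝ → ℝ} {B : ℝ} (hc : Continuous Ux) (h0 : ∀ x, 0 ≤ Ux x)
    (hB : ∀ x, Ux x ≤ B) (v : L2) : Integrable (fun x => Ux x * v x ^ 2) :=
  (Lp.memLp v).integrable_sq.bdd_mul (c := B) hc.aestronglyMeasurable
    (Eventually.of_forall fun x => by rw [Real.norm_eq_abs, abs_of_nonneg (h0 x)]; exact hB x)

theorem eLpNorm_sqrt_mul_sq {Ux : ℝ → ℝ} {B : ℝ} (hc : Continuous Ux) (h0 : ∀ x, 0 ≤ Ux x)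
    (hB : ∀ x, Ux x ≤ B) (v : L2) :
    eLpNorm (fun x => √(Ux x) * v x) 2 volume ^ 2
      = ENNReal.ofReal (∫ x, Ux x * v x ^ 2) := by
  have h := eLpNorm_nnreal_pow_eq_lintegral (μ := (volume : Measure ℝ)) (p := 2)
    (f := fun x => √(Ux x) * v x) (by norm_num)
  simp only [NNReal.coe_ofNat, ENNReal.coe_ofNat, ENNReal.rpow_ofNat] at h
  rw [h, ofReal_integral_eq_lintegral_ofReal (integrable_mul_sq hc h0 hB v)
    (Eventually.of_forall fun x => mul_nonneg (h0 x) (sq_nonneg _))]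
  refine lintegral_congr fun x => ?_
  rw [← ofReal_norm, ← ENNReal.ofReal_pow (norm_nonneg _), Real.norm_eq_abs, sq_abs, mul_pow,
    Real.sq_sqrt (h0 x)]

theorem Sob.enorm_sq {k : ℕ} (v : Sob k) : ‖v‖ₑ ^ 2 = ENNReal.ofReal (∑ j, ‖wd v j‖ ^ 2) := by
  rw [← ofReal_norm, ← ENNReal.ofReal_pow (norm_nonneg _), Sob.norm_sq]

namespace IsSolution

variable {f : ℝ → ℝ} {α β γ δ : ℝ} {U : ℝ → ℝ → ℝ} {T : ℝ} {φ₀ : Sob 3} {φ φx : ℝ → Sob 3}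
  {φt : ℝ → Sob 2}

/-- At almost every time the remainder `F(U) - ∂ₓ(f(φ + U) - f(U))` is controlled by the decay of
the source and by the dissipation. -/
theorem ae_remainder (S : IsSolution f α β γ δ U T φ₀ φ φx φt) {um up B M c L : ℝ} {h : ℝ → ℝ}
    (hprof : ∀ t, 0 ≤ t → ∃ Ux : ℝ → ℝ, (∀ x, HasDerivAt (U t) (Ux x) x) ∧ Continuous Ux ∧
      (∀ x, 0 ≤ Ux x) ∧ (∀ x, Ux x ≤ B) ∧ ∀ x, U t x ∈ Icc um up)
    (h0 : ∀ t, 0 ≤ h t)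
    (hsrc : ∀ t, 0 < t → ∫⁻ x, ENNReal.ofReal (source α β γ δ U t x ^ 2)
      ≤ ENNReal.ofReal (h t ^ 2))
    (hflux : ∀ V Vx : ℝ → ℝ, (∀ x, HasDerivAt V (Vx x) x) → Continuous Vx → (∀ x, 0 ≤ Vx x) →
      (∀ x, Vx x ≤ B) → (∀ x, V x ∈ Icc um up) → ∀ v v₁ v₂ : L2, IsWeakDeriv v v₁ →
      IsWeakDeriv v₁ v₂ → ‖v‖ ^ 2 + ‖v₁‖ ^ 2 ≤ M ^ 2 → ∀ N : ℝ → ℝ,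
      IsWeakDeriv (fun x => f (v x + V x) - f (V x)) N → MemLp N 2 volume ∧
        c * ∫ x, Vx x * v x ^ 2 ≤ ∫ x, N x * v x ∧
        ∫ x, N x ^ 2 ≤ L * (‖v₁‖ ^ 2 + ∫ x, Vx x * v x ^ 2))
    (hbd : ∀ t ∈ Icc 0 T, ‖wd (φ t) 0‖ ^ 2 + ‖wd (φ t) 1‖ ^ 2 ≤ M ^ 2) :
    ∀ᵐ t ∂volume.restrict (Ioo 0 T), 0 ≤ ∫ x, deriv (U t) x * wd (φ t) 0 x ^ 2 ∧
      c * ∫ x, deriv (U t) x * wd (φ t) 0 x ^ 2 ≤ h t * ‖wd (φ t) 0‖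
        - ⟪wd (φt t) 0 - α • wd (φt t) 2 - β • wd (φ t) 2 + γ • wd (φx t) 3, wd (φ t) 0⟫ ∧
      ‖wd (φt t) 0 - α • wd (φt t) 2 - β • wd (φ t) 2 + γ • wd (φx t) 3‖ ^ 2
        ≤ 2 * h t ^ 2 + 2 * L * (‖wd (φ t) 1‖ ^ 2 + ∫ x, deriv (U t) x * wd (φ t) 0 x ^ 2) := by
  filter_upwards [S.equation, ae_restrict_mem measurableSet_Ioo] with t ⟨N, hN, heq⟩ ht
  obtain ⟨Ux, hd, hc, hUx, hB, hI⟩ := hprof t ht.1.le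
  have e : deriv (U t) = Ux := funext fun x => (hd x).deriv
  rw [e]
  obtain ⟨g1, g2, g3⟩ := hflux (U t) Ux hd hc hUx hB hI _ _ _ (isWeakDeriv_wd (φ t) 0)
    (isWeakDeriv_wd (φ t) 1) (hbd t (Ioo_subset_Icc_self ht)) N hN
  exact ⟨integral_nonneg fun x => mul_nonneg (hUx x) (sq_nonneg _),
    remainder_estimate g1 heq (h0 t) (hsrc t ht.1) g2 g3⟩

theorem enorm_sum_le {C t : ℝ} (hT : 0 < T) (S : IsSolution f α β γ δ U T φ₀ φ φx φt) {um up B : ℝ}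
    (hprof : ∀ t, 0 ≤ t → ∃ Ux : ℝ → ℝ, (∀ x, HasDerivAt (U t) (Ux x) x) ∧ Continuous Ux ∧
      (∀ x, 0 ≤ Ux x) ∧ (∀ x, Ux x ≤ B) ∧ ∀ x, U t x ∈ Icc um up) (ht : t ∈ Icc 0 T)
    (h₁ : ‖wd (φ t) 0‖ ^ 2 + ‖wd (φ t) 1‖ ^ 2 + ‖wd (φ t) 2‖ ^ 2 + ‖wd (φ t) 3‖ ^ 2 ≤ C)
    (h₂ : ∫⁻ τ in Ioo 0 t, ENNReal.ofReal (∫ x, deriv (U τ) x * wd (φ τ) 0 x ^ 2)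
      ≤ ENNReal.ofReal C)
    (h₃ : ∫ τ in Ioo 0 t, (‖wd (φ τ) 1‖ ^ 2 + ‖wd (φ τ) 2‖ ^ 2 + ‖wd (φ τ) 3‖ ^ 2
      + ‖wd (φx τ) 3‖ ^ 2) ≤ C)
    (h₄ : ∫ τ in Ioo 0 t, (‖wd (φt τ) 0‖ ^ 2 + ‖wd (φt τ) 1‖ ^ 2 + ‖wd (φt τ) 2‖ ^ 2) ≤ C) :
    ‖φ t‖ₑ ^ 2
      + (∫⁻ τ in Ioo 0 t, eLpNorm (fun x => √(deriv (U τ) x) * wd (φ τ) 0 x) 2 volume ^ 2)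
      + (∫⁻ τ in Ioo 0 t, ‖φx τ‖ₑ ^ 2) + (∫⁻ τ in Ioo 0 t, ‖φt τ‖ₑ ^ 2)
      ≤ ENNReal.ofReal C + ENNReal.ofReal C + ENNReal.ofReal C + ENNReal.ofReal C := by
  obtain ⟨-, hx⟩ := S.exists_sobolevCurve hT
  have hν := SobolevCurve.restrict_le ht
  refine add_le_add (add_le_add (add_le_add ?_ ?_) ?_) ?_
  · rw [Sob.enorm_sq, Fin.sum_univ_four]
    exact ENNReal.ofReal_le_ofReal h₁
  · refine le_trans (le_of_eq (setLIntegral_congr_fun measurableSet_Ioo fun τ hτ => ?_)) h₂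
    obtain ⟨Ux, hd, hc, hUx, hB, -⟩ := hprof τ hτ.1.le
    have e : deriv (U τ) = Ux := funext fun x => (hd x).deriv
    simp only [e]
    exact eLpNorm_sqrt_mul_sq hc hUx hB _
  · have hi := ((memLp_two_iff_integrable_sq_norm S.memLp_dx.1).1 S.memLp_dx).mono_measure hν
    simp only [Sob.norm_sq] at hi
    simp only [Sob.enorm_sq]
    rw [← ofReal_integral_eq_lintegral_ofReal hi (Eventually.of_forall fun τ => by positivity)]
    refine ENNReal.ofReal_le_ofReal (le_trans (le_of_eq (integral_congr_ae ?_)) h₃)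
    filter_upwards [ae_mono hν hx] with τ hτ
    rw [Fin.sum_univ_four, hτ.1, hτ.2.1, hτ.2.2]
  · have hi := ((memLp_two_iff_integrable_sq_norm S.memLp_dt.1).1 S.memLp_dt).mono_measure hν
    simp only [Sob.norm_sq] at hi
    simp only [Sob.enorm_sq]
    rw [← ofReal_integral_eq_lintegral_ofReal hi (Eventually.of_forall fun τ => by positivity)]
    refine ENNReal.ofReal_le_ofReal (le_trans (le_of_eq (integral_congr_ae ?_)) h₄)
    exact Eventually.of_forall fun τ => Fin.sum_univ_three _

end IsSolution

end BBMB

end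

theorem theorem3p3 (f : ℝ → ℝ) (hf : ContDiff ℝ 5 f) (hconv : ∀ u, 0 < iteratedDeriv 2 f u)
    (um up : ℝ) (hu : um < up) (α β γ δ : ℝ) (hα : 0 < α) (hβ : 0 < β) (hγ : 0 < γ)
    (ε q : ℝ) (hε : 0 < ε) (hq : 1 / 2 < q) (φ₀ : BBMB.Sob 3) :
    ∃ C : ℝ≥0, 0 < C ∧ ∀ T : ℝ, 0 < T →
      ∀ (φ φx : ℝ → BBMB.Sob 3) (φt : ℝ → BBMB.Sob 2),
        BBMB.IsSolution f α β γ δ (BBMB.rarefaction f um up ε q) T φ₀ φ φx φt →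
        ∀ t ∈ Icc (0 : ℝ) T,
          ‖φ t‖ₑ ^ 2
            + (∫⁻ τ in Ioo 0 t,
                eLpNorm (fun x => √(deriv (BBMB.rarefaction f um up ε q τ) x)
                  * BBMB.wd (φ τ) 0 x) 2 volume ^ 2)
            + (∫⁻ τ in Ioo 0 t, ‖φx τ‖ₑ ^ 2)
            + (∫⁻ τ in Ioo 0 t, ‖φt τ‖ₑ ^ 2) ≤ (C : ℝ≥0∞) := by
  obtain ⟨B, hprof⟩ := BBMB.rarefaction_profile (um := um) (up := up) hf hconv hu hε hq
  obtain ⟨h, K, hhc, hh0, hhK, hhI, hsrc⟩ :=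
    BBMB.source_decay (um := um) (up := up) hf hconv hu hε hq α β γ δ
  have hf2 : ContDiff ℝ 2 f := hf.of_le (by norm_num)
  set m := 2 * (‖BBMB.wd φ₀ 0‖ ^ 2 + α * ‖BBMB.wd φ₀ 1‖ ^ 2) + 4 * K ^ 2
  have hm : 0 ≤ m := by positivity
  have hM : 0 ≤ m + m / α := by positivity
  -- These are the uniform flux constants: the radius is computed from `m`, the a priori energy
  -- bound, which depends on the initial datum but not on the solution or `T`.
  obtain ⟨c, hc, L, hL, hflux⟩ :=
    BBMB.flux_estimate hf2 hconv um up B √(m + m / α) hu.le (Real.sqrt_nonneg _)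
  obtain ⟨C, hC, hE⟩ := BBMB.SobolevCurve.exists_energy_bound (K := K) (L := 2 * L) hα hβ hγ
    ((hh0 0).trans (hhK 0)) hc (by positivity) m (‖φ₀‖ ^ 2) hm
  refine ⟨(4 * C + 1).toNNReal, Real.toNNReal_pos.2 (by positivity), ?_⟩
  intro T hT φ φx φt S t ht
  obtain ⟨Sc, -⟩ := S.exists_sobolevCurve hT
  have hfirst : ∀ t ∈ Icc 0 T, ‖BBMB.wd (φ t) 0‖ ^ 2 + α * ‖BBMB.wd (φ t) 1‖ ^ 2 ≤ m := by
    intro t ht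
    have hcont : ContinuousOn (fun t => ‖BBMB.wd (φ t) 0‖ ^ 2 + ‖BBMB.wd (φ t) 1‖ ^ 2)
        (Icc 0 T) := (Sc.cont₀.norm.pow 2).add (Sc.cont₁.norm.pow 2)
    obtain ⟨b, hb⟩ := isCompact_Icc.exists_bound_of_continuousOn hcont
    -- A preliminary use of the flux estimate, with a radius taken from the solution itself. Its
    -- constants depend on the solution, but only the positivity of `c'` is used, so the resulting
    -- energy bound `m` does not. This avoids circularity with the uniform constants.
    obtain ⟨c', hc', L', -, hflux'⟩ :=
      BBMB.flux_estimate hf2 hconv um up B √b hu.le (Real.sqrt_nonneg _)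
    have hb' : ∀ t ∈ Icc 0 T, ‖BBMB.wd (φ t) 0‖ ^ 2 + ‖BBMB.wd (φ t) 1‖ ^ 2 ≤ √b ^ 2 := by
      intro t ht
      have h1 := (le_abs_self _).trans (hb t ht)
      rwa [Real.sq_sqrt (by linarith [sq_nonneg ‖BBMB.wd (φ t) 0‖, sq_nonneg ‖BBMB.wd (φ t) 1‖])]
    have hA := S.ae_remainder hprof hh0 hsrc hflux' hb'
    have := Sc.first_energy hα hβ hγ hhc hh0 hhI (hA.mono fun t ht => by
      have := mul_nonneg hc'.le ht.1
      linarith [ht.2.1]) ht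
    simpa only [S.initial] using this
  have hbd : ∀ t ∈ Icc 0 T,
      ‖BBMB.wd (φ t) 0‖ ^ 2 + ‖BBMB.wd (φ t) 1‖ ^ 2 ≤ √(m + m / α) ^ 2 := by
    intro t ht
    have h1 := hfirst t ht
    have h2 : 0 ≤ α * ‖BBMB.wd (φ t) 1‖ ^ 2 := by positivity
    -- The weighted energy bound yields the unweighted `H¹` bound `m + m / α` for which the uniform
    -- flux constants were chosen.
    have h3 : ‖BBMB.wd (φ t) 1‖ ^ 2 ≤ m / α := by
      rw [le_div_iff₀ hα]
      linarith [sq_nonneg ‖BBMB.wd (φ t) 0‖]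
    rw [Real.sq_sqrt hM]
    linarith
  have hin : ‖BBMB.wd (φ 0) 0‖ ^ 2 + ‖BBMB.wd (φ 0) 1‖ ^ 2 + ‖BBMB.wd (φ 0) 2‖ ^ 2
      + ‖BBMB.wd (φ 0) 3‖ ^ 2 ≤ ‖φ₀‖ ^ 2 := by
    rw [BBMB.Sob.norm_sq, Fin.sum_univ_four, S.initial]
  obtain ⟨h₁, h₂, h₃, h₄⟩ := hE T _ _ _ _ _ _ _ _ Sc h
    (fun t => ∫ x, deriv (BBMB.rarefaction f um up ε q t) x * BBMB.wd (φ t) 0 x ^ 2) hhc hh0 hhK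
    hhI hin hfirst (S.ae_remainder hprof hh0 hsrc hflux hbd) t ht
  refine (S.enorm_sum_le hT hprof ht h₁ h₂ h₃ h₄).trans ?_
  rw [← ENNReal.ofReal_add hC hC, ← ENNReal.ofReal_add (by positivity) hC,
    ← ENNReal.ofReal_add (by positivity) hC]
  exact ENNReal.ofReal_le_ofReal (by linarith)
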